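/- Let $\mathbb{H}=\{\tau\in\mathbb{C}\mid \operatorname{Im}\tau>0\}$, let $q=e^{2\pi i\tau}$ and $q^s=e^{2\pi i s\tau}$ for real $s$, and put $\zeta_n=e^{2\pi i/n}$ and $(q)_\infty=\prod_{n\ge1}(1-q^n)$. All square roots are principal. The seventh order mock theta functions $\mathcal F_0,\mathcal F_1,\mathcal F_2$ are defined for $0<|q|<1$ by $$(q)_\infty \mathcal F_0(q)=\Bigl(\sum_{r,s\ge0}-\sum_{r,s<0}\Bigr)(-1)^{r+s}q^{\frac32r^2+4rs+\frac32s^2+\frac12r+\frac12s},$$ $$(q)_\infty \mathcal F_1(q)=\Bigl(\sum_{r,s\ge0}-\sum_{r,s<0}\Bigr)(-1)^{r+s}q^{\frac32r^2+4rs+\frac32s^2+\frac52r+\frac52s+1},$$ $$(q)_\infty \mathcal F_2(q)=\Bigl(\sum_{r,s\ge0}-\sum_{r,s<0}\Bigr)(-1)^{r+s}q^{\frac32r^2+4rs+\frac32s^2+\frac32r+\frac32s},$$ where $r,s$ run over integers. Put $$F_7(\tau)=\begin{pmatrix}q^{-1/168}\mathcal F_0(q)\\ q^{47/168}\mathcal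 F_2(q)\\ q^{-25/168}\mathcal F_1(q)\end{pmatrix},\qquad M_7=\frac{2}{\sqrt7}\begin{pmatrix}\sin\frac{\pi}{7}&\sin\frac{3\pi}{7}&\sin\frac{2\pi}{7}\\ \sin\frac{3\pi}{7}&-\sin\frac{2\pi}{7}&\sin\frac{\pi}{7}\\ \sin\frac{2\pi}{7}&\sin\frac{\pi}{7}&-\sin\frac{3\pi}{7}\end{pmatrix}.$$ For $a,b\in\mathbb R$ and $\tau\in\mathbb H$ let $g_{a,b}(\tau)=\sum_{\nu\in a+\mathbb Z}\nu\, e^{\pi i\nu^2\tau+2\pi i\nu b}$, and let $$g_7(\tau)=\begin{pmatrix}\zeta_{84}^{-13}\,g_{\frac{13}{42},\frac12}(21\tau)+\zeta_{84}\,g_{\frac{41}{42},\frac12}(21\tau)\\ \zeta_{84}^{73}\,g_{\frac{11}{42},\frac12}(21\tau)+\zeta_{84}^{59}\,g_{\frac{25}{42},\frac12}(21\tau)\\ \zeta_{84}^{61}\,g_{\frac{23}{42},\frac12}(21\tau)+\zeta_{84}^{47}\,g_{\frac{37}{42},\frac12}(21\tau)\end{pmatrix}.$$ **Corollary.** For every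 $\tau\in\mathbb H$, $$F_7(\tau)-\frac{1}{\sqrt{-i\tau}}\,M_7\,F_7\Bigl(-\frac1\tau\Bigr)=i\sqrt{21}\int_0^{i\infty}\frac{g_7(z)}{\sqrt{-i(z+\tau)}}\,dz,$$ where each component of the vector is integrated along the positive imaginary axis and these integrals converge absolutely, and $$F_7(\tau+1)=\begin{pmatrix}\zeta_{168}^{-1}&0&0\\0&\zeta_{168}^{47}&0\\0&0&\zeta_{168}^{-25}\end{pmatrix}F_7(\tau).$$ -/

import Mathlib

open Complex MeasureTheory

noncomputable section

namespace MockTheta7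

/-- The root of unity `ζ_n = e^{2πi/n}`. -/
def zeta (n : ℕ) : ℂ := exp (2 * Real.pi * I / n)

/-- The principal branch of the square root. -/
def csqrt (w : ℂ) : ℂ := w ^ (1 / 2 : ℂ)

/-- The power `q^s = e^{2πi s τ}` for a real exponent `s`, where `q = e^{2πiτ}`. -/
def qpow (s : ℝ) (τ : ℂ) : ℂ := exp (2 * Real.pi * I * s * τ)

/-- `(q)_∞ = ∏_{n ≥ 1} (1 - q^n)`. -/
def qInf (q : ℂ) : ℂ := ∏' n : ℕ, (1 - q ^ (n + 1))

/-- The term `(-1)^{r+s} q^{(3/2) r² + 4rs + (3/2) s² + (l/2) r + (l/2) s}`.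
For odd `l` the numerator of the exponent is even, so the integer division is exact. -/
def heckeTerm (l : ℤ) (q : ℂ) (r s : ℤ) : ℂ :=
  (-1 : ℂ) ^ (r + s) * q ^ ((3 * r ^ 2 + 8 * r * s + 3 * s ^ 2 + l * r + l * s) / 2)

/-- `(∑_{r,s ≥ 0} - ∑_{r,s < 0})` of the terms above. -/
def heckeSum (l : ℤ) (q : ℂ) : ℂ :=
  (∑' p : {p : ℤ × ℤ // 0 ≤ p.1 ∧ 0 ≤ p.2}, heckeTerm l q p.1.1 p.1.2) -
    ∑' p : {p : ℤ × ℤ // p.1 < 0 ∧ p.2 < 0}, heckeTerm l q p.1.1 p.1.2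

/-- The seventh order mock theta function `𝓕₀`. -/
def mockF0 (q : ℂ) : ℂ := heckeSum 1 q / qInf q

/-- The seventh order mock theta function `𝓕₁`
(the exponent of its double series has the additional summand `1`). -/
def mockF1 (q : ℂ) : ℂ := q * heckeSum 5 q / qInf q

/-- The seventh order mock theta function `𝓕₂`. -/
def mockF2 (q : ℂ) : ℂ := heckeSum 3 q / qInf q

/-- The vector `F₇(τ) = (q^{-1/168} 𝓕₀(q), q^{47/168} 𝓕₂(q), q^{-25/168} 𝓕₁(q))`. -/
def F7 (τ : ℂ) : Fin 3 → ℂ :=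
  ![qpow (-1 / 168) τ * mockF0 (qpow 1 τ),
    qpow (47 / 168) τ * mockF2 (qpow 1 τ),
    qpow (-25 / 168) τ * mockF1 (qpow 1 τ)]

/-- The unary theta function `g_{a,b}(τ) = ∑_{ν ∈ a + ℤ} ν e^{πiν²τ + 2πiνb}`. -/
def unaryTheta (a b : ℝ) (τ : ℂ) : ℂ :=
  ∑' n : ℤ, ((a + n : ℝ) : ℂ) *
    exp (Real.pi * I * ((a + n : ℝ) : ℂ) ^ 2 * τ + 2 * Real.pi * I * ((a + n : ℝ) : ℂ) * b)

/-- The vector `g₇` of unary theta functions of weight `3/2`. -/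
def g7 (τ : ℂ) : Fin 3 → ℂ :=
  ![zeta 84 ^ (-13 : ℤ) * unaryTheta (13 / 42) (1 / 2) (21 * τ) +
      zeta 84 * unaryTheta (41 / 42) (1 / 2) (21 * τ),
    zeta 84 ^ 73 * unaryTheta (11 / 42) (1 / 2) (21 * τ) +
      zeta 84 ^ 59 * unaryTheta (25 / 42) (1 / 2) (21 * τ),
    zeta 84 ^ 61 * unaryTheta (23 / 42) (1 / 2) (21 * τ) +
      zeta 84 ^ 47 * unaryTheta (37 / 42) (1 / 2) (21 * τ)]

/-- The real matrix `M₇`, with complex entries. -/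
def M7 : Matrix (Fin 3) (Fin 3) ℂ :=
  ((2 / Real.sqrt 7 : ℝ) : ℂ) •
    (!![Real.sin (Real.pi / 7), Real.sin (3 * Real.pi / 7), Real.sin (2 * Real.pi / 7);
        Real.sin (3 * Real.pi / 7), -Real.sin (2 * Real.pi / 7), Real.sin (Real.pi / 7);
        Real.sin (2 * Real.pi / 7), Real.sin (Real.pi / 7), -Real.sin (3 * Real.pi / 7)].map
      Complex.ofReal)

/-- The diagonal matrix `diag(ζ₁₆₈^{-1}, ζ₁₆₈^{47}, ζ₁₆₈^{-25})`. -/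
def T7 : Matrix (Fin 3) (Fin 3) ℂ :=
  Matrix.diagonal ![zeta 168 ^ (-1 : ℤ), zeta 168 ^ (47 : ℤ), zeta 168 ^ (-25 : ℤ)]

/-- The integrand `g₇(z) / √(-i(z+τ)) dz` (component `j`) on the path `z = it`, `t > 0`,
so that `dz = i dt`. -/
def periodIntegrand (τ : ℂ) (j : Fin 3) (t : ℝ) : ℂ :=
  g7 (I * t) j / csqrt (-I * (I * t + τ)) * I

/-- The vector of integrals `∫_0^{i∞} g₇(z) / √(-i(z+τ)) dz`, component by component. -/
def periodIntegral (τ : ℂ) : Fin 3 → ℂ :=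
  fun j => ∫ t in Set.Ioi (0 : ℝ), periodIntegrand τ j t

end MockTheta7

end

noncomputable section

namespace MockTheta7

/-! The proof is Zwegers' completion of indefinite theta series, carried out on the imaginary axis τ
= iy with real functions and extended to the half plane by the identity theorem.

Completing the square with x = (r, s) + (2j+1)/14·(1, 1) turns the Hecke double sums into theta
series of Q(x) = X² − Y², of signature (1,1), weighted by (sgn x₁ + sgn x₂)/2; the three values j =
0, 1, 2 give 𝓕₀, 𝓕₂, 𝓕₁. Rotating (X, Y) hyperbolically by θ keeps Q and gives the definite majorant
X_θ² + Y_θ². The kernel Σ ± X_θ exp(−2πy(X_θ² + Y_θ²)) is an ordinary convergent theta series, and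
Poisson summation gives its inversion y ↦ 1/y, θ ↦ −θ (`thetaKernel_inv`).

As dY_θ/dθ = X_θ, each term is an exact θ-derivative. Integrated over [−θ₀, θ₀], where ±θ₀ are the
walls of the cone x₁, x₂ ≥ 0, it yields exp(−2πyQ) with the signs replaced by error functions
(`sqrt_mul_integral_thetaTerm`). This completed series inverts exactly (`completedTheta_inv`). It
differs from the original by Gaussian tails, i.e. by integrals over t > y of a theta series attached
to a wall (`hasSum_indefTheta`), which factors as the unary series of g₇ at t times η at iy
(`edgeTheta_eq_mul`).

The kernel with Y_θ in place of X_θ, taken at θ₀, is this wall series at t = y; dividing its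
inversion by that of η gives the inversion of g₇ (`g7Real_inv`), and with it convergence at 0.
Substituting t = 1/s turns the tails at 1/y into the integral over (0, y), so the two error terms
join into one integral over (0, ∞) (`indefTheta_sub_inv`). Division by η gives the corollary on the
axis (`F7_sub_inv_imag`); both sides are holomorphic, so it holds everywhere (`F7_sub_inv`). The
translation law is read off from the q-exponents. -/

/-! ### One-variable Poisson summation and Gaussian bounds -/

lemma tsum_gaussian_poisson {γ : ℝ} (hγ : 0 < γ) (w b : ℝ) :
    ∑' n : ℤ, cexp (-Real.pi * γ * (n + w) ^ 2 + 2 * Real.pi * I * n * b) =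
      (1 / Real.sqrt γ : ℝ) *
        ∑' m : ℤ, cexp (-Real.pi * (m - b) ^ 2 / γ + 2 * Real.pi * I * w * (m - b)) := by
  have h := jacobiTheta₂_functional_equation (I * γ * w + b) (I * γ)
  have hγ0 : (γ : ℂ) ≠ 0 := by exact_mod_cast hγ.ne'
  have e1 : (-I * (I * (γ : ℂ))) = (γ : ℂ) := by linear_combination (-(γ : ℂ)) * I_sq
  have e2 : ((γ : ℂ)) ^ (1 / 2 : ℂ) = (Real.sqrt γ : ℝ) := by
    rw [Real.sqrt_eq_rpow, ofReal_cpow hγ.le]; norm_num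
  rw [e1, e2] at h
  unfold jacobiTheta₂ jacobiTheta₂_term at h
  have l1 : ∀ n : ℤ, cexp (-Real.pi * γ * (n + w) ^ 2 + 2 * Real.pi * I * n * b) =
      cexp (-Real.pi * γ * w ^ 2) *
        cexp (2 * Real.pi * I * n * (I * γ * w + b) + Real.pi * I * n ^ 2 * (I * γ)) := by
    intro n
    rw [← Complex.exp_add]; congr 1
    linear_combination (-2 * Real.pi * n * γ * w - Real.pi * n ^ 2 * γ) * I_sq
  simp_rw [l1, tsum_mul_left, h]
  push_cast
  rw [mul_left_comm, mul_assoc, mul_assoc, ← tsum_mul_left, ← tsum_mul_left]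
  congr 2; ext m
  rw [← Complex.exp_add, ← Complex.exp_add]; congr 1
  field_simp
  ring_nf
  simp only [I_sq]
  ring

/-- The factor n comes from differentiating the theta series in z, so the functional equations of
`jacobiTheta₂'` and `jacobiTheta₂` combine to give this. The linear factor passes to −i/γ times the
dual variable. -/
lemma tsum_linear_gaussian_poisson {γ : ℝ} (hγ : 0 < γ) (w b : ℝ) :
    ∑' n : ℤ, (n + w : ℂ) * cexp (-Real.pi * γ * (n + w) ^ 2 + 2 * Real.pi * I * n * b) =
      -I / γ * ((1 / Real.sqrt γ : ℝ) *
        ∑' m : ℤ, (m - b : ℂ) *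
          cexp (-Real.pi * (m - b) ^ 2 / γ + 2 * Real.pi * I * w * (m - b))) := by
  have h := jacobiTheta₂_functional_equation (I * γ * w + b) (I * γ)
  have h' := jacobiTheta₂'_functional_equation (I * γ * w + b) (I * γ)
  have hγ0 : (γ : ℂ) ≠ 0 := by exact_mod_cast hγ.ne'
  have e1 : (-I * (I * (γ : ℂ))) = (γ : ℂ) := by linear_combination (-(γ : ℂ)) * I_sq
  have e2 : ((γ : ℂ)) ^ (1 / 2 : ℂ) = (Real.sqrt γ : ℝ) := by
    rw [Real.sqrt_eq_rpow, ofReal_cpow hγ.le]; norm_num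
  have hτ : 0 < (I * (γ : ℂ)).im := by simpa using hγ
  have hτ' : 0 < (-1 / (I * (γ : ℂ))).im := by
    have : -1 / (I * (γ : ℂ)) = I * ((1 / γ : ℝ) : ℂ) := by
      push_cast; field_simp; simp
    rw [this]; simpa using hγ
  have s0 := hasSum_jacobiTheta₂_term (I * γ * w + b) hτ
  have s1 := hasSum_jacobiTheta₂'_term (I * γ * w + b) hτ
  have t0 := hasSum_jacobiTheta₂_term ((I * γ * w + b) / (I * γ)) hτ'
  have t1 := hasSum_jacobiTheta₂'_term ((I * γ * w + b) / (I * γ)) hτ'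
  have hpi : (Real.pi : ℂ) ≠ 0 := by exact_mod_cast Real.pi_ne_zero
  have S := ((s1.mul_left (1 / (2 * Real.pi * I))).add (s0.mul_left (w : ℂ))).mul_left
    (cexp (-Real.pi * γ * w ^ 2))
  have T := ((t1.mul_left (1 / (2 * Real.pi * I))).sub (t0.mul_left (b : ℂ))).mul_left
    (cexp (-Real.pi * b ^ 2 / γ - 2 * Real.pi * I * w * b))
  have l1 : ∀ n : ℤ, (n + w : ℂ) * cexp (-Real.pi * γ * (n + w) ^ 2 + 2 * Real.pi * I * n * b) =
      cexp (-Real.pi * γ * w ^ 2) * (1 / (2 * Real.pi * I) *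
        jacobiTheta₂'_term n (I * γ * w + b) (I * γ) +
        w * jacobiTheta₂_term n (I * γ * w + b) (I * γ)) := by
    intro n
    have : cexp (-Real.pi * γ * (n + w) ^ 2 + 2 * Real.pi * I * n * b) =
      cexp (-Real.pi * γ * w ^ 2) * jacobiTheta₂_term n (I * γ * w + b) (I * γ) := by
      unfold jacobiTheta₂_term
      rw [← Complex.exp_add]; congr 1
      linear_combination (-2 * Real.pi * n * γ * w - Real.pi * n ^ 2 * γ) * I_sq
    rw [this, jacobiTheta₂'_term]
    field_simp
  have l2 : ∀ m : ℤ, (m - b : ℂ) *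
          cexp (-Real.pi * (m - b) ^ 2 / γ + 2 * Real.pi * I * w * (m - b)) =
      cexp (-Real.pi * b ^ 2 / γ - 2 * Real.pi * I * w * b) * (1 / (2 * Real.pi * I) *
        jacobiTheta₂'_term m ((I * γ * w + b) / (I * γ)) (-1 / (I * γ)) -
        b * jacobiTheta₂_term m ((I * γ * w + b) / (I * γ)) (-1 / (I * γ))) := by
    intro m
    have : cexp (-Real.pi * (m - b) ^ 2 / γ + 2 * Real.pi * I * w * (m - b)) =
      cexp (-Real.pi * b ^ 2 / γ - 2 * Real.pi * I * w * b) *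
        jacobiTheta₂_term m ((I * γ * w + b) / (I * γ)) (-1 / (I * γ)) := by
      unfold jacobiTheta₂_term
      rw [← Complex.exp_add]; congr 1
      field_simp
      ring_nf
    rw [this, jacobiTheta₂'_term]
    field_simp
  rw [tsum_congr l1, S.tsum_eq, tsum_congr l2, T.tsum_eq, h', h, e1, e2]
  have e3 : cexp (-Real.pi * γ * w ^ 2) * cexp (-Real.pi * I * (I * γ * w + b) ^ 2 / (I * γ)) =
      cexp (-Real.pi * b ^ 2 / γ - 2 * Real.pi * I * w * b) := by
    rw [← Complex.exp_add]; congr 1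
    field_simp
    ring_nf
    simp only [I_sq]
    ring
  rw [← e3]
  push_cast
  have hs : (Real.sqrt γ : ℂ) ≠ 0 := by exact_mod_cast (Real.sqrt_pos.mpr hγ).ne'
  field_simp
  ring_nf
  simp only [I_sq, I_pow_three]
  ring

lemma summable_exp_neg_mul_sq {c : ℝ} (hc : 0 < c) (a : ℝ) :
    Summable fun n : ℤ => Real.exp (-c * (n + a) ^ 2) := by
  have h := summable_pow_mul_jacobiTheta₂_term_bound (c * |a| / Real.pi)
    (T := c / Real.pi) (by positivity) 0
  refine h.of_nonneg_of_le (fun n => (Real.exp_pos _).le) fun n => ?_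
  rw [pow_zero, one_mul]
  apply Real.exp_le_exp.mpr
  have hpi := Real.pi_pos.ne'
  have e : -Real.pi * (c / Real.pi * n ^ 2 - 2 * (c * |a| / Real.pi) * |n|) =
    -c * n ^ 2 + 2 * c * (|a| * |(n : ℝ)|) := by
    push_cast; field_simp; ring
  rw [e]
  have : -(a * n) ≤ |a| * |(n : ℝ)| := by rw [← abs_mul]; exact neg_le_abs _
  nlinarith [mul_le_mul_of_nonneg_left this hc.le, mul_nonneg hc.le (sq_nonneg a)]

lemma summable_exp_neg_mul_sq_add_sq {c : ℝ} (hc : 0 < c) (a b : ℝ) :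
    Summable fun n : ℤ × ℤ => Real.exp (-c * ((n.1 + a) ^ 2 + (n.2 + b) ^ 2)) := by
  have := (summable_exp_neg_mul_sq hc a).mul_of_nonneg (summable_exp_neg_mul_sq hc b)
    (fun _ => (Real.exp_pos _).le) (fun _ => (Real.exp_pos _).le)
  refine this.congr fun n => ?_
  rw [← Real.exp_add]; congr 1; ring

/-- Half of the Gaussian decay absorbs the linear factor, by |u| + |v| ≤ 1 + u² + v² and 1 + x ≤ eˣ.
-/
lemma linear_mul_exp_le {c : ℝ} (hc : 0 < c) (u v : ℝ) :
    (|u| + |v|) * Real.exp (-c * (u ^ 2 + v ^ 2)) ≤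
      (1 + 2 / c) * Real.exp (-(c / 2) * (u ^ 2 + v ^ 2)) := by
  have e : Real.exp (-c * (u ^ 2 + v ^ 2)) =
      Real.exp (-(c / 2) * (u ^ 2 + v ^ 2)) * Real.exp (-(c / 2 * (u ^ 2 + v ^ 2))) := by
    rw [← Real.exp_add]; congr 1; ring
  have h1 : |u| + |v| ≤ 1 + (u ^ 2 + v ^ 2) := by
    nlinarith [sq_nonneg (|u| - 1), sq_nonneg (|v| - 1), sq_abs u, sq_abs v]
  have h2 : 1 + (u ^ 2 + v ^ 2) ≤ (1 + 2 / c) * Real.exp (c / 2 * (u ^ 2 + v ^ 2)) := by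
    have h3 := Real.add_one_le_exp (c / 2 * (u ^ 2 + v ^ 2))
    have h4 : (1 + 2 / c) * (c / 2 * (u ^ 2 + v ^ 2) + 1) =
      (1 + (u ^ 2 + v ^ 2)) + (c / 2 * (u ^ 2 + v ^ 2) + 2 / c) := by field_simp; ring
    have h5 : 0 ≤ c / 2 * (u ^ 2 + v ^ 2) + 2 / c := by positivity
    have h6 := mul_le_mul_of_nonneg_left h3 (show 0 ≤ 1 + 2 / c by positivity)
    linarith
  rw [e, mul_left_comm, mul_comm (1 + 2 / c)]
  apply mul_le_mul_of_nonneg_left _ (Real.exp_pos _).le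
  rw [Real.exp_neg, ← div_eq_mul_inv, div_le_iff₀ (Real.exp_pos _)]
  exact h1.trans h2

lemma summable_linear_mul_exp_neg_mul_sq {c : ℝ} (hc : 0 < c) (a : ℝ) :
    Summable fun n : ℤ => |(n + a : ℝ)| * Real.exp (-c * (n + a) ^ 2) := by
  refine ((summable_exp_neg_mul_sq (half_pos hc) a).mul_left (1 + 2 / c)).of_nonneg_of_le
    (fun n => by positivity) fun n => ?_
  simpa using linear_mul_exp_le hc (n + a : ℝ) 0

lemma summable_affine_mul_cexp {c : ℝ} (hc : 0 < c) (a : ℝ) (A B : ℂ) {f : ℤ → ℂ}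
    (hf : ∀ n, (f n).re = -c * (n + a) ^ 2) :
    Summable fun n : ℤ => (A * (n + a) + B) * cexp (f n) := by
  refine Summable.of_norm_bounded (((summable_linear_mul_exp_neg_mul_sq hc a).mul_left ‖A‖).add
    ((summable_exp_neg_mul_sq hc a).mul_left ‖B‖)) fun n => ?_
  rw [norm_mul, Complex.norm_exp, hf, ← mul_assoc, ← add_mul]
  gcongr
  refine (norm_add_le _ _).trans (le_of_eq ?_)
  rw [norm_mul, show (n + a : ℂ) = ((n + a : ℝ) : ℂ) by push_cast; rfl, Complex.norm_real,
    Real.norm_eq_abs]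

/-- Poisson summation for an affine function times a Gaussian. -/
lemma tsum_affine_gaussian_poisson {γ : ℝ} (hγ : 0 < γ) (w b : ℝ) (A B : ℂ) :
    ∑' n : ℤ, (A * (n + w) + B) *
        cexp (-Real.pi * γ * (n + w) ^ 2 + 2 * Real.pi * I * n * b) =
      (1 / Real.sqrt γ : ℝ) * ∑' m : ℤ, (-I / γ * A * (m - b) + B) *
        cexp (-Real.pi * (m - b) ^ 2 / γ + 2 * Real.pi * I * w * (m - b)) := by
  have hpi := Real.pi_pos
  have re1 : ∀ n : ℤ, (-Real.pi * γ * (n + w) ^ 2 + 2 * Real.pi * I * n * b : ℂ).re =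
      -(Real.pi * γ) * (n + w) ^ 2 := by
    intro n
    rw [show (-Real.pi * γ * (n + w) ^ 2 + 2 * Real.pi * I * n * b : ℂ) =
      ((-(Real.pi * γ) * (n + w) ^ 2 : ℝ) : ℂ) + ((2 * Real.pi * n * b : ℝ) : ℂ) * I by
        push_cast; ring]
    rw [Complex.add_re, Complex.ofReal_re, Complex.re_ofReal_mul, Complex.I_re]; ring
  have re2 : ∀ m : ℤ,
      (-Real.pi * (m - b) ^ 2 / γ + 2 * Real.pi * I * w * (m - b) : ℂ).re =
      -(Real.pi / γ) * (m + -b) ^ 2 := by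
    intro m
    rw [show (-Real.pi * (m - b) ^ 2 / γ + 2 * Real.pi * I * w * (m - b) : ℂ) =
      ((-(Real.pi / γ) * (m + -b) ^ 2 : ℝ) : ℂ) + ((2 * Real.pi * w * (m - b) : ℝ) : ℂ) * I by
        push_cast; ring]
    rw [Complex.add_re, Complex.ofReal_re, Complex.re_ofReal_mul, Complex.I_re]; ring
  have hγ' : 0 < Real.pi / γ := by positivity
  have s1 := summable_affine_mul_cexp (mul_pos hpi hγ) w 1 0 re1
  have s2 := summable_affine_mul_cexp (mul_pos hpi hγ) w 0 1 re1
  have s3 := summable_affine_mul_cexp hγ' (-b) 1 0 re2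
  have s4 := summable_affine_mul_cexp hγ' (-b) 0 1 re2
  simp only [one_mul, add_zero, zero_mul, zero_add] at s1 s2 s3 s4
  simp only [ofReal_neg, ← sub_eq_add_neg] at s3
  simp_rw [add_mul (A * _) B, add_mul (-I / γ * A * _) B, mul_assoc A, mul_assoc (-I / γ * A)]
  rw [(s1.mul_left A).tsum_add (s2.mul_left B),
    (s3.mul_left (-I / γ * A)).tsum_add (s4.mul_left B)]
  rw [tsum_mul_left, tsum_mul_left, tsum_mul_left, tsum_mul_left,
    tsum_gaussian_poisson hγ, tsum_linear_gaussian_poisson hγ]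
  ring

/-! ### The theta kernel and its majorant -/

/-- The linear form `p X_θ + q Y_θ`, where `(X_θ, Y_θ)` is the hyperbolic rotation by `θ` of
`X = √7 (x₁ + x₂) / 2`, `Y = (x₁ - x₂) / 2`. -/
def thetaLin (p q θ x₁ x₂ : ℝ) : ℝ :=
  (p * Real.cosh θ + q * Real.sinh θ) * (Real.sqrt 7 * ((x₁ + x₂) / 2)) +
    (p * Real.sinh θ + q * Real.cosh θ) * ((x₁ - x₂) / 2)

/-- The majorant `X_θ² + Y_θ²` of the indefinite quadratic form. -/
def thetaMaj (θ x₁ x₂ : ℝ) : ℝ := thetaLin 1 0 θ x₁ x₂ ^ 2 + thetaLin 0 1 θ x₁ x₂ ^ 2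

def thetaTerm (p q y θ x₁ x₂ : ℝ) : ℝ :=
  thetaLin p q θ x₁ x₂ * Real.exp (-(2 * Real.pi * y * thetaMaj θ x₁ x₂))

/-- The shift `(2j+1)/14`. -/
def shift (j : ℤ) : ℝ := (2 * j + 1) / 14

/-- The sign `(-1)^{r+s}`. -/
def latticeSign (n : ℤ × ℤ) : ℝ := (-1) ^ (n.1 + n.2)

/-- The theta kernel `∑ (-1)^{r+s} (p X_θ + q Y_θ) exp(-2πy (X_θ² + Y_θ²))`. -/
def thetaKernel (p q : ℝ) (j : ℤ) (y θ : ℝ) : ℝ :=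
  ∑' n : ℤ × ℤ, latticeSign n * thetaTerm p q y θ (n.1 + shift j) (n.2 + shift j)

lemma abs_latticeSign (n : ℤ × ℤ) : |latticeSign n| = 1 := by
  rw [latticeSign, abs_zpow]; simp

lemma cosh_sq_add_sinh_sq_pos (θ : ℝ) : 0 < Real.cosh θ ^ 2 + Real.sinh θ ^ 2 := by
  have := Real.cosh_pos θ; positivity

lemma thetaMaj_eq (θ x₁ x₂ : ℝ) : thetaMaj θ x₁ x₂ =
    (Real.cosh θ ^ 2 + Real.sinh θ ^ 2) * (7 * ((x₁ + x₂) / 2) ^ 2 + ((x₁ - x₂) / 2) ^ 2) +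
    4 * Real.cosh θ * Real.sinh θ * (Real.sqrt 7 * ((x₁ + x₂) / 2) * ((x₁ - x₂) / 2)) := by
  have h7 : Real.sqrt 7 ^ 2 = 7 := Real.sq_sqrt (by norm_num)
  unfold thetaMaj thetaLin
  linear_combination ((Real.cosh θ ^ 2 + Real.sinh θ ^ 2) * ((x₁ + x₂) / 2) ^ 2) * h7

/-- A hyperbolic rotation by θ shrinks X² + Y² by at most e^{−2|θ|}, and X² + Y² dominates (x₁² +
x₂²)/2. -/
lemma le_thetaMaj (θ x₁ x₂ : ℝ) :
    Real.exp (-(2 * |θ|)) / 2 * (x₁ ^ 2 + x₂ ^ 2) ≤ thetaMaj θ x₁ x₂ := by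
  have h7 : Real.sqrt 7 ^ 2 = 7 := Real.sq_sqrt (by norm_num)
  have hexp : Real.exp (-(2 * |θ|)) = (Real.cosh θ - |Real.sinh θ|) ^ 2 := by
    have : Real.cosh θ - |Real.sinh θ| = Real.exp (-|θ|) := by
      rw [← Real.cosh_sub_sinh, Real.cosh_abs, Real.abs_sinh]
    rw [this, ← Real.exp_nat_mul]; congr 1; push_cast; ring
  rw [thetaMaj_eq, hexp]
  set c := Real.cosh θ
  set s := Real.sinh θ
  have hc : 0 < c := Real.cosh_pos θ
  set X := Real.sqrt 7 * ((x₁ + x₂) / 2) with hX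
  set Y := (x₁ - x₂) / 2 with hY
  have hX2 : 7 * ((x₁ + x₂) / 2) ^ 2 = X ^ 2 := by rw [hX, mul_pow, h7]
  have h1 : (x₁ ^ 2 + x₂ ^ 2) / 2 ≤ X ^ 2 + Y ^ 2 := by
    rw [← hX2, hY]; nlinarith [sq_nonneg (x₁ + x₂)]
  have h2 : (c - |s|) ^ 2 * (X ^ 2 + Y ^ 2) ≤
      (c ^ 2 + s ^ 2) * (X ^ 2 + Y ^ 2) + 4 * c * s * (X * Y) := by
    have hs : |s| ^ 2 = s ^ 2 := sq_abs s
    have : -(|s| * (X ^ 2 + Y ^ 2)) ≤ 2 * s * (X * Y) := by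
      rcases abs_cases s with ⟨h, h'⟩ | ⟨h, h'⟩ <;> rw [h]
      · nlinarith [mul_nonneg h' (sq_nonneg (X + Y))]
      · nlinarith [mul_nonneg (neg_pos.mpr h').le (sq_nonneg (X - Y))]
    nlinarith [mul_le_mul_of_nonneg_left this hc.le]
  rw [hX2]
  have h3 := mul_le_mul_of_nonneg_left h1 (sq_nonneg (c - |s|))
  linarith

lemma abs_thetaLin_le (p q θ x₁ x₂ : ℝ) :
    |thetaLin p q θ x₁ x₂| ≤ 4 * (|p| + |q|) * Real.exp |θ| * (|x₁| + |x₂|) := by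
  have h7 : Real.sqrt 7 ≤ 3 := by
    rw [show (3 : ℝ) = Real.sqrt 9 by rw [show (9:ℝ) = 3 ^ 2 by norm_num]; simp]
    exact Real.sqrt_le_sqrt (by norm_num)
  have hc : |Real.cosh θ| ≤ Real.exp |θ| := by
    rw [abs_of_pos (Real.cosh_pos θ), ← Real.cosh_abs, ← Real.cosh_add_sinh |θ|]
    have := Real.sinh_nonneg_iff.mpr (abs_nonneg θ); linarith
  have hs : |Real.sinh θ| ≤ Real.exp |θ| := by
    rw [Real.abs_sinh, ← Real.cosh_add_sinh |θ|]
    have := Real.cosh_pos |θ|; linarith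
  set E := Real.exp |θ|
  have hE : 0 < E := Real.exp_pos _
  have b1 : |p * Real.cosh θ + q * Real.sinh θ| ≤ (|p| + |q|) * E := by
    refine (abs_add_le _ _).trans ?_
    rw [abs_mul, abs_mul, add_mul]; gcongr
  have b2 : |p * Real.sinh θ + q * Real.cosh θ| ≤ (|p| + |q|) * E := by
    refine (abs_add_le _ _).trans ?_
    rw [abs_mul, abs_mul, add_mul]; gcongr
  have b3 : |Real.sqrt 7 * ((x₁ + x₂) / 2)| ≤ 3 * (|x₁| + |x₂|) := by
    rw [abs_mul, abs_of_nonneg (Real.sqrt_nonneg 7), abs_div, abs_two]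
    have := abs_add_le x₁ x₂
    have h0 := abs_nonneg (x₁ + x₂)
    have := mul_le_mul h7 this h0 (by norm_num)
    linarith [mul_nonneg (Real.sqrt_nonneg 7) h0]
  have b4 : |(x₁ - x₂) / 2| ≤ |x₁| + |x₂| := by
    rw [abs_div, abs_two]
    have := abs_sub x₁ x₂
    linarith [abs_nonneg (x₁ - x₂)]
  unfold thetaLin
  refine (abs_add_le _ _).trans ?_
  rw [abs_mul (p * _ + _), abs_mul (p * _ + _)]
  have hpq : 0 ≤ (|p| + |q|) * E := by positivity
  have c1 := mul_le_mul b1 b3 (abs_nonneg _) hpq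
  have c2 := mul_le_mul b2 b4 (abs_nonneg _) hpq
  linarith

/-- Uniformity in |θ| ≤ T is what permits integrating the kernel term by term in θ. -/
lemma exists_abs_thetaTerm_le (p q : ℝ) {y : ℝ} (hy : 0 < y) (T : ℝ) :
    ∃ K c : ℝ, 0 < c ∧ ∀ θ, |θ| ≤ T → ∀ x₁ x₂,
      |thetaTerm p q y θ x₁ x₂| ≤ K * Real.exp (-c * (x₁ ^ 2 + x₂ ^ 2)) := by
  set c := Real.pi * y * Real.exp (-(2 * T))
  have hc : 0 < c := by positivity
  refine ⟨4 * (|p| + |q|) * Real.exp T * (1 + 2 / c), c / 2, by positivity, fun θ hθ x₁ x₂ => ?_⟩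
  rw [thetaTerm, abs_mul, Real.abs_exp]
  have h1 : |thetaLin p q θ x₁ x₂| ≤ 4 * (|p| + |q|) * Real.exp T * (|x₁| + |x₂|) :=
    (abs_thetaLin_le p q θ x₁ x₂).trans (by gcongr)
  have h2 : Real.exp (-(2 * Real.pi * y * thetaMaj θ x₁ x₂)) ≤
      Real.exp (-c * (x₁ ^ 2 + x₂ ^ 2)) := by
    apply Real.exp_le_exp.mpr
    have h3 := le_thetaMaj θ x₁ x₂
    have h4 : Real.exp (-(2 * T)) ≤ Real.exp (-(2 * |θ|)) := Real.exp_le_exp.mpr (by linarith)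
    have h5 : Real.exp (-(2 * T)) / 2 * (x₁ ^ 2 + x₂ ^ 2) ≤ thetaMaj θ x₁ x₂ :=
      le_trans (by gcongr) h3
    have := mul_le_mul_of_nonneg_left h5 (show 0 ≤ 2 * Real.pi * y by positivity)
    have e : c * (x₁ ^ 2 + x₂ ^ 2) =
      2 * Real.pi * y * (Real.exp (-(2 * T)) / 2 * (x₁ ^ 2 + x₂ ^ 2)) := by
      simp only [c]; ring
    linarith
  calc _ ≤ 4 * (|p| + |q|) * Real.exp T * (|x₁| + |x₂|) * Real.exp (-c * (x₁ ^ 2 + x₂ ^ 2)) :=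
        mul_le_mul h1 h2 (Real.exp_pos _).le (by positivity)
    _ = 4 * (|p| + |q|) * Real.exp T * ((|x₁| + |x₂|) * Real.exp (-c * (x₁ ^ 2 + x₂ ^ 2))) := by
        ring
    _ ≤ 4 * (|p| + |q|) * Real.exp T * ((1 + 2 / c) * Real.exp (-(c / 2) * (x₁ ^ 2 + x₂ ^ 2))) :=
        mul_le_mul_of_nonneg_left (linear_mul_exp_le hc x₁ x₂) (by positivity)
    _ = _ := by ring

lemma summable_thetaTerm (p q : ℝ) {y : ℝ} (hy : 0 < y) (θ a b : ℝ) :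
    Summable fun n : ℤ × ℤ => latticeSign n * thetaTerm p q y θ (n.1 + a) (n.2 + b) := by
  obtain ⟨K, c, hc, h⟩ := exists_abs_thetaTerm_le p q hy |θ|
  refine Summable.of_norm_bounded ((summable_exp_neg_mul_sq_add_sq hc a b).mul_left K) fun n => ?_
  rw [Real.norm_eq_abs, abs_mul, abs_latticeSign, one_mul]
  exact h θ le_rfl _ _

/-! ### Inversion of the theta kernel by Poisson summation in two variables -/

lemma neg_one_zpow_add_self_add (r d : ℤ) : (-1 : ℝ) ^ (r + (r + d)) = (-1) ^ d := by
  rw [← add_assoc, zpow_add₀ (by norm_num), Even.neg_one_zpow ⟨r, rfl⟩, one_mul]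

lemma cexp_pi_mul_I_int (d : ℤ) : cexp (Real.pi * I * d) = (((-1 : ℝ) ^ d : ℝ) : ℂ) := by
  rw [mul_comm (Real.pi * I : ℂ), Complex.exp_int_mul, Complex.exp_pi_mul_I]; push_cast; rfl

/-- The pair `(r, s)` with difference `s - r = d`, as a function of `(d, r)`. -/
def diffEquiv : ℤ × ℤ ≃ ℤ × ℤ where
  toFun n := (n.2, n.2 + n.1)
  invFun n := (n.2 - n.1, n.1)
  left_inv n := by ext <;> simp
  right_inv n := by ext <;> simp

/-- The dual lattice `ℤ × ℤ` split into seven translates of the lattice. -/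
def dualEquiv : Fin 7 × (ℤ × ℤ) ≃ ℤ × ℤ where
  toFun x := (2 * (7 * x.2.1 + x.1) + 1 + 7 * (x.2.2 - x.2.1),
    7 * x.2.1 + x.1 + 1 + 4 * (x.2.2 - x.2.1))
  invFun n := (⟨((n.2 - 1 - 4 * (2 * n.2 - n.1 - 1)) % 7).toNat, by omega⟩,
    ((n.2 - 1 - 4 * (2 * n.2 - n.1 - 1)) / 7,
      (n.2 - 1 - 4 * (2 * n.2 - n.1 - 1)) / 7 + (2 * n.2 - n.1 - 1)))
  left_inv x := by
    obtain ⟨⟨k, hk⟩, r, s⟩ := x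
    simp only [Prod.mk.injEq, Fin.mk.injEq]
    omega
  right_inv n := by
    obtain ⟨m, n⟩ := n
    simp only [Prod.mk.injEq]
    omega

section Poisson

variable (p q : ℝ) (j : ℤ) (y θ : ℝ)

/-- `cosh θ ^ 2 + sinh θ ^ 2 = cosh (2 θ)`. -/
def ch2 : ℝ := Real.cosh θ ^ 2 + Real.sinh θ ^ 2

def sh2 : ℝ := 2 * Real.cosh θ * Real.sinh θ

lemma ch2_pos : 0 < ch2 θ := cosh_sq_add_sinh_sq_pos θ

lemma ch2_sq_sub_sh2_sq : ch2 θ ^ 2 - sh2 θ ^ 2 = 1 := by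
  have := Real.cosh_sq θ
  simp only [ch2, sh2]
  linear_combination (Real.cosh θ ^ 2 - Real.sinh θ ^ 2 + 1) * this

/-- Summand after Poisson summation in the first variable. -/
def halfDualTerm (d m : ℤ) : ℂ :=
  ((-1 : ℝ) ^ d * Real.exp (-(Real.pi * (y / (2 * ch2 θ)) * d ^ 2)) *
    (1 / Real.sqrt (14 * y * ch2 θ)) : ℝ) *
  ((-I / (14 * y * ch2 θ : ℝ) * ((p * Real.cosh θ + q * Real.sinh θ) * Real.sqrt 7 : ℝ) * m +
    ((p * Real.sinh θ - q * Real.cosh θ) * d / (2 * ch2 θ) : ℝ)) *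
  cexp (-Real.pi * m ^ 2 / (14 * y * ch2 θ : ℝ) +
    2 * Real.pi * I * (shift j + d / 2 - sh2 θ * d / (2 * Real.sqrt 7 * ch2 θ) : ℝ) * m))

/-- The dual frequency after Poisson summation in the second variable. -/
def dualFreq (m : ℤ) : ℝ := (m + 1) / 2 - m * sh2 θ / (2 * Real.sqrt 7 * ch2 θ)

/-- Summand after Poisson summation in both variables. -/
def dualTerm (m n : ℤ) : ℂ :=
  -I / (Real.sqrt 7 * y : ℝ) * cexp (2 * Real.pi * I * shift j * m) *
  (((p * Real.cosh θ + q * Real.sinh θ) * Real.sqrt 7 * m / (14 * y * ch2 θ) +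
    (p * Real.sinh θ - q * Real.cosh θ) * (n - dualFreq θ m) / y) *
    Real.exp (-(Real.pi * m ^ 2 / (14 * y * ch2 θ)) -
      Real.pi * (n - dualFreq θ m) ^ 2 / (y / (2 * ch2 θ))) : ℝ)

variable {y}

lemma thetaLin_completed (r d : ℤ) (a : ℝ) :
    thetaLin p q θ (r + a) (r + d + a) =
      (p * Real.cosh θ + q * Real.sinh θ) * Real.sqrt 7 *
        (r + (a + d / 2 - sh2 θ * d / (2 * Real.sqrt 7 * ch2 θ))) +
      (p * Real.sinh θ - q * Real.cosh θ) * d / (2 * ch2 θ) := by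
  have h := ch2_pos θ
  have h7 : (0 : ℝ) < Real.sqrt 7 := by positivity
  have hcs := Real.cosh_sq θ
  have e : ((p * Real.cosh θ + q * Real.sinh θ) * Real.sqrt 7 *
        (r + (a + d / 2 - sh2 θ * d / (2 * Real.sqrt 7 * ch2 θ))) +
      (p * Real.sinh θ - q * Real.cosh θ) * d / (2 * ch2 θ)) =
      (p * Real.cosh θ + q * Real.sinh θ) * Real.sqrt 7 * (r + a + d / 2) -
      (((p * Real.cosh θ + q * Real.sinh θ) * sh2 θ - (p * Real.sinh θ - q * Real.cosh θ)) /
        ch2 θ) * d / 2 := by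
    field_simp; ring
  have e2 : ((p * Real.cosh θ + q * Real.sinh θ) * sh2 θ -
      (p * Real.sinh θ - q * Real.cosh θ)) / ch2 θ = p * Real.sinh θ + q * Real.cosh θ := by
    rw [div_eq_iff h.ne']
    simp only [ch2, sh2]
    linear_combination (p * Real.sinh θ - q * Real.cosh θ) * hcs
  rw [e, e2, thetaLin]; ring

/-- For fixed d = s − r the square is completed in r; the leftover coefficient of d² simplifies
because cosh²(2θ) − sinh²(2θ) = 1. -/
lemma thetaMaj_completed (r d : ℤ) (a : ℝ) :
    2 * thetaMaj θ (r + a) (r + d + a) =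
      14 * ch2 θ * (r + (a + d / 2 - sh2 θ * d / (2 * Real.sqrt 7 * ch2 θ))) ^ 2 +
        d ^ 2 / (2 * ch2 θ) := by
  have h := ch2_pos θ
  have h7 : (0 : ℝ) < Real.sqrt 7 := by positivity
  have h77 : Real.sqrt 7 ^ 2 = 7 := Real.sq_sqrt (by norm_num)
  have hcs := ch2_sq_sub_sh2_sq θ
  rw [thetaMaj_eq]
  have e1 : Real.cosh θ ^ 2 + Real.sinh θ ^ 2 = ch2 θ := rfl
  have e2 : 4 * Real.cosh θ * Real.sinh θ = 2 * sh2 θ := by simp only [sh2]; ring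
  rw [e1, e2]
  have e3 : sh2 θ * d / (2 * Real.sqrt 7 * ch2 θ) = Real.sqrt 7 * sh2 θ * d / (14 * ch2 θ) := by
    field_simp; rw [h77]; ring
  rw [e3]
  field_simp
  linear_combination (-(d : ℝ) ^ 2 * sh2 θ ^ 2 * 4) * h77 + (28 * (d : ℝ) ^ 2) * hcs

lemma tsum_first_variable (hy : 0 < y) (d : ℤ) :
    ((∑' r : ℤ, latticeSign (r, r + d) *
      thetaTerm p q y θ (r + shift j) (r + d + shift j) : ℝ) : ℂ) =
      ∑' m : ℤ, halfDualTerm p q j y θ d m := by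
  have hC := ch2_pos θ
  have hα : 0 < 14 * y * ch2 θ := by positivity
  set w : ℝ := shift j + d / 2 - sh2 θ * d / (2 * Real.sqrt 7 * ch2 θ) with hw
  -- The frequency is 0: for fixed d the sign (−1)^{r+s} = (−1)^d does not depend on r.
  have h := tsum_affine_gaussian_poisson hα w 0
    ((p * Real.cosh θ + q * Real.sinh θ) * Real.sqrt 7 : ℝ)
    ((p * Real.sinh θ - q * Real.cosh θ) * d / (2 * ch2 θ) : ℝ)
  have l : ∀ r : ℤ, ((latticeSign (r, r + d) *
      thetaTerm p q y θ (r + shift j) (r + d + shift j) : ℝ) : ℂ) =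
      ((-1 : ℝ) ^ d * Real.exp (-(Real.pi * (y / (2 * ch2 θ)) * d ^ 2)) : ℝ) *
      ((((p * Real.cosh θ + q * Real.sinh θ) * Real.sqrt 7 : ℝ) * (r + w) +
        ((p * Real.sinh θ - q * Real.cosh θ) * d / (2 * ch2 θ) : ℝ)) *
        cexp (-Real.pi * (14 * y * ch2 θ : ℝ) * (r + w) ^ 2 +
          2 * Real.pi * I * r * (0 : ℝ))) := by
    intro r
    have e1 := thetaMaj_completed θ r d (shift j)
    rw [← hw] at e1
    have e2 : -(2 * Real.pi * y * thetaMaj θ (r + shift j) (r + d + shift j)) =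
        -(Real.pi * (y / (2 * ch2 θ)) * d ^ 2) + -Real.pi * (14 * y * ch2 θ) * (r + w) ^ 2 := by
      have : -(2 * Real.pi * y * thetaMaj θ (r + shift j) (r + d + shift j)) =
        -(Real.pi * y) * (2 * thetaMaj θ (r + shift j) (r + d + shift j)) := by ring
      rw [this, e1]; ring
    have e3 : cexp (-Real.pi * (14 * y * ch2 θ : ℝ) * (r + w) ^ 2 +
        2 * Real.pi * I * r * (0 : ℝ)) =
        ((Real.exp (-Real.pi * (14 * y * ch2 θ) * (r + w) ^ 2) : ℝ) : ℂ) := by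
      push_cast; congr 1; ring
    rw [thetaTerm, thetaLin_completed, ← hw, e2, Real.exp_add, e3, latticeSign]
    simp only [neg_one_zpow_add_self_add]
    push_cast
    ring
  rw [ofReal_tsum, tsum_congr l, tsum_mul_left, h, ← mul_assoc, ← tsum_mul_left]
  refine tsum_congr fun m => ?_
  rw [halfDualTerm, ← hw]
  simp only [ofReal_zero, sub_zero]
  push_cast
  ring

/-- Regrouping as an affine function times a Gaussian in d prepares the second Poisson summation.
Writing (−1)^d = e^{πid} puts the extra 1/2 into `dualFreq`. -/
lemma halfDualTerm_eq (d m : ℤ) : halfDualTerm p q j y θ d m =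
    ((1 / Real.sqrt (14 * y * ch2 θ) : ℝ) *
      cexp (-Real.pi * m ^ 2 / (14 * y * ch2 θ : ℝ) + 2 * Real.pi * I * shift j * m)) *
    (((((p * Real.sinh θ - q * Real.cosh θ) / (2 * ch2 θ) : ℝ) : ℂ) * (d + (0 : ℝ)) +
      -I / (14 * y * ch2 θ : ℝ) * ((p * Real.cosh θ + q * Real.sinh θ) * Real.sqrt 7 : ℝ) * m) *
      cexp (-Real.pi * (y / (2 * ch2 θ) : ℝ) * (d + (0 : ℝ)) ^ 2 +
        2 * Real.pi * I * d * dualFreq θ m)) := by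
  have e : cexp (-Real.pi * m ^ 2 / (14 * y * ch2 θ : ℝ) +
      2 * Real.pi * I * (shift j + d / 2 - sh2 θ * d / (2 * Real.sqrt 7 * ch2 θ) : ℝ) * m) *
      ((((-1 : ℝ) ^ d : ℝ) : ℂ) * ((Real.exp (-(Real.pi * (y / (2 * ch2 θ)) * d ^ 2)) : ℝ) : ℂ)) =
      cexp (-Real.pi * m ^ 2 / (14 * y * ch2 θ : ℝ) + 2 * Real.pi * I * shift j * m) *
      cexp (-Real.pi * (y / (2 * ch2 θ) : ℝ) * (d + (0 : ℝ)) ^ 2 +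
        2 * Real.pi * I * d * dualFreq θ m) := by
    rw [← cexp_pi_mul_I_int, ofReal_exp, ← Complex.exp_add, ← Complex.exp_add, ← Complex.exp_add]
    congr 1
    rw [dualFreq]
    push_cast
    ring
  rw [halfDualTerm]
  rw [mul_mul_mul_comm ((1 / Real.sqrt (14 * y * ch2 θ) : ℝ) : ℂ), ← e]
  push_cast
  ring

lemma sqrt_mul_sqrt_completed (hy : 0 < y) :
    Real.sqrt (14 * y * ch2 θ) * Real.sqrt (y / (2 * ch2 θ)) = Real.sqrt 7 * y := by
  have hC := ch2_pos θ
  rw [← Real.sqrt_mul (by positivity), show 14 * y * ch2 θ * (y / (2 * ch2 θ)) = 7 * y ^ 2 by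
    field_simp; ring, Real.sqrt_mul (by norm_num), Real.sqrt_sq hy.le]

lemma tsum_second_variable (hy : 0 < y) (m : ℤ) :
    ∑' d : ℤ, halfDualTerm p q j y θ d m = ∑' n : ℤ, dualTerm p q j y θ m n := by
  have hC := ch2_pos θ
  have hγ : 0 < y / (2 * ch2 θ) := by positivity
  simp_rw [halfDualTerm_eq, tsum_mul_left]
  rw [tsum_affine_gaussian_poisson hγ 0 (dualFreq θ m), ← mul_assoc, ← tsum_mul_left]
  refine tsum_congr fun n => ?_
  have e : cexp (-Real.pi * m ^ 2 / (14 * y * ch2 θ : ℝ) + 2 * Real.pi * I * shift j * m) *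
      cexp (-Real.pi * (n - dualFreq θ m) ^ 2 / (y / (2 * ch2 θ) : ℝ) +
        2 * Real.pi * I * (0 : ℝ) * (n - dualFreq θ m)) =
      cexp (2 * Real.pi * I * shift j * m) *
      ((Real.exp (-(Real.pi * m ^ 2 / (14 * y * ch2 θ)) -
      Real.pi * (n - dualFreq θ m) ^ 2 / (y / (2 * ch2 θ))) : ℝ) : ℂ) := by
    rw [ofReal_exp, ← Complex.exp_add, ← Complex.exp_add]
    congr 1
    push_cast
    ring
  have e2 : ((1 / Real.sqrt (14 * y * ch2 θ) : ℝ) : ℂ) * ((1 / Real.sqrt (y / (2 * ch2 θ)) : ℝ) : ℂ) =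
      ((1 / (Real.sqrt 7 * y) : ℝ) : ℂ) := by
    rw [← ofReal_mul, ← sqrt_mul_sqrt_completed θ hy, one_div_mul_one_div]
  rw [dualTerm]
  set E1 := cexp (-Real.pi * m ^ 2 / (14 * y * ch2 θ : ℝ) + 2 * Real.pi * I * shift j * m)
  set E2 := cexp (-Real.pi * (n - dualFreq θ m) ^ 2 / (y / (2 * ch2 θ) : ℝ) +
        2 * Real.pi * I * (0 : ℝ) * (n - dualFreq θ m))
  set E3 := cexp (2 * Real.pi * I * shift j * m)
  set E4 := Real.exp (-(Real.pi * m ^ 2 / (14 * y * ch2 θ)) -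
      Real.pi * (n - dualFreq θ m) ^ 2 / (y / (2 * ch2 θ)))
  set S1 := ((1 / Real.sqrt (14 * y * ch2 θ) : ℝ) : ℂ)
  set S2 := ((1 / Real.sqrt (y / (2 * ch2 θ)) : ℝ) : ℂ)
  have hC' : (ch2 θ : ℂ) ≠ 0 := by exact_mod_cast hC.ne'
  have hy' : (y : ℂ) ≠ 0 := by exact_mod_cast hy.ne'
  have h7 : (Real.sqrt 7 : ℂ) ≠ 0 := by
    exact_mod_cast (Real.sqrt_pos.mpr (by norm_num : (0 : ℝ) < 7)).ne'
  calc _ = (S1 * S2) * (-I / (y / (2 * ch2 θ) : ℝ) *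
        ((p * Real.sinh θ - q * Real.cosh θ) / (2 * ch2 θ) : ℝ) * (n - dualFreq θ m) +
        -I / (14 * y * ch2 θ : ℝ) *
          ((p * Real.cosh θ + q * Real.sinh θ) * Real.sqrt 7 : ℝ) * m) * (E1 * E2) := by ring
    _ = _ := by
      rw [e, e2]
      generalize cexp (2 * Real.pi * I * shift j * m) = E3
      push_cast
      field_simp
      ring

/-- This justifies interchanging the sums over d and m between the two Poisson summations. -/
lemma summable_halfDualTerm (hy : 0 < y) :
    Summable fun x : ℤ × ℤ => halfDualTerm p q j y θ x.1 x.2 := by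
  have hC := ch2_pos θ
  set c := min (Real.pi * (y / (2 * ch2 θ))) (Real.pi / (14 * y * ch2 θ)) with hc
  have hc0 : 0 < c := lt_min (by positivity) (by positivity)
  set S := 1 / Real.sqrt (14 * y * ch2 θ)
  set A := ‖((p * Real.sinh θ - q * Real.cosh θ) / (2 * ch2 θ) : ℝ)‖
  set B := ‖-I / (14 * y * ch2 θ : ℝ) *
    ((p * Real.cosh θ + q * Real.sinh θ) * Real.sqrt 7 : ℝ)‖
  refine Summable.of_norm_bounded ((summable_exp_neg_mul_sq_add_sq (half_pos hc0) 0 0).mul_left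
    (S * (A + B) * (1 + 2 / c))) fun x => ?_
  have hexp1 : ‖cexp (-Real.pi * x.2 ^ 2 / (14 * y * ch2 θ : ℝ) +
      2 * Real.pi * I * shift j * x.2)‖ = Real.exp (-(Real.pi / (14 * y * ch2 θ)) * x.2 ^ 2) := by
    rw [show (-Real.pi * x.2 ^ 2 / (14 * y * ch2 θ : ℝ) + 2 * Real.pi * I * shift j * x.2 : ℂ) =
      ((-(Real.pi / (14 * y * ch2 θ)) * x.2 ^ 2 : ℝ) : ℂ) +
        ((2 * Real.pi * shift j * x.2 : ℝ) : ℂ) * I by push_cast; ring]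
    rw [Complex.exp_add, norm_mul, Complex.norm_exp_ofReal_mul_I, mul_one, ← ofReal_exp,
      Complex.norm_real, Real.norm_of_nonneg (Real.exp_pos _).le]
  have hexp2 : ‖cexp (-Real.pi * (y / (2 * ch2 θ) : ℝ) * (x.1 + (0 : ℝ)) ^ 2 +
        2 * Real.pi * I * x.1 * dualFreq θ x.2)‖ =
      Real.exp (-(Real.pi * (y / (2 * ch2 θ))) * x.1 ^ 2) := by
    rw [show (-Real.pi * (y / (2 * ch2 θ) : ℝ) * (x.1 + (0 : ℝ)) ^ 2 +
        2 * Real.pi * I * x.1 * dualFreq θ x.2 : ℂ) =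
      ((-(Real.pi * (y / (2 * ch2 θ))) * x.1 ^ 2 : ℝ) : ℂ) +
        ((2 * Real.pi * x.1 * dualFreq θ x.2 : ℝ) : ℂ) * I by push_cast; ring]
    rw [Complex.exp_add, norm_mul, Complex.norm_exp_ofReal_mul_I, mul_one, ← ofReal_exp,
      Complex.norm_real, Real.norm_of_nonneg (Real.exp_pos _).le]
  rw [halfDualTerm_eq, norm_mul, norm_mul, norm_mul, hexp1, hexp2, Complex.norm_real]
  have hS : ‖S‖ = S := Real.norm_of_nonneg (by positivity)
  have hlin : ‖(((p * Real.sinh θ - q * Real.cosh θ) / (2 * ch2 θ) : ℝ) : ℂ) * (x.1 + (0 : ℝ)) +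
      -I / (14 * y * ch2 θ : ℝ) *
        ((p * Real.cosh θ + q * Real.sinh θ) * Real.sqrt 7 : ℝ) * x.2‖ ≤
      (A + B) * (|(x.1 : ℝ)| + |(x.2 : ℝ)|) := by
    refine (norm_add_le _ _).trans ?_
    have n1 : ‖((x.1 : ℂ) + (0 : ℝ))‖ = |(x.1 : ℝ)| := by
      rw [ofReal_zero, add_zero, ← ofReal_intCast, Complex.norm_real, Real.norm_eq_abs]
    have n2 : ‖(x.2 : ℂ)‖ = |(x.2 : ℝ)| := by
      rw [← ofReal_intCast, Complex.norm_real, Real.norm_eq_abs]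
    rw [norm_mul, norm_mul _ (x.2 : ℂ), n1, n2, Complex.norm_real]
    have hA : 0 ≤ A := norm_nonneg _
    have hB : 0 ≤ B := norm_nonneg _
    nlinarith [mul_nonneg hA (abs_nonneg (x.2 : ℝ)), mul_nonneg hB (abs_nonneg (x.1 : ℝ))]
  have hexp : Real.exp (-(Real.pi / (14 * y * ch2 θ)) * x.2 ^ 2) *
      Real.exp (-(Real.pi * (y / (2 * ch2 θ))) * x.1 ^ 2) ≤
      Real.exp (-c * ((x.1 : ℝ) ^ 2 + (x.2 : ℝ) ^ 2)) := by
    rw [← Real.exp_add]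
    apply Real.exp_le_exp.mpr
    have m1 := mul_le_mul_of_nonneg_right (min_le_left (Real.pi * (y / (2 * ch2 θ)))
      (Real.pi / (14 * y * ch2 θ))) (sq_nonneg (x.1 : ℝ))
    have m2 := mul_le_mul_of_nonneg_right (min_le_right (Real.pi * (y / (2 * ch2 θ)))
      (Real.pi / (14 * y * ch2 θ))) (sq_nonneg (x.2 : ℝ))
    rw [← hc] at m1 m2
    linarith
  have hfin := linear_mul_exp_le hc0 (x.1 : ℝ) (x.2 : ℝ)
  have hAB : 0 ≤ A + B := by positivity
  have hS0 : 0 ≤ S := by positivity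
  rw [hS]
  calc _ = S * (‖(((p * Real.sinh θ - q * Real.cosh θ) / (2 * ch2 θ) : ℝ) : ℂ) *
        (x.1 + (0 : ℝ)) + -I / (14 * y * ch2 θ : ℝ) *
        ((p * Real.cosh θ + q * Real.sinh θ) * Real.sqrt 7 : ℝ) * x.2‖ *
        (Real.exp (-(Real.pi / (14 * y * ch2 θ)) * x.2 ^ 2) *
          Real.exp (-(Real.pi * (y / (2 * ch2 θ))) * x.1 ^ 2))) := by ring
    _ ≤ S * ((A + B) * (|(x.1 : ℝ)| + |(x.2 : ℝ)|) *
        Real.exp (-c * ((x.1 : ℝ) ^ 2 + (x.2 : ℝ) ^ 2))) := by gcongr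
    _ = S * (A + B) * ((|(x.1 : ℝ)| + |(x.2 : ℝ)|) *
        Real.exp (-c * ((x.1 : ℝ) ^ 2 + (x.2 : ℝ) ^ 2))) := by ring
    _ ≤ S * (A + B) * ((1 + 2 / c) *
        Real.exp (-(c / 2) * ((x.1 : ℝ) ^ 2 + (x.2 : ℝ) ^ 2))) := by gcongr
    _ = _ := by simp only [add_zero]; ring

/-- In the coordinates of `dualEquiv`, passing to the inverse of the rotated majorant amounts to θ ↦
−θ and y ↦ 1/y. This lemma matches the linear factors, `exponent_dualEquiv` the Gaussians. -/
lemma linear_dualEquiv (hy : 0 < y) (m n d x : ℝ) (hm : m = 14 * (x + d / 2))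
    (hn : n - (m + 1) / 2 = d / 2) :
    (p * Real.cosh θ + q * Real.sinh θ) * Real.sqrt 7 * m / (14 * y * ch2 θ) +
      (p * Real.sinh θ - q * Real.cosh θ) *
        (n - ((m + 1) / 2 - m * sh2 θ / (2 * Real.sqrt 7 * ch2 θ))) / y =
      1 / y * thetaLin p q (-θ) x (x + d) := by
  have hC := ch2_pos θ
  have h7 : (0 : ℝ) < Real.sqrt 7 := by positivity
  have h77 : Real.sqrt 7 ^ 2 = 7 := Real.sq_sqrt (by norm_num)
  have hcs := Real.cosh_sq θ
  have e1 : n - ((m + 1) / 2 - m * sh2 θ / (2 * Real.sqrt 7 * ch2 θ)) =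
      d / 2 + Real.sqrt 7 * (x + d / 2) * (sh2 θ / ch2 θ) := by
    have : n - ((m + 1) / 2 - m * sh2 θ / (2 * Real.sqrt 7 * ch2 θ)) =
      d / 2 + m * sh2 θ / (2 * Real.sqrt 7 * ch2 θ) := by rw [← hn]; ring
    rw [this, hm]
    field_simp
    linear_combination (-(2 * x + d) * 2 * sh2 θ) * h77
  have e2 : ((p * Real.cosh θ + q * Real.sinh θ) +
      (p * Real.sinh θ - q * Real.cosh θ) * sh2 θ) / ch2 θ =
      p * Real.cosh θ - q * Real.sinh θ := by
    rw [div_eq_iff hC.ne']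
    simp only [ch2, sh2]
    linear_combination (-p * Real.cosh θ - q * Real.sinh θ) * hcs
  rw [e1, hm, thetaLin, Real.cosh_neg, Real.sinh_neg]
  have e3 : p * Real.cosh θ + q * -Real.sinh θ = ((p * Real.cosh θ + q * Real.sinh θ) +
      (p * Real.sinh θ - q * Real.cosh θ) * sh2 θ) / ch2 θ := by rw [e2]; ring
  rw [e3]
  field_simp
  ring

lemma exponent_dualEquiv (hy : 0 < y) (m n d x : ℝ) (hm : m = 14 * (x + d / 2))
    (hn : n - (m + 1) / 2 = d / 2) :
    -(Real.pi * m ^ 2 / (14 * y * ch2 θ)) -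
      Real.pi * (n - ((m + 1) / 2 - m * sh2 θ / (2 * Real.sqrt 7 * ch2 θ))) ^ 2 /
        (y / (2 * ch2 θ)) = -(2 * Real.pi * (1 / y) * thetaMaj (-θ) x (x + d)) := by
  have hC := ch2_pos θ
  have h7 : (0 : ℝ) < Real.sqrt 7 := by positivity
  have h77 : Real.sqrt 7 ^ 2 = 7 := Real.sq_sqrt (by norm_num)
  have hcs := ch2_sq_sub_sh2_sq θ
  have e1 : n - ((m + 1) / 2 - m * sh2 θ / (2 * Real.sqrt 7 * ch2 θ)) =
      d / 2 + Real.sqrt 7 * (x + d / 2) * (sh2 θ / ch2 θ) := by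
    have : n - ((m + 1) / 2 - m * sh2 θ / (2 * Real.sqrt 7 * ch2 θ)) =
      d / 2 + m * sh2 θ / (2 * Real.sqrt 7 * ch2 θ) := by rw [← hn]; ring
    rw [this, hm]
    field_simp
    linear_combination (-(2 * x + d) * 2 * sh2 θ) * h77
  have e2 : thetaMaj (-θ) x (x + d) = ch2 θ * (7 * (x + d / 2) ^ 2 + (d / 2) ^ 2) +
      sh2 θ * (Real.sqrt 7 * (x + d / 2) * d) := by
    rw [thetaMaj_eq, Real.cosh_neg, Real.sinh_neg]
    simp only [ch2, sh2]; ring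
  rw [e1, e2, hm]
  field_simp
  linear_combination (14 * (x * 2 + d) ^ 2) * hcs - 2 * (x * 2 + d) ^ 2 * sh2 θ ^ 2 * h77

/-- The dual index is m = 2k + 1 + 7(r + s), so its phase splits into a root of unity depending only
on the translate k and the sign (−1)^{r+s}. Hence each translate reproduces a theta kernel. -/
lemma dualTerm_dualEquiv (hy : 0 < y) (k : Fin 7) (n : ℤ × ℤ) :
    dualTerm p q j y θ (dualEquiv (k, n)).1 (dualEquiv (k, n)).2 =
      -I / (Real.sqrt 7 * y ^ 2 : ℝ) * cexp (Real.pi * I * (2 * j + 1) * (2 * k + 1) / 7) *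
      (latticeSign n *
        thetaTerm p q (1 / y) (-θ) (n.1 + shift k) (n.2 + shift k) : ℝ) := by
  obtain ⟨r, s⟩ := n
  have hm : ((dualEquiv (k, (r, s))).1 : ℝ) = 14 * ((r + shift k) + (s - r : ℝ) / 2) := by
    simp only [dualEquiv, Equiv.coe_fn_mk, shift]; push_cast; ring
  have hn : ((dualEquiv (k, (r, s))).2 : ℝ) - ((dualEquiv (k, (r, s))).1 + 1) / 2 =
      (s - r : ℝ) / 2 := by
    simp only [dualEquiv, Equiv.coe_fn_mk]; push_cast; ring
  have hphase : cexp (2 * Real.pi * I * shift j * (dualEquiv (k, (r, s))).1) =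
      cexp (Real.pi * I * (2 * j + 1) * (2 * k + 1) / 7) * (latticeSign (r, s) : ℝ) := by
    rw [latticeSign, ← cexp_pi_mul_I_int, ← Complex.exp_add,
      show (2 * Real.pi * I * shift j * (dualEquiv (k, (r, s))).1 : ℂ) =
      Real.pi * I * (2 * j + 1) * (2 * k + 1) / 7 + Real.pi * I * ((r + s : ℤ) : ℂ) +
        (2 * j * r + j * (s - r) : ℤ) * (2 * Real.pi * I) by
        simp only [dualEquiv, Equiv.coe_fn_mk, shift]; push_cast; ring,
      Complex.exp_add _ (_ * (2 * Real.pi * I)), Complex.exp_int_mul_two_pi_mul_I, mul_one]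
  have hx : (s : ℝ) + shift k = (r + shift k) + (s - r) := by ring
  rw [dualTerm, hphase, dualFreq, linear_dualEquiv p q θ hy _ _ _ _ hm hn,
    exponent_dualEquiv θ hy _ _ _ _ hm hn, thetaTerm, hx]
  have hy' : (y : ℂ) ≠ 0 := by exact_mod_cast hy.ne'
  push_cast
  field_simp

end Poisson

lemma summable_dualTerm (p q : ℝ) (j : ℤ) {y : ℝ} (θ : ℝ) (hy : 0 < y) :
    Summable fun x : ℤ × ℤ => dualTerm p q j y θ x.1 x.2 := by
  rw [← dualEquiv.summable_iff, ← summable_norm_iff,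
    summable_prod_of_nonneg (fun _ => norm_nonneg _)]
  refine ⟨fun k => ?_, (hasSum_fintype _).summable⟩
  simp only [Function.comp_apply, dualTerm_dualEquiv p q j θ hy]
  exact ((Complex.summable_ofReal.mpr (summable_thetaTerm p q (one_div_pos.mpr hy) (-θ)
    (shift k) (shift k))).mul_left _).norm

lemma tsum_dualTerm (p q : ℝ) (j : ℤ) {y : ℝ} (θ : ℝ) (hy : 0 < y) :
    ∑' x : ℤ × ℤ, dualTerm p q j y θ x.1 x.2 = -I / (Real.sqrt 7 * y ^ 2 : ℝ) *
      ∑ k : Fin 7, cexp (Real.pi * I * (2 * j + 1) * (2 * k + 1) / 7) *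
        (thetaKernel p q k (1 / y) (-θ) : ℂ) := by
  have h1 := dualEquiv.tsum_eq (fun x => dualTerm p q j y θ x.1 x.2)
  have h2 := Summable.tsum_prod (dualEquiv.summable_iff.mpr (summable_dualTerm p q j θ hy))
  simp only [Function.comp_apply] at h2
  rw [← h1, h2, tsum_fintype, Finset.mul_sum]
  refine Finset.sum_congr rfl fun k _ => ?_
  rw [tsum_congr (fun n => dualTerm_dualEquiv p q j θ hy k n), tsum_mul_left, ← ofReal_tsum,
    mul_assoc]
  rfl

lemma thetaKernel_eq_tsum_tsum (p q : ℝ) (j : ℤ) {y : ℝ} (θ : ℝ) (hy : 0 < y) :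
    thetaKernel p q j y θ = ∑' d : ℤ, ∑' r : ℤ, latticeSign (r, r + d) *
      thetaTerm p q y θ (r + shift j) (r + d + shift j) := by
  have hsum := diffEquiv.summable_iff.mpr (summable_thetaTerm p q hy θ (shift j) (shift j))
  have h1 := diffEquiv.tsum_eq (fun n : ℤ × ℤ => latticeSign n *
    thetaTerm p q y θ (n.1 + shift j) (n.2 + shift j))
  rw [thetaKernel, ← h1]
  refine (Summable.tsum_prod hsum).trans ?_
  simp only [Function.comp_apply, diffEquiv, Equiv.coe_fn_mk, Int.cast_add]

/-- Poisson summation in r, interchange, Poisson summation in d; the dual lattice is then sorted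
into its seven translates. -/
lemma thetaKernel_eq_sum_seven (p q : ℝ) (j : ℤ) {y : ℝ} (θ : ℝ) (hy : 0 < y) :
    (thetaKernel p q j y θ : ℂ) = -I / (Real.sqrt 7 * y ^ 2 : ℝ) *
      ∑ k : Fin 7, cexp (Real.pi * I * (2 * j + 1) * (2 * k + 1) / 7) *
        (thetaKernel p q k (1 / y) (-θ) : ℂ) := by
  rw [← tsum_dualTerm p q j θ hy]
  calc (thetaKernel p q j y θ : ℂ)
      = ∑' d : ℤ, ((∑' r : ℤ, latticeSign (r, r + d) *
          thetaTerm p q y θ (r + shift j) (r + d + shift j) : ℝ) : ℂ) := by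
        rw [thetaKernel_eq_tsum_tsum p q j θ hy, ofReal_tsum]
    _ = ∑' d : ℤ, ∑' m : ℤ, halfDualTerm p q j y θ d m := by
        simp_rw [tsum_first_variable p q j θ hy]
    _ = ∑' m : ℤ, ∑' d : ℤ, halfDualTerm p q j y θ d m := by
        exact (Summable.tsum_comm (f := fun d m => halfDualTerm p q j y θ d m)
          (summable_halfDualTerm p q j θ hy)).symm
    _ = ∑' m : ℤ, ∑' n : ℤ, dualTerm p q j y θ m n := by
        simp_rw [tsum_second_variable p q j θ hy]
    _ = _ := ((summable_dualTerm p q j θ hy).tsum_prod).symm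

/-- The reflection n ↦ (−1, −1) − n sends the shift of 6 − k to minus that of k; signs and Gaussian
are invariant, while the linear factor is odd. -/
lemma thetaKernel_six_sub (p q : ℝ) (k : ℤ) (y θ : ℝ) :
    thetaKernel p q (6 - k) y θ = -thetaKernel p q k y θ := by
  rw [thetaKernel, thetaKernel, ← tsum_neg,
    ← (Equiv.subLeft ((-1 : ℤ), (-1 : ℤ))).tsum_eq]
  refine tsum_congr fun n => ?_
  have e1 : latticeSign (Equiv.subLeft ((-1 : ℤ), (-1 : ℤ)) n) = latticeSign n := by
    simp only [latticeSign, Equiv.subLeft_apply, Prod.fst_sub, Prod.snd_sub]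
    rw [show (-1 - n.1 + (-1 - n.2) : ℤ) = -2 + -(n.1 + n.2) by ring,
      zpow_add₀ (by norm_num), zpow_neg (-1 : ℝ) (n.1 + n.2), ← inv_zpow]
    norm_num
  have e2 : ((Equiv.subLeft ((-1 : ℤ), (-1 : ℤ)) n).1 + shift (6 - k) : ℝ) =
      -(n.1 + shift k) := by simp [shift]; ring
  have e3 : ((Equiv.subLeft ((-1 : ℤ), (-1 : ℤ)) n).2 + shift (6 - k) : ℝ) =
      -(n.2 + shift k) := by simp [shift]; ring
  have hl : ∀ p q x₁ x₂, thetaLin p q θ (-x₁) (-x₂) = -thetaLin p q θ x₁ x₂ := by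
    intros; simp only [thetaLin]; ring
  rw [e1, e2, e3]
  simp only [thetaTerm, thetaMaj, hl, neg_sq]
  ring

/-- Pairing k with 6 − k turns the exponentials into sines, and k = 3, its own partner, contributes
0. Three kernels remain. -/
theorem thetaKernel_inv (p q : ℝ) (j : ℤ) {y : ℝ} (hy : 0 < y) (θ : ℝ) :
    thetaKernel p q j y θ = 2 / (Real.sqrt 7 * y ^ 2) *
      ∑ k ∈ Finset.range 3, Real.sin (Real.pi * (2 * j + 1) * (2 * k + 1) / 7) *
        thetaKernel p q k (1 / y) (-θ) := by
  have h := thetaKernel_eq_sum_seven p q j θ hy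
  have h3 : thetaKernel p q 3 (1 / y) (-θ) = 0 := by
    have := thetaKernel_six_sub p q 3 (1 / y) (-θ)
    rw [show (6 - 3 : ℤ) = 3 by norm_num] at this; linarith
  have h4 := thetaKernel_six_sub p q 2 (1 / y) (-θ)
  have h5 := thetaKernel_six_sub p q 1 (1 / y) (-θ)
  have h6 := thetaKernel_six_sub p q 0 (1 / y) (-θ)
  norm_num at h4 h5 h6
  have key : ∀ k : ℂ, cexp (Real.pi * I * (2 * j + 1) * (2 * (6 - k) + 1) / 7) =
      cexp (-(Real.pi * I * (2 * j + 1) * (2 * k + 1) / 7)) := by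
    intro k
    rw [show Real.pi * I * (2 * j + 1) * (2 * (6 - k) + 1) / 7 =
      -(Real.pi * I * (2 * j + 1) * (2 * k + 1) / 7) + (2 * j + 1 : ℤ) * (2 * Real.pi * I) by
        push_cast; ring, Complex.exp_add, Complex.exp_int_mul_two_pi_mul_I, mul_one]
  have hsin : ∀ k : ℂ, cexp (Real.pi * I * (2 * j + 1) * (2 * k + 1) / 7) -
      cexp (-(Real.pi * I * (2 * j + 1) * (2 * k + 1) / 7)) =
      2 * I * Complex.sin (Real.pi * (2 * j + 1) * (2 * k + 1) / 7) := by
    intro k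
    rw [Complex.sin]
    rw [show -(Real.pi * (2 * j + 1) * (2 * k + 1) / 7 : ℂ) * I =
      -(Real.pi * I * (2 * j + 1) * (2 * k + 1) / 7) by ring,
      show (Real.pi * (2 * j + 1) * (2 * k + 1) / 7 : ℂ) * I =
      (Real.pi * I * (2 * j + 1) * (2 * k + 1) / 7) by ring]
    linear_combination (-cexp (-(Real.pi * I * (2 * j + 1) * (2 * k + 1) / 7)) +
      cexp ((Real.pi * I * (2 * j + 1) * (2 * k + 1) / 7))) * I_sq
  have s0 := hsin 0
  have s1 := hsin 1
  have s2 := hsin 2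
  rw [← key] at s0 s1 s2
  have hcast : ((thetaKernel p q j y θ : ℝ) : ℂ) = ((2 / (Real.sqrt 7 * y ^ 2) *
      ∑ k ∈ Finset.range 3, Real.sin (Real.pi * (2 * j + 1) * (2 * k + 1) / 7) *
        thetaKernel p q k (1 / y) (-θ) : ℝ) : ℂ) := by
    rw [h]
    have hr : ∀ f : ℕ → ℂ, ∑ k : Fin 7, f k = f 0 + f 1 + f 2 + f 3 + f 4 + f 5 + f 6 :=
      fun f => by simp [Fin.sum_univ_succ]; ring
    have := hr (fun k => cexp (Real.pi * I * (2 * j + 1) * (2 * k + 1) / 7) *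
        (thetaKernel p q k (1 / y) (-θ) : ℂ))
    rw [show ∑ k : Fin 7, cexp (Real.pi * I * (2 * j + 1) * (2 * k + 1) / 7) *
        (thetaKernel p q k (1 / y) (-θ) : ℂ) = _ from this]
    simp only [Finset.sum_range_succ, Finset.sum_range_zero]
    norm_num at h3 s0 s1 s2 ⊢
    rw [h3, h4, h5, h6]
    push_cast
    generalize (thetaKernel p q 0 y⁻¹ (-θ) : ℂ) = T0
    generalize (thetaKernel p q 1 y⁻¹ (-θ) : ℂ) = T1
    generalize (thetaKernel p q 2 y⁻¹ (-θ) : ℂ) = T2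
    linear_combination (-I / (Real.sqrt 7 * y ^ 2)) * (T0 * s0 + T1 * s1 + T2 * s2) -
      2 / (Real.sqrt 7 * y ^ 2) * (Complex.sin (Real.pi * (2 * j + 1) / 7) * T0 +
        Complex.sin (Real.pi * (2 * j + 1) * 3 / 7) * T1 +
        Complex.sin (Real.pi * (2 * j + 1) * 5 / 7) * T2) * I_sq
  exact_mod_cast hcast

/-! ### Signs as error functions plus Gaussian tails -/

/-- The indefinite quadratic form `(3/2) x₁² + 4 x₁ x₂ + (3/2) x₂²`. -/
def quadForm (x₁ x₂ : ℝ) : ℝ := 3 / 2 * x₁ ^ 2 + 4 * x₁ * x₂ + 3 / 2 * x₂ ^ 2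

/-- The hyperbolic angle of the boundary vectors of the cone `x₁, x₂ ≥ 0`. -/
def theta0 : ℝ := Real.arsinh (1 / Real.sqrt 6)

lemma sinh_theta0 : Real.sinh theta0 = 1 / Real.sqrt 6 := Real.sinh_arsinh _

lemma cosh_theta0 : Real.cosh theta0 = Real.sqrt 7 / Real.sqrt 6 := by
  rw [theta0, Real.cosh_arsinh, ← Real.sqrt_div (by norm_num), div_pow,
    Real.sq_sqrt (by norm_num)]
  norm_num

lemma theta0_nonneg : 0 ≤ theta0 := Real.arsinh_nonneg_iff.mpr (by positivity)

/-- The angle θ₀ is chosen so that the coefficient of x₂ in Y_θ cancels; at −θ₀ that of x₁ cancels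
instead. -/
lemma thetaLin_theta0 (x₁ x₂ : ℝ) :
    thetaLin 0 1 theta0 x₁ x₂ = Real.sqrt 7 / Real.sqrt 6 * x₁ := by
  rw [thetaLin, sinh_theta0, cosh_theta0]; ring

lemma thetaLin_neg_theta0 (x₁ x₂ : ℝ) :
    thetaLin 0 1 (-theta0) x₁ x₂ = -(Real.sqrt 7 / Real.sqrt 6 * x₂) := by
  rw [thetaLin, Real.sinh_neg, Real.cosh_neg, sinh_theta0, cosh_theta0]; ring

lemma thetaLin_sq_sub_sq (θ x₁ x₂ : ℝ) :
    thetaLin 1 0 θ x₁ x₂ ^ 2 - thetaLin 0 1 θ x₁ x₂ ^ 2 = quadForm x₁ x₂ := by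
  have h7 : Real.sqrt 7 ^ 2 = 7 := Real.sq_sqrt (by norm_num)
  have h := Real.cosh_sq θ
  simp only [thetaLin, quadForm]
  linear_combination (Real.sqrt 7 ^ 2 * ((x₁ + x₂) / 2) ^ 2 - ((x₁ - x₂) / 2) ^ 2) * h +
    ((x₁ + x₂) / 2) ^ 2 * h7

lemma thetaMaj_eq_add (θ x₁ x₂ : ℝ) :
    thetaMaj θ x₁ x₂ = quadForm x₁ x₂ + 2 * thetaLin 0 1 θ x₁ x₂ ^ 2 := by
  rw [← thetaLin_sq_sub_sq θ, thetaMaj]; ring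

/-- The primitive of the Gaussian `exp(-4πu²)`. -/
def gaussPrim (v : ℝ) : ℝ := ∫ u in (0 : ℝ)..v, Real.exp (-(4 * Real.pi) * u ^ 2)

lemma hasDerivAt_gaussPrim (v : ℝ) :
    HasDerivAt gaussPrim (Real.exp (-(4 * Real.pi) * v ^ 2)) v := by
  have hc : Continuous fun u : ℝ => Real.exp (-(4 * Real.pi) * u ^ 2) := by fun_prop
  exact intervalIntegral.integral_hasDerivAt_right (hc.intervalIntegrable _ _)
    (hc.stronglyMeasurableAtFilter _ _) hc.continuousAt

lemma gaussPrim_neg (v : ℝ) : gaussPrim (-v) = -gaussPrim v := by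
  have := intervalIntegral.integral_comp_neg (a := 0) (b := v)
    (fun u => Real.exp (-(4 * Real.pi) * u ^ 2))
  simp only [neg_sq, neg_zero] at this
  rw [gaussPrim, gaussPrim, this, intervalIntegral.integral_symm]

lemma tendsto_gaussPrim : Filter.Tendsto gaussPrim Filter.atTop (nhds (1 / 4)) := by
  have hpi := Real.pi_pos
  have h := intervalIntegral_tendsto_integral_Ioi (0 : ℝ)
    ((integrable_exp_neg_mul_sq (b := 4 * Real.pi) (by positivity)).integrableOn)
    Filter.tendsto_id
  rw [integral_gaussian_Ioi, show Real.pi / (4 * Real.pi) = (1 / 2) ^ 2 by field_simp; norm_num,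
    Real.sqrt_sq (by norm_num)] at h
  norm_num at h
  refine h.congr fun v => ?_
  simp only [gaussPrim, neg_mul]

/-- The majorant is Q + 2Y_θ² and dY_θ/dθ = X_θ, so the integrand is the derivative of exp(−2πyQ)
`gaussPrim`(Y_θ √y). At ±θ₀ the form Y_θ is a multiple of x₁, respectively of −x₂. -/
lemma sqrt_mul_integral_thetaTerm {y : ℝ} (hy : 0 < y) (x₁ x₂ : ℝ) :
    Real.sqrt y * ∫ θ in (-theta0)..theta0, thetaTerm 1 0 y θ x₁ x₂ =
      Real.exp (-(2 * Real.pi * y * quadForm x₁ x₂)) *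
        (gaussPrim (Real.sqrt 7 / Real.sqrt 6 * x₁ * Real.sqrt y) +
          gaussPrim (Real.sqrt 7 / Real.sqrt 6 * x₂ * Real.sqrt y)) := by
  have hd : ∀ θ, HasDerivAt (fun θ => Real.exp (-(2 * Real.pi * y * quadForm x₁ x₂)) *
      gaussPrim (thetaLin 0 1 θ x₁ x₂ * Real.sqrt y))
      (Real.sqrt y * thetaTerm 1 0 y θ x₁ x₂) θ := by
    intro θ
    have h1 : HasDerivAt (fun θ => thetaLin 0 1 θ x₁ x₂) (thetaLin 1 0 θ x₁ x₂) θ := by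
      have := (((Real.hasDerivAt_sinh θ).mul_const (Real.sqrt 7 * ((x₁ + x₂) / 2))).add
        ((Real.hasDerivAt_cosh θ).mul_const ((x₁ - x₂) / 2)))
      refine (this.congr_deriv ?_).congr_of_eventuallyEq (Filter.Eventually.of_forall fun θ => ?_)
      · simp [thetaLin]
      · simp [thetaLin]
    have h2 := ((hasDerivAt_gaussPrim (thetaLin 0 1 θ x₁ x₂ * Real.sqrt y)).comp θ
      (h1.mul_const (Real.sqrt y))).const_mul (Real.exp (-(2 * Real.pi * y * quadForm x₁ x₂)))
    refine h2.congr_deriv ?_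
    rw [thetaTerm, thetaMaj_eq_add, mul_pow, Real.sq_sqrt hy.le,
      show -(2 * Real.pi * y * (quadForm x₁ x₂ + 2 * thetaLin 0 1 θ x₁ x₂ ^ 2)) =
        -(2 * Real.pi * y * quadForm x₁ x₂) +
          -(4 * Real.pi) * (thetaLin 0 1 θ x₁ x₂ ^ 2 * y) by ring, Real.exp_add]
    ring
  have hc : Continuous fun θ => Real.sqrt y * thetaTerm 1 0 y θ x₁ x₂ := by
    unfold thetaTerm thetaMaj thetaLin
    fun_prop
  rw [← intervalIntegral.integral_const_mul,
    intervalIntegral.integral_eq_sub_of_hasDerivAt (fun θ _ => hd θ) (hc.intervalIntegrable _ _),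
    thetaLin_theta0, thetaLin_neg_theta0, neg_mul, gaussPrim_neg]
  ring

lemma integrableOn_tail {w y : ℝ} (hw : w ≠ 0) (hy : 0 < y) :
    IntegrableOn (fun t => w * Real.exp (-(2 * Real.pi * t * w ^ 2)) / Real.sqrt (t + y))
      (Set.Ioi y) ∧
    ∫ t in Set.Ioi y, ‖w * Real.exp (-(2 * Real.pi * t * w ^ 2)) / Real.sqrt (t + y)‖ ≤
      1 / (2 * Real.pi * Real.sqrt y * |w|) * Real.exp (-(2 * Real.pi * y * w ^ 2)) := by
  have hpi := Real.pi_pos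
  have hw2 : 0 < w ^ 2 := by positivity
  have ha : -(2 * Real.pi * w ^ 2) < 0 := by
    have : 0 < 2 * Real.pi * w ^ 2 := by positivity
    linarith
  have hI := (integrableOn_exp_mul_Ioi ha y).const_mul (|w| / Real.sqrt y)
  have hle : ∀ t ∈ Set.Ioi y,
      ‖w * Real.exp (-(2 * Real.pi * t * w ^ 2)) / Real.sqrt (t + y)‖ ≤
      |w| / Real.sqrt y * Real.exp (-(2 * Real.pi * w ^ 2) * t) := by
    intro t ht
    have ht' : y < t := ht
    rw [norm_div, norm_mul, Real.norm_eq_abs, Real.norm_eq_abs, Real.norm_eq_abs, Real.abs_exp,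
      abs_of_nonneg (Real.sqrt_nonneg _), div_mul_eq_mul_div,
      show -(2 * Real.pi * t * w ^ 2) = -(2 * Real.pi * w ^ 2) * t by ring]
    gcongr
    linarith
  have hint : IntegrableOn
      (fun t => w * Real.exp (-(2 * Real.pi * t * w ^ 2)) / Real.sqrt (t + y)) (Set.Ioi y) := by
    refine Integrable.mono' hI ?_ ((ae_restrict_iff' measurableSet_Ioi).mpr (.of_forall hle))
    refine ContinuousOn.aestronglyMeasurable (ContinuousOn.div (by fun_prop) (by fun_prop) ?_)
      measurableSet_Ioi
    intro t ht
    have ht' : y < t := ht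
    exact (Real.sqrt_pos.mpr (by linarith)).ne'
  refine ⟨hint, ?_⟩
  refine (setIntegral_mono_on hint.norm hI measurableSet_Ioi hle).trans (le_of_eq ?_)
  rw [integral_const_mul, integral_exp_mul_Ioi ha]
  have e : |w| * |w| = w ^ 2 := by rw [← sq, sq_abs]
  have hw' : |w| ≠ 0 := abs_ne_zero.mpr hw
  have hs : Real.sqrt y ≠ 0 := (Real.sqrt_pos.mpr hy).ne'
  rw [← e, show -(2 * Real.pi * (|w| * |w|)) * y = -(2 * Real.pi * y * (|w| * |w|)) by ring]
  field_simp

/-- The substitution u = w√((t + y)/2) makes this the Gaussian integral from w√y to ±∞; the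
half-line integral of exp(−4πu²) is 1/4. -/
lemma integral_tail {w y : ℝ} (hw : w ≠ 0) (hy : 0 < y) :
    ∫ t in Set.Ioi y, w * Real.exp (-(2 * Real.pi * t * w ^ 2)) / Real.sqrt (t + y) =
      2 * Real.sqrt 2 * Real.exp (2 * Real.pi * y * w ^ 2) *
        (Real.sign w / 4 - gaussPrim (w * Real.sqrt y)) := by
  have hd : ∀ t ∈ Set.Ici y, HasDerivAt (fun t => 2 * Real.sqrt 2 *
      Real.exp (2 * Real.pi * y * w ^ 2) * gaussPrim (w * Real.sqrt ((t + y) / 2)))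
      (w * Real.exp (-(2 * Real.pi * t * w ^ 2)) / Real.sqrt (t + y)) t := by
    intro t ht
    have ht' : y ≤ t := ht
    have hpos : 0 < (t + y) / 2 := by linarith
    have h1 : HasDerivAt (fun t => (t + y) / 2) (1 / 2) t :=
      ((hasDerivAt_id t).add_const y).div_const 2
    have h2 := ((hasDerivAt_gaussPrim (w * Real.sqrt ((t + y) / 2))).comp t
      ((h1.sqrt hpos.ne').const_mul w)).const_mul
      (2 * Real.sqrt 2 * Real.exp (2 * Real.pi * y * w ^ 2))
    refine h2.congr_deriv ?_
    rw [mul_pow, Real.sq_sqrt hpos.le,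
      show -(2 * Real.pi * t * w ^ 2) = 2 * Real.pi * y * w ^ 2 +
        -(4 * Real.pi) * (w ^ 2 * ((t + y) / 2)) by ring, Real.exp_add,
      Real.sqrt_div (by linarith)]
    have hs : Real.sqrt (t + y) ≠ 0 := (Real.sqrt_pos.mpr (by linarith)).ne'
    have h22 : Real.sqrt 2 ^ 2 = 2 := Real.sq_sqrt (by norm_num)
    have h2' : Real.sqrt 2 ≠ 0 := by positivity
    field_simp
    linear_combination (1 : ℝ) * h22
  have hlim : Filter.Tendsto (fun t => 2 * Real.sqrt 2 *
      Real.exp (2 * Real.pi * y * w ^ 2) * gaussPrim (w * Real.sqrt ((t + y) / 2)))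
      Filter.atTop (nhds (2 * Real.sqrt 2 * Real.exp (2 * Real.pi * y * w ^ 2) *
        (Real.sign w / 4))) := by
    apply Filter.Tendsto.const_mul
    have hs : Filter.Tendsto (fun t : ℝ => Real.sqrt ((t + y) / 2)) Filter.atTop Filter.atTop :=
      Real.tendsto_sqrt_atTop.comp ((Filter.tendsto_atTop_add_const_right _ y
        Filter.tendsto_id).atTop_div_const (by norm_num))
    rcases lt_or_gt_of_ne hw with h | h
    · rw [Real.sign_of_neg h]
      have := (tendsto_gaussPrim.comp (hs.const_mul_atTop (neg_pos.mpr h))).neg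
      refine (this.congr fun t => ?_).trans (le_of_eq (by norm_num))
      simp only [Function.comp_apply, neg_mul, gaussPrim_neg, neg_neg]
    · rw [Real.sign_of_pos h]
      exact tendsto_gaussPrim.comp (hs.const_mul_atTop h)
  rw [integral_Ioi_of_hasDerivAt_of_tendsto' hd (integrableOn_tail hw hy).1 hlim]
  rw [show (y + y) / 2 = y by ring]
  ring

/-- The summand of the kernel attached to one boundary of the cone. -/
def edgeTerm (t y x₁ x₂ : ℝ) : ℝ :=
  Real.sqrt 7 / Real.sqrt 6 * x₁ *
    Real.exp (-(2 * Real.pi * t * (Real.sqrt 7 / Real.sqrt 6 * x₁) ^ 2)) *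
    Real.exp (-(2 * Real.pi * y * (quadForm x₁ x₂ + (Real.sqrt 7 / Real.sqrt 6 * x₁) ^ 2)))

lemma integral_edgeTerm {y x₁ : ℝ} (hy : 0 < y) (hx : x₁ ≠ 0) (x₂ : ℝ) :
    1 / Real.sqrt 2 * ∫ t in Set.Ioi y, edgeTerm t y x₁ x₂ / Real.sqrt (t + y) =
      Real.exp (-(2 * Real.pi * y * quadForm x₁ x₂)) *
        (Real.sign x₁ / 2 - 2 * gaussPrim (Real.sqrt 7 / Real.sqrt 6 * x₁ * Real.sqrt y)) := by
  have hκ : 0 < Real.sqrt 7 / Real.sqrt 6 := by positivity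
  have hw : Real.sqrt 7 / Real.sqrt 6 * x₁ ≠ 0 := mul_ne_zero hκ.ne' hx
  have hsign : Real.sign (Real.sqrt 7 / Real.sqrt 6 * x₁) = Real.sign x₁ := by
    rcases lt_or_gt_of_ne hx with h | h
    · rw [Real.sign_of_neg h, Real.sign_of_neg (mul_neg_of_pos_of_neg hκ h)]
    · rw [Real.sign_of_pos h, Real.sign_of_pos (mul_pos hκ h)]
  have h := integral_tail hw hy
  rw [hsign] at h
  simp only [edgeTerm]
  set w := Real.sqrt 7 / Real.sqrt 6 * x₁
  have e : ∀ t, w * Real.exp (-(2 * Real.pi * t * w ^ 2)) *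
      Real.exp (-(2 * Real.pi * y * (quadForm x₁ x₂ + w ^ 2))) / Real.sqrt (t + y) =
      Real.exp (-(2 * Real.pi * y * (quadForm x₁ x₂ + w ^ 2))) *
        (w * Real.exp (-(2 * Real.pi * t * w ^ 2)) / Real.sqrt (t + y)) := fun t => by ring
  simp_rw [e]
  rw [integral_const_mul, h, show -(2 * Real.pi * y * (quadForm x₁ x₂ + w ^ 2)) =
    -(2 * Real.pi * y * quadForm x₁ x₂) + -(2 * Real.pi * y * w ^ 2) by ring, Real.exp_add]
  have e2 : Real.exp (-(2 * Real.pi * y * w ^ 2)) * Real.exp (2 * Real.pi * y * w ^ 2) = 1 := by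
    rw [← Real.exp_add, neg_add_cancel, Real.exp_zero]
  have h2' : Real.sqrt 2 ≠ 0 := by positivity
  field_simp
  linear_combination (4 * (Real.sign x₁ - 4 * gaussPrim (w * Real.sqrt y))) * e2

/-- Termwise form of the completion: for each wall, sgn/2 is an error function plus the missing
Gaussian tail. -/
lemma sign_mul_exp_eq {y x₁ x₂ : ℝ} (hy : 0 < y) (h₁ : x₁ ≠ 0) (h₂ : x₂ ≠ 0) :
    (Real.sign x₁ + Real.sign x₂) / 2 * Real.exp (-(2 * Real.pi * y * quadForm x₁ x₂)) =
      2 * Real.sqrt y * (∫ θ in (-theta0)..theta0, thetaTerm 1 0 y θ x₁ x₂) +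
      (1 / Real.sqrt 2 * (∫ t in Set.Ioi y, edgeTerm t y x₁ x₂ / Real.sqrt (t + y)) +
       1 / Real.sqrt 2 * ∫ t in Set.Ioi y, edgeTerm t y x₂ x₁ / Real.sqrt (t + y)) := by
  rw [integral_edgeTerm hy h₁, integral_edgeTerm hy h₂, mul_assoc 2 (Real.sqrt y),
    sqrt_mul_integral_thetaTerm hy, show quadForm x₂ x₁ = quadForm x₁ x₂ by
      simp only [quadForm]; ring]
  ring

lemma shift_add_ne_zero (n j : ℤ) : (n : ℝ) + shift j ≠ 0 := by
  intro h
  have h1 : (14 * n + (2 * j + 1) : ℝ) = 0 := by rw [shift] at h; linarith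
  have h2 : 14 * n + (2 * j + 1) = 0 := by exact_mod_cast h1
  omega

/-- Lattice points stay away from the walls, since the numerator 14n + 2j + 1 is odd. This bounds
the negative powers of x₁ produced by integrating tails. -/
lemma one_le_abs_shift_add (n j : ℤ) : 1 / 14 ≤ |(n : ℝ) + shift j| := by
  have h1 : (n : ℝ) + shift j = ((14 * n + (2 * j + 1) : ℤ) : ℝ) / 14 := by
    rw [shift]; push_cast; ring
  have h2 : (1 : ℝ) ≤ |((14 * n + (2 * j + 1) : ℤ) : ℝ)| := by
    rw [← Int.cast_abs]; exact_mod_cast Int.one_le_abs (by omega)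
  rw [h1, abs_div, abs_of_pos (by norm_num : (0 : ℝ) < 14)]
  linarith

/-! ### The completed theta series and its inversion -/

/-- The indefinite theta series `∑ (sgn x₁ + sgn x₂)/2 (-1)^{r+s} exp(-2πy Q(x))`. -/
def indefTheta (j : ℤ) (y : ℝ) : ℝ :=
  ∑' n : ℤ × ℤ, latticeSign n *
    ((Real.sign (n.1 + shift j) + Real.sign (n.2 + shift j)) / 2 *
      Real.exp (-(2 * Real.pi * y * quadForm (n.1 + shift j) (n.2 + shift j))))

/-- The completed indefinite theta series. -/
def completedTheta (j : ℤ) (y : ℝ) : ℝ :=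
  2 * Real.sqrt y * ∫ θ in (-theta0)..theta0, thetaKernel 1 0 j y θ

/-- The theta series attached to a boundary of the cone. -/
def edgeTheta (j : ℤ) (t y : ℝ) : ℝ :=
  ∑' n : ℤ × ℤ, latticeSign n * edgeTerm t y (n.1 + shift j) (n.2 + shift j)

lemma continuous_thetaTerm (p q y x₁ x₂ : ℝ) : Continuous fun θ => thetaTerm p q y θ x₁ x₂ := by
  unfold thetaTerm thetaMaj thetaLin
  fun_prop

lemma hasSum_integral_thetaTerm (p q : ℝ) (j : ℤ) {y : ℝ} (hy : 0 < y) (T : ℝ) (hT : 0 ≤ T) :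
    HasSum (fun n : ℤ × ℤ => latticeSign n *
      ∫ θ in (-T)..T, thetaTerm p q y θ (n.1 + shift j) (n.2 + shift j))
      (∫ θ in (-T)..T, thetaKernel p q j y θ) := by
  obtain ⟨K, c, hc, h⟩ := exists_abs_thetaTerm_le p q hy T
  have hs := (summable_exp_neg_mul_sq_add_sq hc (shift j) (shift j)).mul_left K
  simp_rw [← intervalIntegral.integral_const_mul]
  refine intervalIntegral.hasSum_integral_of_dominated_convergence
    (fun n _ => K * Real.exp (-c * ((n.1 + shift j) ^ 2 + (n.2 + shift j) ^ 2)))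
    (fun n => ((continuous_thetaTerm p q y _ _).const_mul _).aestronglyMeasurable)
    (fun n => .of_forall fun θ hθ => ?_) (.of_forall fun _ _ => hs)
    intervalIntegrable_const
    (.of_forall fun θ _ => (summable_thetaTerm p q hy θ (shift j) (shift j)).hasSum)
  rw [Real.norm_eq_abs, abs_mul, abs_latticeSign, one_mul]
  refine h θ ?_ _ _
  rw [Set.uIoc_of_le (by linarith)] at hθ
  exact abs_le.mpr ⟨hθ.1.le, hθ.2⟩

/-- With (v, w) the rotated coordinates at θ₀, the exponent is −2π(tw² + yv²), a definite form;
lowering t and y to m gives the kernel term there. -/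
lemma abs_edgeTerm_le {t y m : ℝ} (ht : m ≤ t) (hy : m ≤ y) (x₁ x₂ : ℝ) :
    |edgeTerm t y x₁ x₂| ≤ |thetaTerm 0 1 m theta0 x₁ x₂| := by
  have hQ := thetaLin_sq_sub_sq theta0 x₁ x₂
  rw [edgeTerm, thetaTerm, thetaMaj_eq_add, ← hQ, thetaLin_theta0, mul_assoc, ← Real.exp_add]
  set w := Real.sqrt 7 / Real.sqrt 6 * x₁
  set v := thetaLin 1 0 theta0 x₁ x₂
  rw [abs_mul w, abs_mul w, Real.abs_exp, Real.abs_exp]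
  apply mul_le_mul_of_nonneg_left _ (abs_nonneg _)
  apply Real.exp_le_exp.mpr
  have h1 := mul_le_mul_of_nonneg_right ht (mul_nonneg Real.pi_pos.le (sq_nonneg w))
  have h2 := mul_le_mul_of_nonneg_right hy (mul_nonneg Real.pi_pos.le (sq_nonneg v))
  linarith

lemma edgeTerm_diag (y x₁ x₂ : ℝ) : edgeTerm y y x₁ x₂ = thetaTerm 0 1 y theta0 x₁ x₂ := by
  rw [edgeTerm, thetaTerm, thetaMaj_eq_add, thetaLin_theta0, mul_assoc, ← Real.exp_add]
  congr 2; ring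

lemma edgeTheta_diag (j : ℤ) (y : ℝ) : edgeTheta j y y = thetaKernel 0 1 j y theta0 := by
  simp only [edgeTheta, thetaKernel, edgeTerm_diag]

lemma summable_edgeTerm (j : ℤ) {t y : ℝ} (ht : 0 < t) (hy : 0 < y) :
    Summable fun n : ℤ × ℤ => latticeSign n * edgeTerm t y (n.1 + shift j) (n.2 + shift j) := by
  refine Summable.of_norm_bounded
    (summable_thetaTerm 0 1 (lt_min ht hy) theta0 (shift j) (shift j)).norm fun n => ?_
  rw [Real.norm_eq_abs, Real.norm_eq_abs, abs_mul, abs_mul, abs_latticeSign, one_mul, one_mul]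
  exact abs_edgeTerm_le (min_le_left _ _) (min_le_right _ _) _ _

/-- The bound from `integrableOn_tail` carries |w|⁻¹ where the kernel term carries |w|; the ratio
|w|⁻² is controlled by |x₁| ≥ 1/14. -/
lemma integrableOn_edgeTerm (j : ℤ) {y : ℝ} (hy : 0 < y) (n : ℤ) (x₂ : ℝ) :
    IntegrableOn (fun t => edgeTerm t y (n + shift j) x₂ / Real.sqrt (t + y)) (Set.Ioi y) ∧
    ∫ t in Set.Ioi y, ‖edgeTerm t y (n + shift j) x₂ / Real.sqrt (t + y)‖ ≤
      1 / (2 * Real.pi * Real.sqrt y * (Real.sqrt 7 / Real.sqrt 6 * (1 / 14)) ^ 2) *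
        |thetaTerm 0 1 y theta0 (n + shift j) x₂| := by
  have hκ : 0 < Real.sqrt 7 / Real.sqrt 6 := by positivity
  have hx := one_le_abs_shift_add n j
  rw [← edgeTerm_diag]
  simp only [edgeTerm]
  set x₁ := (n : ℝ) + shift j
  set w := Real.sqrt 7 / Real.sqrt 6 * x₁ with hwdef
  have hwabs : Real.sqrt 7 / Real.sqrt 6 * (1 / 14) ≤ |w| := by
    rw [hwdef, abs_mul, abs_of_pos hκ]; gcongr
  have hw : w ≠ 0 := abs_pos.mp (lt_of_lt_of_le (by positivity) hwabs)
  have hwpos : 0 < |w| := abs_pos.mpr hw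
  obtain ⟨h1, h2⟩ := integrableOn_tail hw hy
  have e : ∀ t, w * Real.exp (-(2 * Real.pi * t * w ^ 2)) *
      Real.exp (-(2 * Real.pi * y * (quadForm x₁ x₂ + w ^ 2))) / Real.sqrt (t + y) =
      Real.exp (-(2 * Real.pi * y * (quadForm x₁ x₂ + w ^ 2))) *
        (w * Real.exp (-(2 * Real.pi * t * w ^ 2)) / Real.sqrt (t + y)) := fun t => by ring
  simp_rw [e]
  refine ⟨h1.const_mul _, ?_⟩
  simp_rw [norm_mul (Real.exp (-(2 * Real.pi * y * (quadForm x₁ x₂ + w ^ 2))))]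
  rw [integral_const_mul, Real.norm_of_nonneg (Real.exp_pos _).le, abs_mul, abs_mul, Real.abs_exp,
    Real.abs_exp]
  set E := Real.exp (-(2 * Real.pi * y * (quadForm x₁ x₂ + w ^ 2)))
  have hE : 0 < E := Real.exp_pos _
  have hpi := Real.pi_pos
  have hs : 0 < Real.sqrt y := Real.sqrt_pos.mpr hy
  calc _ ≤ E * (1 / (2 * Real.pi * Real.sqrt y * |w|) * Real.exp (-(2 * Real.pi * y * w ^ 2))) :=
        mul_le_mul_of_nonneg_left h2 hE.le
    _ = 1 / (2 * Real.pi * Real.sqrt y * |w| ^ 2) *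
        (|w| * Real.exp (-(2 * Real.pi * y * w ^ 2)) * E) := by field_simp
    _ ≤ _ := by gcongr

lemma hasSum_integral_edgeTerm (j : ℤ) {y : ℝ} (hy : 0 < y) :
    HasSum (fun n : ℤ × ℤ => latticeSign n *
      ∫ t in Set.Ioi y, edgeTerm t y (n.1 + shift j) (n.2 + shift j) / Real.sqrt (t + y))
      (∫ t in Set.Ioi y, edgeTheta j t y / Real.sqrt (t + y)) := by
  have hint : ∀ n : ℤ × ℤ, Integrable (fun t => latticeSign n *
      (edgeTerm t y (n.1 + shift j) (n.2 + shift j) / Real.sqrt (t + y)))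
      (volume.restrict (Set.Ioi y)) :=
    fun n => (integrableOn_edgeTerm j hy n.1 _).1.const_mul _
  have hsum : Summable fun n : ℤ × ℤ => ∫ t in Set.Ioi y, ‖latticeSign n *
      (edgeTerm t y (n.1 + shift j) (n.2 + shift j) / Real.sqrt (t + y))‖ := by
    refine ((summable_thetaTerm 0 1 hy theta0 (shift j) (shift j)).abs.mul_left
      (1 / (2 * Real.pi * Real.sqrt y * (Real.sqrt 7 / Real.sqrt 6 * (1 / 14)) ^ 2))).of_nonneg_of_le
      (fun n => integral_nonneg fun _ => norm_nonneg _) fun n => ?_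
    have hn : ‖latticeSign n‖ = 1 := by rw [Real.norm_eq_abs, abs_latticeSign]
    simp_rw [norm_mul, hn, one_mul, abs_mul, abs_latticeSign, one_mul]
    exact (integrableOn_edgeTerm j hy n.1 _).2
  have h := hasSum_integral_of_summable_integral_norm hint hsum
  simp_rw [integral_const_mul] at h
  have e : ∀ t : ℝ, edgeTheta j t y / Real.sqrt (t + y) = ∑' n : ℤ × ℤ, latticeSign n *
      (edgeTerm t y (n.1 + shift j) (n.2 + shift j) / Real.sqrt (t + y)) := by
    intro t
    rw [edgeTheta, ← tsum_div_const]
    exact tsum_congr fun n => by ring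
  simp_rw [e]
  exact h

lemma latticeSign_swap (n : ℤ × ℤ) : latticeSign n.swap = latticeSign n := by
  simp only [latticeSign, Prod.fst_swap, Prod.snd_swap, add_comm]

/-- Summing `sign_mul_exp_eq` over the lattice. The swap r ↔ s identifies the two wall
contributions, and 2/√2 = √2. -/
theorem hasSum_indefTheta (j : ℤ) {y : ℝ} (hy : 0 < y) :
    HasSum (fun n : ℤ × ℤ => latticeSign n *
    ((Real.sign (n.1 + shift j) + Real.sign (n.2 + shift j)) / 2 *
      Real.exp (-(2 * Real.pi * y * quadForm (n.1 + shift j) (n.2 + shift j)))))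
    (completedTheta j y +
      Real.sqrt 2 * ∫ t in Set.Ioi y, edgeTheta j t y / Real.sqrt (t + y)) := by
  have h1 := (hasSum_integral_thetaTerm 1 0 j hy theta0 theta0_nonneg).mul_left (2 * Real.sqrt y)
  have h2 := (hasSum_integral_edgeTerm j hy).mul_left (1 / Real.sqrt 2)
  have h3 := (Equiv.prodComm ℤ ℤ).hasSum_iff.mpr h2
  have h := h1.add (h2.add h3)
  have e : (2 * Real.sqrt y * ∫ θ in (-theta0)..theta0, thetaKernel 1 0 j y θ) +
      (1 / Real.sqrt 2 * (∫ t in Set.Ioi y, edgeTheta j t y / Real.sqrt (t + y)) +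
      1 / Real.sqrt 2 * (∫ t in Set.Ioi y, edgeTheta j t y / Real.sqrt (t + y))) =
      completedTheta j y +
      Real.sqrt 2 * ∫ t in Set.Ioi y, edgeTheta j t y / Real.sqrt (t + y) := by
    have h2' : Real.sqrt 2 ≠ 0 := by positivity
    have h22 : Real.sqrt 2 ^ 2 = 2 := Real.sq_sqrt (by norm_num)
    rw [completedTheta, add_right_inj, ← add_mul]
    congr 1
    field_simp
    rw [h22]; norm_num
  rw [e] at h
  refine Eq.mpr (congrArg (fun f => HasSum f _) (funext fun n => ?_)) h
  rw [sign_mul_exp_eq hy (shift_add_ne_zero n.1 j) (shift_add_ne_zero n.2 j)]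
  simp only [Function.comp_apply, Equiv.prodComm_apply, latticeSign_swap, Prod.fst_swap,
    Prod.snd_swap]
  ring

/-- The swap r ↔ s exchanges the two walls and reverses the sign of Y. -/
lemma thetaKernel_zero_one_neg (j : ℤ) (y : ℝ) :
    thetaKernel 0 1 j y (-theta0) = -thetaKernel 0 1 j y theta0 := by
  rw [thetaKernel, thetaKernel, ← tsum_neg, ← (Equiv.prodComm ℤ ℤ).tsum_eq]
  refine tsum_congr fun n => ?_
  have hQ : ∀ x₁ x₂, quadForm x₂ x₁ = quadForm x₁ x₂ := by intros; simp only [quadForm]; ring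
  simp only [Equiv.prodComm_apply, latticeSign_swap, Prod.fst_swap, Prod.snd_swap, thetaTerm,
    thetaMaj_eq_add, thetaLin_theta0, thetaLin_neg_theta0, neg_sq]
  rw [hQ]
  ring

lemma intervalIntegrable_thetaKernel (p q : ℝ) (j : ℤ) {y : ℝ} (hy : 0 < y) {T : ℝ}
    (hT : 0 ≤ T) : IntervalIntegrable (fun θ => thetaKernel p q j y θ) volume (-T) T := by
  obtain ⟨K, c, hc, h⟩ := exists_abs_thetaTerm_le p q hy T
  refine ContinuousOn.intervalIntegrable ?_
  rw [Set.uIcc_of_le (by linarith)]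
  refine continuousOn_tsum
    (fun n => ((continuous_thetaTerm p q y _ _).const_mul _).continuousOn)
    ((summable_exp_neg_mul_sq_add_sq hc (shift j) (shift j)).mul_left K) fun n θ hθ => ?_
  rw [Real.norm_eq_abs, abs_mul, abs_latticeSign, one_mul]
  exact h θ (abs_le.mpr hθ) _ _

/-- The interval [−θ₀, θ₀] is symmetric, so the reversal of θ in `thetaKernel_inv` disappears; the
prefactor √y changes the weight from 2 to 1. -/
theorem completedTheta_inv (j : ℤ) {y : ℝ} (hy : 0 < y) :
    completedTheta j y = 2 / (Real.sqrt 7 * y) *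
      ∑ k ∈ Finset.range 3, Real.sin (Real.pi * (2 * j + 1) * (2 * k + 1) / 7) *
        completedTheta k (1 / y) := by
  have hy' : 0 < 1 / y := one_div_pos.mpr hy
  have hneg : ∀ k : ℤ, ∫ θ in (-theta0)..theta0, thetaKernel 1 0 k (1 / y) (-θ) =
      ∫ θ in (-theta0)..theta0, thetaKernel 1 0 k (1 / y) θ := by
    intro k
    rw [intervalIntegral.integral_comp_neg (fun θ => thetaKernel 1 0 k (1 / y) θ), neg_neg]
  have hint : ∀ k : ℤ, IntervalIntegrable (fun θ => thetaKernel 1 0 k (1 / y) (-θ)) volume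
      (-theta0) theta0 := by
    intro k
    have := (IntervalIntegrable.iff_comp_neg (by simp)).mp
      (intervalIntegrable_thetaKernel 1 0 k hy' theta0_nonneg)
    rw [neg_neg] at this
    exact this.symm
  have hs : Real.sqrt (1 / y) = 1 / Real.sqrt y := by rw [Real.sqrt_div zero_le_one, Real.sqrt_one]
  simp_rw [completedTheta, thetaKernel_inv 1 0 j hy]
  rw [intervalIntegral.integral_const_mul,
    intervalIntegral.integral_finsetSum (s := Finset.range 3) (f := fun (k : ℕ) θ =>
      Real.sin (Real.pi * (2 * j + 1) * (2 * k + 1) / 7) * thetaKernel 1 0 k (1 / y) (-θ))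
      (fun k _ => (hint k).const_mul _)]
  simp_rw [intervalIntegral.integral_const_mul, hneg, hs, Finset.mul_sum]
  refine Finset.sum_congr rfl fun k _ => ?_
  have h1 : Real.sqrt y ≠ 0 := (Real.sqrt_pos.mpr hy).ne'
  have h2 : Real.sqrt y ^ 2 = y := Real.sq_sqrt hy.le
  field_simp
  rw [h2]

/-! ### The wall series factors as g₇ times η -/

/-- The unary theta series `∑ (-1)^n (n + m/42) exp(-21πt (n + m/42)²)`. -/
def unaryReal (m : ℤ) (t : ℝ) : ℝ :=
  ∑' n : ℤ, (-1 : ℝ) ^ n * ((n + m / 42) * Real.exp (-(21 * Real.pi * t) * (n + m / 42) ^ 2))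

/-- The theta series `∑ (-1)^n exp(-3πy (n + m/6)²)`. -/
def etaTheta (m : ℤ) (y : ℝ) : ℝ :=
  ∑' n : ℤ, (-1 : ℝ) ^ n * Real.exp (-(3 * Real.pi * y) * (n + m / 6) ^ 2)

lemma abs_neg_one_zpow_real (n : ℤ) : |(-1 : ℝ) ^ n| = 1 := by rw [abs_zpow]; simp

lemma summable_unaryReal (m : ℤ) {t : ℝ} (ht : 0 < t) : Summable fun n : ℤ =>
    ‖(-1 : ℝ) ^ n * ((n + m / 42) * Real.exp (-(21 * Real.pi * t) * (n + m / 42) ^ 2))‖ := by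
  have hc : 0 < 21 * Real.pi * t := by have := Real.pi_pos; positivity
  refine (summable_linear_mul_exp_neg_mul_sq hc (m / 42)).congr fun n => ?_
  rw [Real.norm_eq_abs, abs_mul, abs_neg_one_zpow_real, one_mul, abs_mul, Real.abs_exp]

lemma summable_etaTheta (m : ℤ) {y : ℝ} (hy : 0 < y) : Summable fun n : ℤ =>
    ‖(-1 : ℝ) ^ n * Real.exp (-(3 * Real.pi * y) * (n + m / 6) ^ 2)‖ := by
  have hc : 0 < 3 * Real.pi * y := by have := Real.pi_pos; positivity
  refine (summable_exp_neg_mul_sq hc (m / 6)).congr fun n => ?_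
  rw [Real.norm_eq_abs, abs_mul, abs_neg_one_zpow_real, one_mul, Real.abs_exp]

lemma unaryReal_sub (m : ℤ) (t : ℝ) : unaryReal (42 - m) t = unaryReal m t := by
  rw [unaryReal, unaryReal, ← (Equiv.subLeft (-1 : ℤ)).tsum_eq]
  refine tsum_congr fun n => ?_
  have e : (((-1 - n : ℤ) : ℝ) + (42 - m : ℤ) / 42) = -(n + m / 42) := by push_cast; ring
  rw [Equiv.subLeft_apply, e, neg_sq, zpow_sub₀ (by norm_num), zpow_neg_one]
  have : ((-1 : ℝ) ^ n)⁻¹ = (-1 : ℝ) ^ n := by rw [← inv_zpow]; norm_num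
  rw [div_eq_mul_inv, this]
  ring

lemma etaTheta_add (m : ℤ) (y : ℝ) : etaTheta (m + 6) y = -etaTheta m y := by
  rw [etaTheta, etaTheta, ← tsum_neg, ← (Equiv.subRight (1 : ℤ)).tsum_eq]
  refine tsum_congr fun n => ?_
  have e : (((n - 1 : ℤ) : ℝ) + (m + 6 : ℤ) / 6) = n + m / 6 := by push_cast; ring
  rw [Equiv.subRight_apply, e, zpow_sub₀ (by norm_num), zpow_one]
  ring

lemma etaTheta_neg (m : ℤ) (y : ℝ) : etaTheta (-m) y = etaTheta m y := by
  rw [etaTheta, etaTheta, ← (Equiv.neg ℤ).tsum_eq]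
  refine tsum_congr fun n => ?_
  have e : (((-n : ℤ) : ℝ) + (-m : ℤ) / 6) = -(n + m / 6) := by push_cast; ring
  rw [Equiv.neg_apply, e, neg_sq, zpow_neg, ← inv_zpow]
  norm_num

/-- The sublattice adapted to one boundary of the cone, of index three, and its translates. -/
def edgeEquiv : Fin 3 × (ℤ × ℤ) ≃ ℤ × ℤ where
  toFun x := (3 * x.2.1 + x.1, x.2.2 - 4 * x.2.1)
  invFun n := (⟨(n.1 % 3).toNat, by omega⟩, (n.1 / 3, n.2 + 4 * (n.1 / 3)))
  left_inv x := by
    obtain ⟨⟨k, hk⟩, r, s⟩ := x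
    simp only [Prod.mk.injEq, Fin.mk.injEq]
    omega
  right_inv n := by
    obtain ⟨m, n⟩ := n
    simp only [Prod.mk.injEq]
    omega

/-- Writing x₁ = 3ν and x₂ = μ − 4ν removes the cross term: Q + (7/6)x₁² = (3/2)μ². On each
translate the double series therefore separates. -/
lemma edgeTerm_edgeEquiv (j : ℤ) (t y : ℝ) (ρ : Fin 3) (n : ℤ × ℤ) :
    latticeSign (edgeEquiv (ρ, n)) *
      edgeTerm t y ((edgeEquiv (ρ, n)).1 + shift j) ((edgeEquiv (ρ, n)).2 + shift j) =
    3 * (Real.sqrt 7 / Real.sqrt 6) * (-1) ^ (ρ : ℕ) *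
      (((-1 : ℝ) ^ n.1 * ((n.1 + (2 * j + 1 + 14 * ρ : ℤ) / 42) *
        Real.exp (-(21 * Real.pi * t) * (n.1 + (2 * j + 1 + 14 * ρ : ℤ) / 42) ^ 2))) *
      ((-1 : ℝ) ^ n.2 *
        Real.exp (-(3 * Real.pi * y) * (n.2 + (2 * j + 1 + 8 * ρ : ℤ) / 6) ^ 2))) := by
  obtain ⟨k, s⟩ := n
  have hκ : (Real.sqrt 7 / Real.sqrt 6) ^ 2 = 7 / 6 := by
    rw [div_pow, Real.sq_sqrt (by norm_num), Real.sq_sqrt (by norm_num)]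
  have e1 : ((edgeEquiv (ρ, (k, s))).1 : ℝ) + shift j =
      3 * (k + (2 * j + 1 + 14 * ρ : ℤ) / 42) := by
    simp only [edgeEquiv, Equiv.coe_fn_mk, shift]; push_cast; ring
  have e2 : ((edgeEquiv (ρ, (k, s))).2 : ℝ) + shift j =
      (s + (2 * j + 1 + 8 * ρ : ℤ) / 6) - 4 * (k + (2 * j + 1 + 14 * ρ : ℤ) / 42) := by
    simp only [edgeEquiv, Equiv.coe_fn_mk, shift]; push_cast; ring
  have e3 : latticeSign (edgeEquiv (ρ, (k, s))) = (-1) ^ (ρ : ℕ) * ((-1) ^ k * (-1) ^ s) := by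
    simp only [latticeSign, edgeEquiv, Equiv.coe_fn_mk]
    rw [show 3 * k + ((ρ : ℕ) : ℤ) + (s - 4 * k) = (ρ : ℕ) + (k + s) + (-k + -k) by ring,
      zpow_add₀ (by norm_num), zpow_add₀ (by norm_num), Even.neg_one_zpow ⟨-k, rfl⟩,
      zpow_natCast, zpow_add₀ (by norm_num), mul_one]
  rw [e1, e2, e3, edgeTerm]
  generalize ((k : ℝ) + (2 * j + 1 + 14 * ρ : ℤ) / 42) = ν
  generalize ((s : ℝ) + (2 * j + 1 + 8 * ρ : ℤ) / 6) = μ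
  rw [show -(2 * Real.pi * t * (Real.sqrt 7 / Real.sqrt 6 * (3 * ν)) ^ 2) =
    -(21 * Real.pi * t) * ν ^ 2 by rw [mul_pow, hκ]; ring,
    show -(2 * Real.pi * y * (quadForm (3 * ν) (μ - 4 * ν) +
      (Real.sqrt 7 / Real.sqrt 6 * (3 * ν)) ^ 2)) = -(3 * Real.pi * y) * μ ^ 2 by
      rw [mul_pow, hκ, quadForm]; ring]
  ring

lemma edgeTheta_eq_sum (j : ℤ) {t y : ℝ} (ht : 0 < t) (hy : 0 < y) :
    edgeTheta j t y = ∑ ρ : Fin 3, 3 * (Real.sqrt 7 / Real.sqrt 6) * (-1) ^ (ρ : ℕ) *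
      (unaryReal (2 * j + 1 + 14 * ρ) t * etaTheta (2 * j + 1 + 8 * ρ) y) := by
  have hs := edgeEquiv.summable_iff.mpr (summable_edgeTerm j ht hy)
  have h1 := edgeEquiv.tsum_eq (fun n => latticeSign n *
    edgeTerm t y (n.1 + shift j) (n.2 + shift j))
  rw [edgeTheta, ← h1]
  refine (Summable.tsum_prod hs).trans ?_
  rw [tsum_fintype]
  refine Finset.sum_congr rfl fun ρ _ => ?_
  simp only [Function.comp_apply]
  simp_rw [edgeTerm_edgeEquiv]
  rw [tsum_mul_left, unaryReal, etaTheta,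
    tsum_mul_tsum_of_summable_norm (summable_unaryReal _ ht) (summable_etaTheta _ hy)]

/-- The components of `g₇` on the imaginary axis. -/
def g7Real (j : ℕ) (t : ℝ) : ℝ :=
  match j with
  | 0 => unaryReal 13 t - unaryReal 41 t
  | 1 => unaryReal 11 t + unaryReal 25 t
  | _ => unaryReal 23 t + unaryReal 37 t

lemma etaTheta_three (y : ℝ) : etaTheta 3 y = 0 := by
  have h1 := etaTheta_add (-3) y
  rw [etaTheta_neg] at h1
  norm_num at h1
  linarith

/-- The η-factors have odd index: for multiples of 3 they vanish, otherwise they are ±`etaTheta 1`.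
So two of the three translates survive, and their unary factors form the component of g₇. -/
theorem edgeTheta_eq_mul {j : ℕ} (hj : j < 3) {t y : ℝ} (ht : 0 < t) (hy : 0 < y) :
    edgeTheta j t y = -(3 * (Real.sqrt 7 / Real.sqrt 6)) * (g7Real j t * etaTheta 1 y) := by
  have e3 := etaTheta_three y
  have e5 : etaTheta 5 y = -etaTheta 1 y := by
    have := etaTheta_add (-1) y; rw [etaTheta_neg] at this; exact this
  have e9 : etaTheta 9 y = 0 := by have := etaTheta_add 3 y; rw [e3, neg_zero] at this; exact this
  have e11 : etaTheta 11 y = etaTheta 1 y := by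
    have := etaTheta_add 5 y; rw [e5, neg_neg] at this; exact this
  have e13 : etaTheta 13 y = etaTheta 1 y := by
    have := etaTheta_add 7 y
    have h7 := etaTheta_add 1 y
    norm_num at this h7
    rw [this, h7, neg_neg]
  have e17 : etaTheta 17 y = -etaTheta 1 y := by
    have := etaTheta_add 11 y; rw [e11] at this; exact this
  have e19 : etaTheta 19 y = -etaTheta 1 y := by
    have := etaTheta_add 13 y; rw [e13] at this; exact this
  have e21 : etaTheta 21 y = 0 := by
    have := etaTheta_add 9 y
    have h15 := etaTheta_add 15 y
    norm_num at this h15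
    rw [h15, this, e9]; simp
  have u1 := unaryReal_sub 1 t
  have u13 := unaryReal_sub 13 t
  have u11 := unaryReal_sub 11 t
  have u17 := unaryReal_sub 17 t
  have u5 := unaryReal_sub 5 t
  have u19 := unaryReal_sub 19 t
  norm_num at u1 u13 u11 u17 u5 u19
  rw [edgeTheta_eq_sum _ ht hy, Fin.sum_univ_three]
  interval_cases j
  · norm_num [g7Real, e9, e17, u1, u13]; ring
  · norm_num [g7Real, e3, e11, e19, u11, u17]; ring
  · norm_num [g7Real, e5, e13, e21, u5, u19]; ring

/-! ### The η-function: pentagonal numbers and inversion -/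

lemma abs_prod_one_sub_pow_le_one {x : ℝ} (h0 : 0 ≤ x) (h1 : x ≤ 1) (k m : ℕ) :
    |∏ i ∈ Finset.range m, (1 - x ^ (k + i + 1))| ≤ 1 := by
  rw [Finset.abs_prod]
  refine Finset.prod_le_one (fun _ _ => abs_nonneg _) fun i _ => ?_
  have := pow_le_one₀ (n := k + i + 1) h0 h1
  have := pow_nonneg h0 (k + i + 1)
  rw [abs_le]; constructor <;> linarith

lemma le_pentagonal (k : ℕ) : k ≤ pentagonal (-k) ∧ k ≤ pentagonal (k + 1) := by
  have h1 := two_mul_natCast_pentagonal_neg (k : ℤ)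
  have h2 := two_mul_natCast_pentagonal ((k : ℤ) + 1)
  constructor
  · zify; nlinarith
  · zify; nlinarith

lemma summable_pow_pentagonal {x : ℝ} (h0 : 0 ≤ x) (h1 : x < 1) :
    (Summable fun k : ℕ => (-1) ^ k * x ^ pentagonal (-k)) ∧
    Summable fun k : ℕ => (-1) ^ k * x ^ pentagonal (k + 1) := by
  have hg := summable_geometric_of_lt_one h0 h1
  constructor
  · refine Summable.of_norm_bounded hg fun k => ?_
    rw [norm_mul, norm_pow, norm_neg, norm_one, one_pow, one_mul, norm_pow,
      Real.norm_of_nonneg h0]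
    exact pow_le_pow_of_le_one h0 h1.le (le_pentagonal k).1
  · refine Summable.of_norm_bounded hg fun k => ?_
    rw [norm_mul, norm_pow, norm_neg, norm_one, one_pow, one_mul, norm_pow,
      Real.norm_of_nonneg h0]
    exact pow_le_pow_of_le_one h0 h1.le (le_pentagonal k).2

/-- Euler's pentagonal number theorem for real `0 ≤ x < 1`. -/
theorem tprod_one_sub_pow_real {x : ℝ} (h0 : 0 ≤ x) (h1 : x < 1) :
    ∏' n : ℕ, (1 - x ^ (n + 1)) =
      ∑' k : ℕ, (-1) ^ k * (x ^ pentagonal (-k) - x ^ pentagonal (k + 1)) := by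
  have hterm : ∀ k n : ℕ, ‖x ^ ((k + 1) * n) * ∏ i ∈ Finset.range (n + 1),
      (1 - x ^ (k + i + 1))‖ ≤ x ^ n := by
    intro k n
    rw [norm_mul, norm_pow, Real.norm_of_nonneg h0]
    refine (mul_le_of_le_one_right (by positivity)
      (abs_prod_one_sub_pow_le_one h0 h1.le k (n + 1))).trans ?_
    exact pow_le_pow_of_le_one h0 h1.le (Nat.le_mul_of_pos_left n (Nat.succ_pos k))
  have hg := summable_geometric_of_lt_one h0 h1
  have hpow : Filter.Tendsto (fun k : ℕ => x ^ k) Filter.atTop (nhds 0) :=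
    tendsto_pow_atTop_nhds_zero_of_lt_one h0 h1
  refine Pentagonal.tprod_one_sub_pow hpow (fun k => Summable.of_norm_bounded hg (hterm k))
    (fun k => ?_) ?_ ?_
  · have : Summable fun n : ℕ => ‖-x ^ (n + k + 1)‖ := by
      simp_rw [norm_neg, norm_pow, Real.norm_of_nonneg h0, add_assoc, pow_add]
      exact hg.mul_right _
    simpa [sub_eq_add_neg] using multipliable_one_add_of_summable this
  · obtain ⟨s1, s2⟩ := summable_pow_pentagonal h0 h1
    exact (s1.sub s2).congr fun k => by ring
  · refine squeeze_zero_norm (a := fun k => x ^ k * (1 - x)⁻¹) (fun k => ?_) ?_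
    · rw [norm_mul, norm_mul, norm_pow, norm_neg, norm_one, one_pow, one_mul, norm_pow,
        Real.norm_of_nonneg h0]
      refine mul_le_mul ?_ ?_ (norm_nonneg _) (by positivity)
      · apply pow_le_pow_of_le_one h0 h1.le
        rw [Nat.le_div_iff_mul_le (by norm_num)]
        nlinarith
      · exact tsum_of_norm_bounded (hasSum_geometric_of_lt_one h0 h1) (hterm k)
    · simpa using hpow.mul_const (1 - x)⁻¹

/-- Since (3/2)(n + 1/6)² = 1/24 + n(3n + 1)/2, the indices n ≥ 0 and n < 0 run through the two
families of pentagonal numbers. -/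
lemma etaTheta_one_eq {y : ℝ} (hy : 0 < y) :
    etaTheta 1 y = Real.exp (-(2 * Real.pi * y) / 24) *
      ∏' n : ℕ, (1 - Real.exp (-(2 * Real.pi * y)) ^ (n + 1)) := by
  set x := Real.exp (-(2 * Real.pi * y)) with hx
  have hpi := Real.pi_pos
  have h0 : 0 ≤ x := (Real.exp_pos _).le
  have h1 : x < 1 := Real.exp_lt_one_iff.mpr (neg_neg_of_pos (by positivity))
  obtain ⟨s1, s2⟩ := summable_pow_pentagonal h0 h1
  have hp : ∀ N : ℕ, Real.exp (-(2 * Real.pi * y) / 24) * x ^ N =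
      Real.exp (-(2 * Real.pi * y) / 24 + -(2 * Real.pi * y) * N) := by
    intro N
    rw [hx, ← Real.exp_nat_mul, ← Real.exp_add]; congr 1; ring
  have t1 : ∀ k : ℕ, (-1 : ℝ) ^ (k : ℤ) *
      Real.exp (-(3 * Real.pi * y) * (((k : ℤ) : ℝ) + (1 : ℤ) / 6) ^ 2) =
      Real.exp (-(2 * Real.pi * y) / 24) * ((-1) ^ k * x ^ pentagonal (-k)) := by
    intro k
    have h := two_mul_natCast_pentagonal_neg (k : ℤ)
    have h' : 2 * ((pentagonal (-(k : ℤ)) : ℕ) : ℝ) = k * (3 * k + 1) := by exact_mod_cast h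
    rw [mul_left_comm, hp, zpow_natCast]
    congr 2
    push_cast
    linear_combination (Real.pi * y) * h'
  have t2 : ∀ k : ℕ, (-1 : ℝ) ^ (-((k : ℤ) + 1)) *
      Real.exp (-(3 * Real.pi * y) * (((-((k : ℤ) + 1) : ℤ) : ℝ) + (1 : ℤ) / 6) ^ 2) =
      Real.exp (-(2 * Real.pi * y) / 24) * -((-1) ^ k * x ^ pentagonal (k + 1)) := by
    intro k
    have h := two_mul_natCast_pentagonal ((k : ℤ) + 1)
    have h' : 2 * ((pentagonal ((k : ℤ) + 1) : ℕ) : ℝ) = (k + 1) * (3 * (k + 1) - 1) := by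
      exact_mod_cast h
    have e : (-1 : ℝ) ^ (-((k : ℤ) + 1)) = -(-1) ^ k := by
      rw [zpow_neg, zpow_add₀ (by norm_num), zpow_natCast, zpow_one, mul_neg_one, inv_neg,
        ← inv_pow]
      norm_num
    rw [e, neg_mul, mul_neg, neg_inj, mul_left_comm, hp]
    congr 2
    push_cast
    linear_combination (Real.pi * y) * h'
  rw [tprod_one_sub_pow_real h0 h1, etaTheta, tsum_of_nat_of_neg_add_one]
  · simp_rw [t1, t2, tsum_mul_left, tsum_neg, mul_sub]
    rw [s1.tsum_sub s2]
    ring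
  · simp_rw [t1]; exact s1.mul_left _
  · simp_rw [t2]; exact s2.neg.mul_left _

lemma ofReal_etaTheta_one {y : ℝ} (hy : 0 < y) :
    (etaTheta 1 y : ℂ) = qpow (1 / 24) (I * y) * qInf (qpow 1 (I * y)) := by
  have e1 : ∀ s : ℝ, qpow s (I * y) = ((Real.exp (-(2 * Real.pi * y) * s) : ℝ) : ℂ) := by
    intro s
    rw [qpow, ofReal_exp]; congr 1; push_cast
    linear_combination (2 * Real.pi * s * y) * I_sq
  have hpi := Real.pi_pos
  have h1 : Real.exp (-(2 * Real.pi * y)) < 1 :=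
    Real.exp_lt_one_iff.mpr (neg_neg_of_pos (by positivity))
  have hm : Multipliable fun n : ℕ => 1 - Real.exp (-(2 * Real.pi * y)) ^ (n + 1) := by
    have : Summable fun n : ℕ => ‖-Real.exp (-(2 * Real.pi * y)) ^ (n + 1)‖ := by
      simp_rw [norm_neg, norm_pow, Real.norm_of_nonneg (Real.exp_pos _).le, pow_succ]
      exact (summable_geometric_of_lt_one (Real.exp_pos _).le h1).mul_right _
    simpa [sub_eq_add_neg] using multipliable_one_add_of_summable this
  have h2 := hm.map_tprod Complex.ofRealHom Complex.continuous_ofReal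
  rw [etaTheta_one_eq hy, e1, e1, qInf, ofReal_mul]
  congr 1
  · congr 2; ring
  · rw [mul_one]
    refine h2.trans (tprod_congr fun n => ?_)
    simp

lemma ofReal_etaTheta_one_eq_eta {y : ℝ} (hy : 0 < y) :
    (etaTheta 1 y : ℂ) = ModularForm.eta (I * y) := by
  rw [ofReal_etaTheta_one hy, ModularForm.eta, qpow, qInf]
  congr 1
  · rw [Function.Periodic.qParam]; congr 1; push_cast; ring
  · refine tprod_congr fun n => ?_
    rw [ModularForm.eta_q, Function.Periodic.qParam, qpow]
    congr 3; push_cast; ring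

lemma etaTheta_one_ne_zero {y : ℝ} (hy : 0 < y) : etaTheta 1 y ≠ 0 := by
  have h : (etaTheta 1 y : ℂ) ≠ 0 := by
    rw [ofReal_etaTheta_one_eq_eta hy]
    exact ModularForm.eta_ne_zero (by simpa [UpperHalfPlane.upperHalfPlaneSet] using hy)
  exact_mod_cast h

lemma etaTheta_one_inv {y : ℝ} (hy : 0 < y) :
    etaTheta 1 (1 / y) = Real.sqrt y * etaTheta 1 y := by
  have hy' : (y : ℂ) ≠ 0 := by exact_mod_cast hy.ne'
  have h : (etaTheta 1 (1 / y) : ℂ) = ((Real.sqrt y * etaTheta 1 y : ℝ) : ℂ) := by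
    have h1 := ModularForm.eta_comp_eq_csqrt_I_inv
      (show I * y ∈ UpperHalfPlane.upperHalfPlaneSet by
        simpa [UpperHalfPlane.upperHalfPlaneSet] using hy)
    have e : -1 / (I * y) = I * ((1 / y : ℝ) : ℂ) := by
      push_cast; field_simp; simp
    simp only [Function.comp_apply, e, Pi.smul_apply, Pi.mul_apply, smul_eq_mul] at h1
    rw [ofReal_mul, ofReal_etaTheta_one_eq_eta (one_div_pos.mpr hy),
      ofReal_etaTheta_one_eq_eta hy, h1]
    -- Splitting √(iy) lets the constant √i in the transformation of `ModularForm.eta` cancel.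
    have hs : Complex.sqrt (I * y) = Real.sqrt y * Complex.sqrt I := by
      rw [sqrt_eq_exp (mul_ne_zero I_ne_zero hy'), sqrt_eq_exp I_ne_zero,
        Complex.log_mul_ofReal y hy I I_ne_zero, add_div, Complex.exp_add,
        Real.sqrt_eq_rpow, Real.rpow_def_of_pos hy, ofReal_exp]
      push_cast
      congr 2; ring
    have hI : Complex.sqrt I ≠ 0 := by
      rw [sqrt_eq_exp I_ne_zero]; exact Complex.exp_ne_zero _
    rw [hs]
    field_simp
  exact_mod_cast h

/-! ### Inversion and integrability of g₇ -/

/-- The trigonometric entries `sin(π(2j+1)(2k+1)/7)`. -/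
def sinEntry (j k : ℕ) : ℝ := Real.sin (Real.pi * (2 * j + 1) * (2 * k + 1) / 7)

/-- At t = y the wall series is the kernel with p = 0, q = 1 at θ₀, of weight 2. Dividing its
inversion by that of η, which has no zero, leaves weight 3/2; the sign comes from
`thetaKernel_zero_one_neg`. -/
lemma g7Real_inv {j : ℕ} (hj : j < 3) {y : ℝ} (hy : 0 < y) :
    g7Real j y = -(2 / (Real.sqrt 7 * (y * Real.sqrt y))) *
      ∑ k ∈ Finset.range 3, sinEntry j k * g7Real k (1 / y) := by
  have hy' : 0 < 1 / y := one_div_pos.mpr hy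
  have h := thetaKernel_inv 0 1 j hy theta0
  have hk : ∀ k ∈ Finset.range 3, Real.sin (Real.pi * (2 * (j : ℤ) + 1) * (2 * k + 1) / 7) *
      thetaKernel 0 1 k (1 / y) (-theta0) =
      3 * (Real.sqrt 7 / Real.sqrt 6) * (Real.sqrt y * etaTheta 1 y) *
        (sinEntry j k * g7Real k (1 / y)) := by
    intro k hk
    rw [thetaKernel_zero_one_neg, ← edgeTheta_diag,
      edgeTheta_eq_mul (Finset.mem_range.mp hk) hy' hy', etaTheta_one_inv hy, sinEntry,
      Int.cast_natCast]
    ring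
  rw [← edgeTheta_diag, edgeTheta_eq_mul hj hy hy, Finset.sum_congr rfl hk, ← Finset.mul_sum] at h
  have he := etaTheta_one_ne_zero hy
  have hs : Real.sqrt y ≠ 0 := (Real.sqrt_pos.mpr hy).ne'
  have hs2 : Real.sqrt y ^ 2 = y := Real.sq_sqrt hy.le
  have h7 : Real.sqrt 7 ≠ 0 := by positivity
  have h6 : Real.sqrt 6 ≠ 0 := by positivity
  generalize (∑ k ∈ Finset.range 3, sinEntry j k * g7Real k (1 / y)) = S at h ⊢
  have h' : g7Real j y * (3 * (Real.sqrt 7 / Real.sqrt 6) * etaTheta 1 y) =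
      -(2 / (Real.sqrt 7 * (y * Real.sqrt y))) * S *
        (3 * (Real.sqrt 7 / Real.sqrt 6) * etaTheta 1 y) := by
    have e : -(2 / (Real.sqrt 7 * (y * Real.sqrt y))) * S *
        (3 * (Real.sqrt 7 / Real.sqrt 6) * etaTheta 1 y) =
        -(2 / (Real.sqrt 7 * y ^ 2) * (3 * (Real.sqrt 7 / Real.sqrt 6) *
          (Real.sqrt y * etaTheta 1 y) * S)) := by
      field_simp
      rw [hs2]
    rw [e, ← h]; ring
  exact mul_right_cancel₀ (by positivity) h'

lemma continuousOn_unaryReal (m : ℤ) : ContinuousOn (unaryReal m) (Set.Ioi 0) := by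
  intro t ht
  have ht' : 0 < t / 2 := half_pos ht
  have hpi := Real.pi_pos
  have h : ContinuousOn (unaryReal m) (Set.Ioi (t / 2)) := by
    refine continuousOn_tsum (fun n => by fun_prop) (summable_unaryReal m ht') fun n s hs => ?_
    have hs' : t / 2 ≤ s := le_of_lt hs
    simp only [Real.norm_eq_abs, abs_mul, abs_neg_one_zpow_real, Real.abs_exp, one_mul]
    gcongr ?_ * ?_
    apply Real.exp_le_exp.mpr
    have := mul_le_mul_of_nonneg_right hs'
      (mul_nonneg hpi.le (sq_nonneg ((n : ℝ) + m / 42)))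
    linarith
  exact (h.continuousAt (Ioi_mem_nhds (half_lt_self ht))).continuousWithinAt

/-- As 42 ∤ m, every |n + m/42| is at least 1/42, which gives exponential decay in t. -/
lemma integrableOn_unaryReal {m : ℤ} (hm : ¬ 42 ∣ m) {y : ℝ} (hy : 0 < y) :
    IntegrableOn (unaryReal m) (Set.Ioi y) := by
  have hpi := Real.pi_pos
  set c := 21 * Real.pi / 42 ^ 2 with hc
  have hc0 : 0 < c := by positivity
  set C := ∑' n : ℤ,
    ‖(-1 : ℝ) ^ n * ((n + m / 42) * Real.exp (-(21 * Real.pi * y) * (n + m / 42) ^ 2))‖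
  have hI : IntegrableOn (fun t => C * Real.exp (c * y) * Real.exp (-c * t)) (Set.Ioi y) :=
    (integrableOn_exp_mul_Ioi (by linarith) y).const_mul _
  refine Integrable.mono' hI (((continuousOn_unaryReal m).mono
    (Set.Ioi_subset_Ioi hy.le)).aestronglyMeasurable measurableSet_Ioi)
    ((ae_restrict_iff' measurableSet_Ioi).mpr (.of_forall fun t ht => ?_))
  have ht' : y < t := ht
  have hterm : ∀ n : ℤ,
      ‖(-1 : ℝ) ^ n * ((n + m / 42) * Real.exp (-(21 * Real.pi * t) * (n + m / 42) ^ 2))‖ ≤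
      ‖(-1 : ℝ) ^ n * ((n + m / 42) * Real.exp (-(21 * Real.pi * y) * (n + m / 42) ^ 2))‖ *
        Real.exp (-(c * (t - y))) := by
    intro n
    have hν : 1 / 42 ^ 2 ≤ ((n : ℝ) + m / 42) ^ 2 := by
      have h1 : (1 : ℝ) ≤ ((42 * n + m : ℤ) : ℝ) ^ 2 := by
        have : 42 * n + m ≠ 0 := fun h => hm ⟨-n, by linarith⟩
        have : 1 ≤ (42 * n + m) ^ 2 := by
          have := sq_pos_of_ne_zero this
          omega
        exact_mod_cast this
      have h2 : ((n : ℝ) + m / 42) = ((42 * n + m : ℤ) : ℝ) / 42 := by push_cast; ring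
      rw [h2, div_pow]
      gcongr
    simp only [Real.norm_eq_abs, abs_mul, abs_neg_one_zpow_real, Real.abs_exp, one_mul]
    rw [mul_assoc |(n : ℝ) + m / 42|, ← Real.exp_add]
    gcongr ?_ * ?_
    apply Real.exp_le_exp.mpr
    have := mul_le_mul_of_nonneg_left hν
      (show 0 ≤ 21 * Real.pi * (t - y) by
        have : 0 ≤ t - y := by linarith
        positivity)
    rw [hc]
    linarith
  calc ‖unaryReal m t‖ ≤ ∑' n : ℤ, ‖(-1 : ℝ) ^ n *
        ((n + m / 42) * Real.exp (-(21 * Real.pi * t) * (n + m / 42) ^ 2))‖ :=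
        norm_tsum_le_tsum_norm (summable_unaryReal m (hy.trans ht'))
    _ ≤ ∑' n : ℤ, ‖(-1 : ℝ) ^ n * ((n + m / 42) *
        Real.exp (-(21 * Real.pi * y) * (n + m / 42) ^ 2))‖ * Real.exp (-(c * (t - y))) :=
        (summable_unaryReal m (hy.trans ht')).tsum_le_tsum hterm
          ((summable_unaryReal m hy).mul_right _)
    _ = C * Real.exp (c * y) * Real.exp (-c * t) := by
        rw [tsum_mul_right]
        change C * _ = _
        rw [mul_assoc C, ← Real.exp_add]
        congr 2; ring

lemma integrableOn_g7Real_Ioi (j : ℕ) {y : ℝ} (hy : 0 < y) :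
    IntegrableOn (g7Real j) (Set.Ioi y) := by
  match j with
  | 0 =>
    exact (integrableOn_unaryReal (m := 13) (by norm_num) hy).sub
      (integrableOn_unaryReal (m := 41) (by norm_num) hy)
  | 1 =>
    exact (integrableOn_unaryReal (m := 11) (by norm_num) hy).add
      (integrableOn_unaryReal (m := 25) (by norm_num) hy)
  | _ + 2 =>
    exact (integrableOn_unaryReal (m := 23) (by norm_num) hy).add
      (integrableOn_unaryReal (m := 37) (by norm_num) hy)

lemma image_one_div_Ioo {y : ℝ} (hy : 0 < y) :
    (fun s : ℝ => 1 / s) '' Set.Ioo 0 y = Set.Ioi (1 / y) := by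
  ext t
  constructor
  · rintro ⟨s, ⟨h0, h1⟩, rfl⟩
    exact one_div_lt_one_div_of_lt h0 h1
  · intro ht
    have ht0 : 0 < t := (one_div_pos.mpr hy).trans ht
    exact ⟨1 / t, ⟨one_div_pos.mpr ht0, by rw [one_div_lt ht0 hy]; exact ht⟩, one_div_one_div t⟩

lemma hasDerivWithinAt_one_div {y : ℝ} :
    ∀ s ∈ Set.Ioo 0 y, HasDerivWithinAt (fun s : ℝ => 1 / s) (-(s ^ 2)⁻¹) (Set.Ioo 0 y) s := by
  intro s hs
  simpa only [one_div] using (hasDerivAt_inv hs.1.ne').hasDerivWithinAt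

lemma injOn_one_div (y : ℝ) : Set.InjOn (fun s : ℝ => 1 / s) (Set.Ioo 0 y) :=
  fun a _ b _ h => by simpa using h

/-- Inversion writes g₇(s) as √s times combinations of s⁻² g₇(1/s); the latter are pullbacks from
(1/y, ∞) with their Jacobian, and √s is bounded. -/
lemma integrableOn_g7Real_Ioo {j : ℕ} (hj : j < 3) {y : ℝ} (hy : 0 < y) :
    IntegrableOn (g7Real j) (Set.Ioo 0 y) := by
  have h1 : ∀ k, IntegrableOn (fun s => (s ^ 2)⁻¹ * g7Real k (1 / s)) (Set.Ioo 0 y) := by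
    intro k
    have := (integrableOn_image_iff_integrableOn_abs_deriv_smul measurableSet_Ioo
      hasDerivWithinAt_one_div (injOn_one_div y) (g7Real k)).mp
      (by rw [image_one_div_Ioo hy]; exact integrableOn_g7Real_Ioi k (one_div_pos.mpr hy))
    refine this.congr_fun (fun s hs => ?_) measurableSet_Ioo
    simp only [abs_neg, abs_inv, abs_pow, sq_abs, smul_eq_mul]
  have h2 : IntegrableOn (fun s => -(2 / Real.sqrt 7) *
      ∑ k ∈ Finset.range 3, sinEntry j k * ((s ^ 2)⁻¹ * g7Real k (1 / s))) (Set.Ioo 0 y) :=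
    (integrable_finsetSum _ fun k _ => (h1 k).const_mul _).const_mul _
  have h3 : IntegrableOn (fun s => Real.sqrt s * (-(2 / Real.sqrt 7) *
      ∑ k ∈ Finset.range 3, sinEntry j k * ((s ^ 2)⁻¹ * g7Real k (1 / s)))) (Set.Ioo 0 y) := by
    refine Integrable.bdd_mul (c := Real.sqrt y) h2
      (Real.continuous_sqrt.aestronglyMeasurable)
      ((ae_restrict_iff' measurableSet_Ioo).mpr (.of_forall fun s hs => ?_))
    rw [Real.norm_of_nonneg (Real.sqrt_nonneg s)]
    exact Real.sqrt_le_sqrt hs.2.le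
  refine h3.congr_fun (fun s hs => ?_) measurableSet_Ioo
  have hs0 : 0 < s := hs.1
  rw [g7Real_inv hj hs0]
  have e : ∑ k ∈ Finset.range 3, sinEntry j k * ((s ^ 2)⁻¹ * g7Real k (1 / s)) =
      (s ^ 2)⁻¹ * ∑ k ∈ Finset.range 3, sinEntry j k * g7Real k (1 / s) := by
    rw [Finset.mul_sum]; exact Finset.sum_congr rfl fun k _ => by ring
  simp only [e]
  have hss : Real.sqrt s ≠ 0 := (Real.sqrt_pos.mpr hs0).ne'
  have hs2 : Real.sqrt s ^ 2 = s := Real.sq_sqrt hs0.le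
  field_simp
  rw [hs2]

lemma integrableOn_g7Real {j : ℕ} (hj : j < 3) : IntegrableOn (g7Real j) (Set.Ioi 0) := by
  have h1 := (integrableOn_g7Real_Ioo hj one_pos)
  have h2 := integrableOn_g7Real_Ioi j (one_pos)
  rw [← integrableOn_Ioc_iff_integrableOn_Ioo] at h1
  rw [← Set.Ioc_union_Ioi_eq_Ioi (zero_le_one' ℝ)]
  exact h1.union h2

lemma integrableOn_g7Real_div {j : ℕ} (hj : j < 3) {y : ℝ} (hy : 0 < y) :
    IntegrableOn (fun t => g7Real j t / Real.sqrt (t + y)) (Set.Ioi 0) := by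
  simp_rw [div_eq_inv_mul]
  refine Integrable.bdd_mul (c := (Real.sqrt y)⁻¹) (integrableOn_g7Real hj)
    (by fun_prop)
    ((ae_restrict_iff' measurableSet_Ioi).mpr (.of_forall fun t ht => ?_))
  have ht' : 0 < t := ht
  rw [Real.norm_of_nonneg (by positivity)]
  gcongr
  linarith

/-! ### Joining the tails at y and 1/y -/

lemma one_div_smul_g7Real (k : ℕ) {s y : ℝ} (hs0 : 0 < s) (hy : 0 < y) :
    |-(s ^ 2)⁻¹| • (g7Real k (1 / s) / Real.sqrt (1 / s + 1 / y)) =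
      Real.sqrt y * (g7Real k (1 / s) / (s * Real.sqrt s) / Real.sqrt (s + y)) := by
  have e : 1 / s + 1 / y = (s + y) / (s * y) := by field_simp; ring
  simp only [abs_neg, abs_inv, abs_pow, sq_abs, smul_eq_mul]
  rw [e, Real.sqrt_div (by positivity), Real.sqrt_mul hs0.le]
  have h1 : Real.sqrt s ≠ 0 := (Real.sqrt_pos.mpr hs0).ne'
  have h2 : Real.sqrt y ≠ 0 := (Real.sqrt_pos.mpr hy).ne'
  have h3 : Real.sqrt (s + y) ≠ 0 := (Real.sqrt_pos.mpr (by positivity)).ne'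
  have hs2 : Real.sqrt s ^ 2 = s := Real.sq_sqrt hs0.le
  field_simp
  rw [hs2, mul_comm]

lemma integral_g7Real_inv (k : ℕ) {y : ℝ} (hy : 0 < y) :
    ∫ t in Set.Ioi (1 / y), g7Real k t / Real.sqrt (t + 1 / y) =
      ∫ s in Set.Ioo 0 y, Real.sqrt y * (g7Real k (1 / s) / (s * Real.sqrt s)
        / Real.sqrt (s + y)) := by
  rw [← image_one_div_Ioo hy, integral_image_eq_integral_abs_deriv_smul measurableSet_Ioo
    hasDerivWithinAt_one_div (injOn_one_div y)]
  exact setIntegral_congr_fun measurableSet_Ioo fun s hs => one_div_smul_g7Real k hs.1 hy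

/-- Under t = 1/s the inversion of g₇ converts the tails at 1/y into the part over (0, y) that the
tail at y lacks. -/
lemma sum_integral_g7Real_inv {j : ℕ} (hj : j < 3) {y : ℝ} (hy : 0 < y) :
    ∑ k ∈ Finset.range 3, sinEntry j k *
      ∫ t in Set.Ioi (1 / y), g7Real k t / Real.sqrt (t + 1 / y) =
      -(Real.sqrt 7 / 2 * Real.sqrt y) *
        ∫ s in Set.Ioo 0 y, g7Real j s / Real.sqrt (s + y) := by
  have hint : ∀ k ∈ Finset.range 3, IntegrableOn (fun s => sinEntry j k *
      (Real.sqrt y * (g7Real k (1 / s) / (s * Real.sqrt s) / Real.sqrt (s + y))))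
      (Set.Ioo 0 y) := by
    intro k hk
    have h := (integrableOn_g7Real_div (Finset.mem_range.mp hk) (one_div_pos.mpr hy)).mono_set
      (Set.Ioi_subset_Ioi (one_div_pos.mpr hy).le)
    rw [← image_one_div_Ioo hy, integrableOn_image_iff_integrableOn_abs_deriv_smul
      measurableSet_Ioo hasDerivWithinAt_one_div (injOn_one_div y)] at h
    exact (h.congr_fun (fun s hs => one_div_smul_g7Real k hs.1 hy) measurableSet_Ioo).const_mul _
  simp_rw [integral_g7Real_inv _ hy, ← integral_const_mul]
  rw [← integral_finsetSum _ hint]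
  refine setIntegral_congr_fun measurableSet_Ioo fun s hs => ?_
  have hs0 : 0 < s := hs.1
  rw [g7Real_inv hj hs0]
  have e : ∑ k ∈ Finset.range 3, sinEntry j k *
      (Real.sqrt y * (g7Real k (1 / s) / (s * Real.sqrt s) / Real.sqrt (s + y))) =
      Real.sqrt y / (s * Real.sqrt s) / Real.sqrt (s + y) *
        ∑ k ∈ Finset.range 3, sinEntry j k * g7Real k (1 / s) := by
    rw [Finset.mul_sum]; exact Finset.sum_congr rfl fun k _ => by ring
  rw [e]
  have h1 : Real.sqrt s ≠ 0 := (Real.sqrt_pos.mpr hs0).ne'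
  have h3 : Real.sqrt (s + y) ≠ 0 := (Real.sqrt_pos.mpr (by positivity)).ne'
  have h7 : Real.sqrt 7 ≠ 0 := by positivity
  field_simp

lemma indefTheta_eq {j : ℕ} (hj : j < 3) {y : ℝ} (hy : 0 < y) :
    indefTheta j y = completedTheta j y - Real.sqrt 21 * etaTheta 1 y *
      ∫ t in Set.Ioi y, g7Real j t / Real.sqrt (t + y) := by
  have h21 : Real.sqrt 21 = 3 * (Real.sqrt 2 * (Real.sqrt 7 / Real.sqrt 6)) := by
    rw [← Real.sqrt_div (by norm_num), ← Real.sqrt_mul (by norm_num),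
      show (21 : ℝ) = 3 ^ 2 * (2 * (7 / 6)) by norm_num, Real.sqrt_mul (by norm_num),
      Real.sqrt_sq (by norm_num)]
  have e : ∫ t in Set.Ioi y, edgeTheta j t y / Real.sqrt (t + y) =
      -(3 * (Real.sqrt 7 / Real.sqrt 6)) * etaTheta 1 y *
        ∫ t in Set.Ioi y, g7Real j t / Real.sqrt (t + y) := by
    rw [← integral_const_mul]
    refine setIntegral_congr_fun measurableSet_Ioi fun t ht => ?_
    have ht0 : 0 < t := hy.trans ht
    rw [edgeTheta_eq_mul hj ht0 hy]
    ring
  rw [indefTheta, (hasSum_indefTheta j hy).tsum_eq, e, h21]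
  ring

/-- The completed parts cancel by `completedTheta_inv`, so only the two tails remain, and they join
at t = y. -/
theorem indefTheta_sub_inv {j : ℕ} (hj : j < 3) {y : ℝ} (hy : 0 < y) :
    indefTheta j y - 2 / (Real.sqrt 7 * y) *
      ∑ k ∈ Finset.range 3, sinEntry j k * indefTheta k (1 / y) =
    -(Real.sqrt 21 * etaTheta 1 y) *
      ∫ t in Set.Ioi 0, g7Real j t / Real.sqrt (t + y) := by
  have hy' : 0 < 1 / y := one_div_pos.mpr hy
  have hsplit : ∫ t in Set.Ioi 0, g7Real j t / Real.sqrt (t + y) =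
      (∫ t in Set.Ioo 0 y, g7Real j t / Real.sqrt (t + y)) +
      ∫ t in Set.Ioi y, g7Real j t / Real.sqrt (t + y) := by
    have hI := integrableOn_g7Real_div hj hy
    rw [← Set.Ioc_union_Ioi_eq_Ioi hy.le, setIntegral_union
      (Set.Ioc_disjoint_Ioi le_rfl) measurableSet_Ioi
      (hI.mono_set Set.Ioc_subset_Ioi_self) (hI.mono_set (Set.Ioi_subset_Ioi hy.le)),
      integral_Ioc_eq_integral_Ioo]
  have hsum : ∑ k ∈ Finset.range 3, sinEntry j k * indefTheta k (1 / y) =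
      (∑ k ∈ Finset.range 3, sinEntry j k * completedTheta k (1 / y)) -
      Real.sqrt 21 * (Real.sqrt y * etaTheta 1 y) * ∑ k ∈ Finset.range 3, sinEntry j k *
        ∫ t in Set.Ioi (1 / y), g7Real k t / Real.sqrt (t + 1 / y) := by
    rw [Finset.mul_sum, ← Finset.sum_sub_distrib]
    refine Finset.sum_congr rfl fun k hk => ?_
    rw [indefTheta_eq (Finset.mem_range.mp hk) hy', etaTheta_one_inv hy]
    ring
  have hC := completedTheta_inv j hy
  have hC' : ∑ k ∈ Finset.range 3, Real.sin (Real.pi * (2 * (j : ℤ) + 1) * (2 * k + 1) / 7) *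
        completedTheta k (1 / y) =
      ∑ k ∈ Finset.range 3, sinEntry j k * completedTheta k (1 / y) := by
    simp only [sinEntry, Int.cast_natCast]
  rw [hC'] at hC
  rw [hsum, sum_integral_g7Real_inv hj hy, indefTheta_eq hj hy, hC, hsplit]
  have h2 : Real.sqrt y ^ 2 = y := Real.sq_sqrt hy.le
  have h7 : Real.sqrt 7 ≠ 0 := by positivity
  field_simp
  rw [h2]
  ring

/-! ### g₇ on the imaginary axis, translation, and the period integrand -/

lemma unaryTheta_imag (m : ℤ) (t : ℝ) : unaryTheta (m / 42) (1 / 2) (21 * (I * t)) =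
    cexp (Real.pi * I * m / 42) * (unaryReal m t : ℂ) := by
  rw [unaryTheta, unaryReal, ofReal_tsum, ← tsum_mul_left]
  refine tsum_congr fun n => ?_
  have e : (Real.pi * I * (((m / 42 + n : ℝ)) : ℂ) ^ 2 * (21 * (I * t)) +
      2 * Real.pi * I * ((m / 42 + n : ℝ) : ℂ) * ((1 / 2 : ℝ) : ℂ)) =
      Real.pi * I * m / 42 + Real.pi * I * n +
        ((-(21 * Real.pi * t) * (n + m / 42) ^ 2 : ℝ) : ℂ) := by
    push_cast
    linear_combination (Real.pi * 21 * t * ((m : ℂ) / 42 + n) ^ 2) * I_sq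
  rw [e, Complex.exp_add, Complex.exp_add, cexp_pi_mul_I_int, ← ofReal_exp]
  push_cast
  ring

lemma zeta_zpow (n : ℕ) (k : ℤ) : zeta n ^ k = cexp (2 * Real.pi * I * k / n) := by
  rw [zeta, ← Complex.exp_int_mul]; congr 1; ring

/-- The root of unity cancels the phase e^{πim/42} coming from b = 1/2. Among the six terms of g₇
only m = 41 has odd d, hence the minus sign in `g7Real`. -/
lemma zeta_mul_unaryTheta (k m d : ℤ) (h : k + m = 42 * d) (t : ℝ) :
    zeta 84 ^ k * unaryTheta (m / 42) (1 / 2) (21 * (I * t)) =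
      ((-1 : ℝ) ^ d : ℝ) * (unaryReal m t : ℂ) := by
  rw [unaryTheta_imag, zeta_zpow, ← mul_assoc, ← Complex.exp_add, ← cexp_pi_mul_I_int]
  congr 2
  have h' : (k : ℂ) + m = 42 * d := by exact_mod_cast h
  push_cast
  linear_combination (Real.pi * I / 42) * h'

lemma g7_imag (t : ℝ) (j : Fin 3) : g7 (I * t) j = (g7Real j t : ℂ) := by
  have H := fun k m d h => zeta_mul_unaryTheta k m d h t
  fin_cases j
  · have h1 := H (-13) 13 0 (by norm_num)
    have h2 := H 1 41 1 (by norm_num)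
    rw [zpow_one] at h2
    norm_num at h1 h2
    rw [one_div] at h1 h2
    simp [g7, g7Real, h1, h2, sub_eq_add_neg]
  · have h1 := H 73 11 2 (by norm_num)
    have h2 := H 59 25 2 (by norm_num)
    norm_num at h1 h2
    norm_cast at h1 h2
    rw [one_div] at h1 h2
    simp [g7, g7Real, h1, h2]
  · have h1 := H 61 23 2 (by norm_num)
    have h2 := H 47 37 2 (by norm_num)
    norm_num at h1 h2
    norm_cast at h1 h2
    rw [one_div] at h1 h2
    simp [g7, g7Real, h1, h2]

lemma qpow_add_one (s : ℝ) (τ : ℂ) :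
    qpow s (τ + 1) = cexp (2 * Real.pi * I * s) * qpow s τ := by
  rw [qpow, qpow, ← Complex.exp_add]; congr 1; ring

lemma qpow_one_add_one (τ : ℂ) : qpow 1 (τ + 1) = qpow 1 τ := by
  rw [qpow_add_one, ofReal_one, mul_one, Complex.exp_two_pi_mul_I, one_mul]

/-- The transformation of `F7` under translation. -/
theorem F7_add_one (τ : ℂ) : F7 (τ + 1) = T7.mulVec (F7 τ) := by
  have hq : ∀ s : ℤ, ∀ x : ℝ, x = s / 168 →
      qpow x (τ + 1) = zeta 168 ^ s * qpow x τ := by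
    rintro s x rfl
    rw [qpow_add_one, zeta_zpow]; congr 2; push_cast; ring
  ext j
  rw [T7, Matrix.mulVec_diagonal]
  fin_cases j
  · simp only [F7, qpow_one_add_one]
    simp [hq (-1) (-1 / 168) (by norm_num), mul_assoc]
  · simp only [F7, qpow_one_add_one]
    simp [hq 47 (47 / 168) (by norm_num), mul_assoc]
  · simp only [F7, qpow_one_add_one]
    simp [hq (-25) (-25 / 168) (by norm_num), mul_assoc]

lemma csqrt_ofReal {x : ℝ} (hx : 0 ≤ x) : csqrt x = (√x : ℝ) := by
  rw [csqrt, Real.sqrt_eq_rpow, ofReal_cpow hx]; norm_num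

lemma norm_csqrt (w : ℂ) : ‖csqrt w‖ = √‖w‖ := by
  rcases eq_or_ne w 0 with rfl | hw
  · simp [csqrt]
  · rw [csqrt, Complex.norm_cpow_of_ne_zero hw, Real.sqrt_eq_rpow]; simp

lemma shifted_arg (τ : ℂ) (t : ℝ) : -I * (I * t + τ) = (t : ℂ) + -I * τ := by
  linear_combination (-(t : ℂ)) * I_sq

lemma re_shifted_arg (τ : ℂ) (t : ℝ) : ((t : ℂ) + -I * τ).re = t + τ.im := by simp

lemma norm_inv_csqrt_le {τ : ℂ} (hτ : 0 < τ.im) {t : ℝ} (ht : 0 ≤ t) :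
    ‖(csqrt (t + -I * τ))⁻¹‖ ≤ (√τ.im)⁻¹ := by
  rw [norm_inv, norm_csqrt]
  have h := Complex.re_le_norm ((t : ℂ) + -I * τ)
  rw [re_shifted_arg] at h
  exact inv_anti₀ (Real.sqrt_pos.mpr hτ) (Real.sqrt_le_sqrt (by linarith))

lemma add_mem_slitPlane {τ : ℂ} (hτ : 0 < τ.im) {t : ℝ} (ht : 0 ≤ t) :
    (t : ℂ) + -I * τ ∈ slitPlane := Or.inl (by rw [re_shifted_arg]; linarith)

lemma periodIntegrand_eq (τ : ℂ) (j : Fin 3) (t : ℝ) :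
    periodIntegrand τ j t = (csqrt (t + -I * τ))⁻¹ * ((g7Real j t : ℂ) * I) := by
  rw [periodIntegrand, g7_imag, shifted_arg]; ring

lemma aestronglyMeasurable_inv_csqrt {τ : ℂ} (hτ : 0 < τ.im) : AEStronglyMeasurable
    (fun t : ℝ => (csqrt (t + -I * τ))⁻¹) (volume.restrict (Set.Ioi 0)) := by
  refine ContinuousOn.aestronglyMeasurable (fun t ht => ?_) measurableSet_Ioi
  have hs := add_mem_slitPlane hτ (le_of_lt ht)
  refine ContinuousAt.continuousWithinAt (ContinuousAt.inv₀ ?_ ?_)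
  · unfold csqrt
    exact ContinuousAt.cpow (by fun_prop) continuousAt_const hs
  · rw [csqrt, Ne, cpow_eq_zero_iff]
    exact fun h => slitPlane_ne_zero hs h.1

lemma integrableOn_ofReal_g7Real (j : Fin 3) :
    IntegrableOn (fun t => (g7Real j t : ℂ) * I) (Set.Ioi 0) :=
  (Integrable.ofReal (integrableOn_g7Real j.isLt)).mul_const I

lemma integrableOn_periodIntegrand {τ : ℂ} (hτ : 0 < τ.im) (j : Fin 3) :
    IntegrableOn (periodIntegrand τ j) (Set.Ioi 0) := by
  simp_rw [funext (periodIntegrand_eq τ j)]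
  refine Integrable.bdd_mul (c := (√τ.im)⁻¹) (integrableOn_ofReal_g7Real j)
    (aestronglyMeasurable_inv_csqrt hτ) ?_
  filter_upwards [ae_restrict_mem measurableSet_Ioi] with t ht
  exact norm_inv_csqrt_le hτ (le_of_lt ht)

/-! ### The identity on the imaginary axis -/

/-- The exponent of the general term of `heckeSum`. -/
def heckeExp (l r s : ℤ) : ℤ := (3 * r ^ 2 + 8 * r * s + 3 * s ^ 2 + l * r + l * s) / 2

lemma two_mul_heckeExp (j r s : ℤ) : 2 * heckeExp (2 * j + 1) r s =
    3 * r ^ 2 + 8 * r * s + 3 * s ^ 2 + (2 * j + 1) * r + (2 * j + 1) * s := by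
  refine Int.mul_ediv_cancel' ?_
  have h1 : (2 : ℤ) ∣ r * (r + 1) := (Int.even_mul_succ_self r).two_dvd
  have h2 : (2 : ℤ) ∣ s * (s + 1) := (Int.even_mul_succ_self s).two_dvd
  obtain ⟨a, ha⟩ := h1
  obtain ⟨b, hb⟩ := h2
  exact ⟨a + b + r ^ 2 + 4 * r * s + s ^ 2 + j * r + j * s, by
    linear_combination ha + hb⟩

lemma quadForm_eq (j r s : ℤ) : quadForm (r + shift j) (s + shift j) =
    heckeExp (2 * j + 1) r s + (2 * j + 1) ^ 2 / 28 := by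
  have h : (2 : ℝ) * heckeExp (2 * j + 1) r s =
    3 * r ^ 2 + 8 * r * s + 3 * s ^ 2 + (2 * j + 1) * r + (2 * j + 1) * s := by
    exact_mod_cast two_mul_heckeExp j r s
  simp only [quadForm, shift]
  linear_combination (-1 / 2 : ℝ) * h

/-- Here 0 < `shift j` < 1, so r = 0 counts as positive, as in the summation ranges of `heckeSum`.
-/
lemma sign_int_add_shift {j : ℤ} (h0 : 0 ≤ j) (h3 : j < 3) (r : ℤ) :
    Real.sign (r + shift j) = if 0 ≤ r then 1 else -1 := by
  have hj0 : (0 : ℝ) ≤ j := by exact_mod_cast h0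
  have hj3 : (j : ℝ) ≤ 2 := by exact_mod_cast (by omega : j ≤ 2)
  split_ifs with h
  · have : (0 : ℝ) ≤ r := by exact_mod_cast h
    exact Real.sign_of_pos (by rw [shift]; linarith)
  · have : (r : ℝ) ≤ -1 := by exact_mod_cast (by omega : r ≤ -1)
    exact Real.sign_of_neg (by rw [shift]; linarith)

lemma qpow_imag (s y : ℝ) : qpow s (I * y) = (Real.exp (-(2 * Real.pi * y) * s) : ℝ) := by
  rw [qpow, ofReal_exp]; congr 1; push_cast; linear_combination (2 * Real.pi * s * y) * I_sq

lemma qpow_add (s t : ℝ) (τ : ℂ) : qpow (s + t) τ = qpow s τ * qpow t τ := by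
  rw [qpow, qpow, qpow, ← Complex.exp_add]; congr 1; push_cast; ring

lemma qpow_int_mul (s : ℝ) (n : ℤ) (τ : ℂ) : qpow (s * n) τ = qpow s τ ^ n := by
  rw [qpow, qpow, ← Complex.exp_int_mul]; congr 1; push_cast; ring

/-- The half-sum of signs is 1 on r, s ≥ 0, −1 on r, s < 0 and 0 elsewhere. -/
lemma ofReal_indefTheta {j : ℤ} (h0 : 0 ≤ j) (h3 : j < 3) {y : ℝ} (hy : 0 < y) :
    (indefTheta j y : ℂ) =
      qpow ((2 * j + 1) ^ 2 / 28) (I * y) * heckeSum (2 * j + 1) (qpow 1 (I * y)) := by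
  set c := qpow ((2 * j + 1) ^ 2 / 28) (I * y) with hc
  set f : ℤ × ℤ → ℂ := fun n => ((latticeSign n *
    ((Real.sign (n.1 + shift j) + Real.sign (n.2 + shift j)) / 2 *
      Real.exp (-(2 * Real.pi * y * quadForm (n.1 + shift j) (n.2 + shift j)))) : ℝ) : ℂ) with hf
  set S : Set (ℤ × ℤ) := {p | 0 ≤ p.1 ∧ 0 ≤ p.2} with hS
  set T : Set (ℤ × ℤ) := {p | p.1 < 0 ∧ p.2 < 0} with hT
  have hsum : HasSum f (indefTheta j y) := 
    Complex.hasSum_ofReal.mpr (hasSum_indefTheta j hy).summable.hasSum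
  have hterm : ∀ n : ℤ × ℤ, f n =
      ((if 0 ≤ n.1 then (1 : ℂ) else -1) + (if 0 ≤ n.2 then (1 : ℂ) else -1)) / 2 *
        (c * heckeTerm (2 * j + 1) (qpow 1 (I * y)) n.1 n.2) := by
    intro n
    have e1 : ((Real.exp (-(2 * Real.pi * y * quadForm (n.1 + shift j) (n.2 + shift j))) : ℝ) : ℂ)
        = c * qpow 1 (I * y) ^ heckeExp (2 * j + 1) n.1 n.2 := by
      rw [hc, ← qpow_int_mul, ← qpow_add, qpow_imag, quadForm_eq]
      congr 2; ring
    rw [hf]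
    simp only [sign_int_add_shift h0 h3]
    have hite : ∀ k : ℤ, (((if 0 ≤ k then 1 else -1 : ℝ)) : ℂ) = if 0 ≤ k then 1 else -1 := by
      intro k; split_ifs <;> simp
    rw [ofReal_mul, ofReal_mul, e1, heckeTerm, heckeExp, latticeSign, ofReal_div, ofReal_add,
      hite, hite]
    push_cast
    ring
  have hsplit : f = fun n => S.indicator f n + T.indicator f n := by
    funext n
    by_cases a : 0 ≤ n.1 <;> by_cases b : 0 ≤ n.2
    · rw [Set.indicator_of_mem (show n ∈ S from ⟨a, b⟩),
        Set.indicator_of_notMem (show n ∉ T from fun h => by have := h.1; omega), add_zero]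
    · rw [Set.indicator_of_notMem (show n ∉ S from fun h => b h.2),
        Set.indicator_of_notMem (show n ∉ T from fun h => by have := h.1; omega), hterm]
      simp [a, b]
    · rw [Set.indicator_of_notMem (show n ∉ S from fun h => a h.1),
        Set.indicator_of_notMem (show n ∉ T from fun h => by have := h.2; omega), hterm]
      simp [a, b]
    · rw [Set.indicator_of_notMem (show n ∉ S from fun h => a h.1),
        Set.indicator_of_mem (show n ∈ T from ⟨by omega, by omega⟩), zero_add]
  rw [← hsum.tsum_eq, hsplit, (hsum.summable.indicator S).tsum_add (hsum.summable.indicator T),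
    ← tsum_subtype, ← tsum_subtype, heckeSum, mul_sub, ← tsum_mul_left, ← tsum_mul_left,
    sub_eq_add_neg, ← tsum_neg]
  congr 1
  · refine tsum_congr fun p => ?_
    have hp := p.2
    rw [hterm, if_pos hp.1, if_pos hp.2]; ring
  · refine tsum_congr fun p => ?_
    have hp := p.2
    rw [hterm, if_neg (not_le.mpr hp.1), if_neg (not_le.mpr hp.2)]; ring

lemma F7_imag (j : Fin 3) {y : ℝ} (hy : 0 < y) :
    F7 (I * y) j = (indefTheta j y : ℂ) / etaTheta 1 y := by
  have hE := ofReal_etaTheta_one hy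
  have hE0 : qInf (qpow 1 (I * y)) ≠ 0 := fun h => by
    rw [h, mul_zero, ofReal_eq_zero] at hE
    exact etaTheta_one_ne_zero hy hE
  have hq0 : qpow (1 / 24) (I * y) ≠ 0 := Complex.exp_ne_zero _
  have H : ∀ s : ℝ, ∀ h : ℂ, qpow (s + 1 / 24) (I * y) * h / etaTheta 1 y =
      qpow s (I * y) * (h / qInf (qpow 1 (I * y))) := by
    intro s h
    rw [hE, qpow_add]; field_simp
  fin_cases j
  · have h := ofReal_indefTheta (j := 0) le_rfl (by norm_num) hy
    rw [show ((2 * (0 : ℤ) + 1) ^ 2 / 28 : ℝ) = -1 / 168 + 1 / 24 by norm_num] at h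
    exact ((congrArg (· / (etaTheta 1 y : ℂ)) h).trans (H _ _)).symm
  · have h := ofReal_indefTheta (j := 1) (by norm_num) (by norm_num) hy
    rw [show ((2 * (1 : ℤ) + 1) ^ 2 / 28 : ℝ) = 47 / 168 + 1 / 24 by norm_num] at h
    exact ((congrArg (· / (etaTheta 1 y : ℂ)) h).trans (H _ _)).symm
  · have h := ofReal_indefTheta (j := 2) (by norm_num) (by norm_num) hy
    -- The summand 1 is the extra factor q in `mockF1`; 1/24 belongs to η.
    rw [show ((2 * (2 : ℤ) + 1) ^ 2 / 28 : ℝ) = (-25 / 168 + 1) + 1 / 24 by norm_num] at h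
    refine ((congrArg (· / (etaTheta 1 y : ℂ)) h).trans ((H _ _).trans ?_)).symm
    rw [qpow_add, mul_assoc, ← mul_div_assoc]
    rfl

lemma M7_apply (j k : Fin 3) : M7 j k = ((2 / √7 * sinEntry j k : ℝ) : ℂ) := by
  have hs : ∀ x y : ℝ, y = Real.pi - x → Real.sin y = Real.sin x := by
    rintro x _ rfl; exact Real.sin_pi_sub x
  have h5 : Real.sin (5 * Real.pi / 7) = Real.sin (2 * Real.pi / 7) := hs _ _ (by ring)
  have h9 : Real.sin (9 * Real.pi / 7) = -Real.sin (2 * Real.pi / 7) := by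
    rw [← Real.sin_add_pi]; congr 1; ring
  have h15 : Real.sin (15 * Real.pi / 7) = Real.sin (Real.pi / 7) := by
    rw [← Real.sin_add_two_pi (Real.pi / 7)]; congr 1; ring
  have h25 : Real.sin (25 * Real.pi / 7) = -Real.sin (3 * Real.pi / 7) := by
    rw [show 25 * Real.pi / 7 = -(3 * Real.pi / 7) + 2 * Real.pi + 2 * Real.pi by ring,
      Real.sin_add_two_pi, Real.sin_add_two_pi, Real.sin_neg]
  have e : sinEntry j k = Real.sin ((2 * (j : ℕ) + 1) * (2 * (k : ℕ) + 1) * Real.pi / 7) := by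
    rw [sinEntry]; congr 1; ring
  rw [M7, Matrix.smul_apply, Matrix.map_apply, smul_eq_mul, ofReal_mul]
  congr 2
  rw [e]
  clear e
  fin_cases j <;> fin_cases k <;> norm_num [h5, h9, h15, h25]

lemma sqrt_add_imag {y t : ℝ} (h : 0 ≤ t + y) : csqrt (t + -I * (I * y)) = (√(t + y) : ℝ) := by
  rw [← csqrt_ofReal h]; congr 1; push_cast; linear_combination (-(y : ℂ)) * I_sq

lemma periodIntegral_imag (j : Fin 3) {y : ℝ} (hy : 0 < y) : periodIntegral (I * y) j =
    I * ((∫ t in Set.Ioi 0, g7Real j t / √(t + y) : ℝ) : ℂ) := by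
  rw [periodIntegral, ← integral_complex_ofReal, ← integral_const_mul]
  refine setIntegral_congr_fun measurableSet_Ioi fun t ht => ?_
  have ht : 0 < t := ht
  simp only [periodIntegrand_eq]
  rw [sqrt_add_imag (by positivity)]
  push_cast
  ring

/-- Dividing `indefTheta_sub_inv` by η(iy), with η(i/y) = √y η(iy), lowers the weight from 1 to 1/2.
The sign is i·i = −1, one factor from dz = i dt. -/
theorem F7_sub_inv_imag (j : Fin 3) {y : ℝ} (hy : 0 < y) :
    F7 (I * y) j - 1 / csqrt (-I * (I * y)) * (M7.mulVec (F7 (-1 / (I * y)))) j =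
      I * (√21 : ℂ) * periodIntegral (I * y) j := by
  have hyc : (y : ℂ) ≠ 0 := by exact_mod_cast hy.ne'
  have e1 : -I * (I * y) = (y : ℂ) := by linear_combination (-(y : ℂ)) * I_sq
  have e2 : -1 / (I * y) = I * ((1 / y : ℝ) : ℂ) := by
    push_cast; field_simp; rw [I_sq]
  have hE := etaTheta_one_ne_zero hy
  have hs : √y * √y = y := Real.mul_self_sqrt hy.le
  have hs0 : √y ≠ 0 := (Real.sqrt_pos.mpr hy).ne'
  have hmv : (M7.mulVec (F7 (-1 / (I * y)))) j = ((2 / √7 *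
      (∑ k ∈ Finset.range 3, sinEntry j k * indefTheta k (1 / y)) /
        (√y * etaTheta 1 y) : ℝ) : ℂ) := by
    rw [Matrix.mulVec, dotProduct, e2, ← etaTheta_one_inv hy, Finset.sum_range, mul_div_assoc,
      Finset.sum_div, Finset.mul_sum, ofReal_sum]
    refine Finset.sum_congr rfl fun k _ => ?_
    rw [M7_apply, F7_imag k (by positivity)]
    push_cast
    ring
  have main := indefTheta_sub_inv j.isLt hy
  rw [hmv, F7_imag j hy, periodIntegral_imag j hy, e1, csqrt_ofReal hy.le]
  have key : indefTheta j y / etaTheta 1 y - 1 / √y * (2 / √7 *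
      (∑ k ∈ Finset.range 3, sinEntry j k * indefTheta k (1 / y)) / (√y * etaTheta 1 y)) =
      -(√21 * ∫ t in Set.Ioi 0, g7Real j t / √(t + y)) := by
    have : ∀ S : ℝ, 1 / √y * (2 / √7 * S / (√y * etaTheta 1 y)) =
        2 / (√7 * y) * S / etaTheta 1 y := by
      intro S
      have h7 : √7 ≠ 0 := by positivity
      field_simp
      rw [sq, hs, mul_comm]
    rw [this, ← sub_div, main]
    field_simp
  have key' := congrArg Complex.ofReal key
  push_cast at key' ⊢
  rw [key']
  linear_combination (-(√21 : ℂ) * (∫ t in Set.Ioi 0, g7Real j t / √(t + y) : ℝ)) * I_sq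

/-! ### Holomorphy and extension to the half plane -/

lemma isOpen_im_pos : IsOpen {τ : ℂ | 0 < τ.im} := isOpen_lt continuous_const continuous_im

lemma norm_qpow_one_lt {τ : ℂ} (hτ : 0 < τ.im) : ‖qpow 1 τ‖ < 1 := by
  rw [qpow, Complex.norm_exp, Real.exp_lt_one_iff]
  have : (2 * Real.pi * I * (1 : ℝ) * τ).re = -(2 * Real.pi * τ.im) := by simp
  rw [this]
  have := Real.pi_pos
  exact neg_neg_of_pos (by positivity)

lemma differentiable_qpow (s : ℝ) : Differentiable ℂ (qpow s) := by
  unfold qpow; fun_prop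

lemma qInf_qpow_ne_zero {τ : ℂ} (hτ : 0 < τ.im) : qInf (qpow 1 τ) ≠ 0 := by
  have h := ModularForm.eta_tprod_ne_zero
    (show τ ∈ UpperHalfPlane.upperHalfPlaneSet from hτ)
  convert h using 1
  refine tprod_congr fun n => ?_
  rw [ModularForm.eta_q, Function.Periodic.qParam, qpow]
  congr 3; push_cast; ring

lemma summable_pow_natAbs {x : ℝ} (h0 : 0 ≤ x) (h1 : x < 1) :
    Summable fun n : ℤ => x ^ n.natAbs := by
  refine Summable.of_nat_of_neg ?_ ?_ <;> simpa using summable_geometric_of_lt_one h0 h1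

lemma summable_pow_natAbs_add {x : ℝ} (h0 : 0 ≤ x) (h1 : x < 1) :
    Summable fun n : ℤ × ℤ => x ^ (n.1.natAbs + n.2.natAbs) := by
  simp_rw [pow_add]
  exact (summable_pow_natAbs h0 h1).mul_of_nonneg (summable_pow_natAbs h0 h1)
    (fun _ => pow_nonneg h0 _) (fun _ => pow_nonneg h0 _)

/-- This gives natural-number exponents and a geometric majorant for `heckeSum`, locally uniform in
|q| < 1. -/
lemma natAbs_add_le_heckeExp {j : ℤ} (h0 : 0 ≤ j) (h3 : j < 3) {r s : ℤ}
    (h : 0 ≤ r ∧ 0 ≤ s ∨ r < 0 ∧ s < 0) :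
    ((r.natAbs + s.natAbs : ℕ) : ℤ) ≤ heckeExp (2 * j + 1) r s := by
  have h2 := two_mul_heckeExp j r s
  rcases h with ⟨hr, hs⟩ | ⟨hr, hs⟩
  · have e : ((r.natAbs + s.natAbs : ℕ) : ℤ) = r + s := by omega
    have a1 : r ≤ r ^ 2 := by nlinarith [Int.le_self_sq r]
    have a2 : s ≤ s ^ 2 := by nlinarith [Int.le_self_sq s]
    have := mul_nonneg hr hs
    have := mul_nonneg h0 hr
    have := mul_nonneg h0 hs
    rw [e]; linarith
  · have e : ((r.natAbs + s.natAbs : ℕ) : ℤ) = -r - s := by omega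
    -- Measured from the corner (−1, −1) all contributions are nonnegative, because j ≤ 2.
    obtain ⟨a, rfl⟩ : ∃ a, r = -1 - a := ⟨-1 - r, by ring⟩
    obtain ⟨b, rfl⟩ : ∃ b, s = -1 - b := ⟨-1 - s, by ring⟩
    have ha : 0 ≤ a := by omega
    have hb : 0 ≤ b := by omega
    have := mul_nonneg ha hb
    have := mul_nonneg (show 0 ≤ 2 - j by omega) ha
    have := mul_nonneg (show 0 ≤ 2 - j by omega) hb
    have := sq_nonneg a
    have := sq_nonneg b
    rw [e]; linarith

lemma norm_heckeTerm_le {j : ℤ} (h0 : 0 ≤ j) (h3 : j < 3) {r s : ℤ}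
    (h : 0 ≤ r ∧ 0 ≤ s ∨ r < 0 ∧ s < 0) {x : ℝ} (hx : x < 1) {q : ℂ} (hq : ‖q‖ ≤ x) :
    ‖heckeTerm (2 * j + 1) q r s‖ ≤ x ^ (r.natAbs + s.natAbs) := by
  obtain ⟨n, hn⟩ := Int.le.dest (natAbs_add_le_heckeExp h0 h3 h)
  have hx0 := (norm_nonneg q).trans hq
  rw [heckeTerm, show (3 * r ^ 2 + 8 * r * s + 3 * s ^ 2 + (2 * j + 1) * r + (2 * j + 1) * s) / 2 =
    heckeExp (2 * j + 1) r s from rfl, ← hn, ← Nat.cast_add, zpow_natCast, norm_mul, norm_zpow,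
    norm_neg, norm_one, one_zpow, one_mul, norm_pow]
  exact (pow_le_pow_left₀ (norm_nonneg q) hq _).trans
    (pow_le_pow_of_le_one hx0 hx.le (Nat.le_add_right _ _))

lemma differentiable_heckeTerm {j : ℤ} (h0 : 0 ≤ j) (h3 : j < 3) {r s : ℤ}
    (h : 0 ≤ r ∧ 0 ≤ s ∨ r < 0 ∧ s < 0) :
    Differentiable ℂ fun q => heckeTerm (2 * j + 1) q r s := by
  obtain ⟨n, hn⟩ := Int.le.dest (natAbs_add_le_heckeExp h0 h3 h)
  have e : (fun q : ℂ => heckeTerm (2 * j + 1) q r s) =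
      fun q : ℂ => (-1 : ℂ) ^ (r + s) * q ^ (r.natAbs + s.natAbs + n) := by
    funext q
    rw [heckeTerm, show (3 * r ^ 2 + 8 * r * s + 3 * s ^ 2 + (2 * j + 1) * r + (2 * j + 1) * s) / 2
      = heckeExp (2 * j + 1) r s from rfl, ← hn, ← Nat.cast_add, zpow_natCast]
  rw [e]
  fun_prop

lemma differentiableOn_heckeSum {j : ℤ} (h0 : 0 ≤ j) (h3 : j < 3) :
    DifferentiableOn ℂ (heckeSum (2 * j + 1)) (Metric.ball 0 1) := by
  intro q hq
  rw [mem_ball_zero_iff] at hq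
  obtain ⟨x, hqx, hx⟩ := exists_between hq
  have hx0 := (norm_nonneg q).trans hqx.le
  have hs := summable_pow_natAbs_add hx0 hx
  have hU : Metric.ball (0 : ℂ) x ∈ nhds q :=
    Metric.isOpen_ball.mem_nhds (mem_ball_zero_iff.mpr hqx)
  refine DifferentiableAt.differentiableWithinAt (DifferentiableAt.sub ?_ ?_)
  · exact (differentiableOn_tsum_of_summable_norm
      (u := fun p : {p : ℤ × ℤ // 0 ≤ p.1 ∧ 0 ≤ p.2} => x ^ (p.1.1.natAbs + p.1.2.natAbs))
      (hs.subtype _) (fun p => (differentiable_heckeTerm h0 h3 (Or.inl p.2)).differentiableOn)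
      Metric.isOpen_ball fun p w hw =>
        norm_heckeTerm_le h0 h3 (Or.inl p.2) hx (mem_ball_zero_iff.mp hw).le).differentiableAt hU
  · exact (differentiableOn_tsum_of_summable_norm
      (u := fun p : {p : ℤ × ℤ // p.1 < 0 ∧ p.2 < 0} => x ^ (p.1.1.natAbs + p.1.2.natAbs))
      (hs.subtype _) (fun p => (differentiable_heckeTerm h0 h3 (Or.inr p.2)).differentiableOn)
      Metric.isOpen_ball fun p w hw =>
        norm_heckeTerm_le h0 h3 (Or.inr p.2) hx (mem_ball_zero_iff.mp hw).le).differentiableAt hU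

lemma differentiableOn_F7 (j : Fin 3) :
    DifferentiableOn ℂ (fun τ => F7 τ j) {τ : ℂ | 0 < τ.im} := by
  have hq : DifferentiableOn ℂ (qpow 1) {τ : ℂ | 0 < τ.im} :=
    (differentiable_qpow 1).differentiableOn
  have hm : Set.MapsTo (qpow 1) {τ : ℂ | 0 < τ.im} (Metric.ball 0 1) :=
    fun τ hτ => mem_ball_zero_iff.mpr (norm_qpow_one_lt hτ)
  have hE : DifferentiableOn ℂ (fun τ => qInf (qpow 1 τ)) {τ : ℂ | 0 < τ.im} :=
    ModularForm.differentiableOn_tprod_one_sub_pow.comp hq hm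
  have hS : ∀ i : ℤ, 0 ≤ i → i < 3 →
      DifferentiableOn ℂ (fun τ => heckeSum (2 * i + 1) (qpow 1 τ)) {τ : ℂ | 0 < τ.im} :=
    fun i h0 h3 => (differentiableOn_heckeSum h0 h3).comp hq hm
  have hs : ∀ s, DifferentiableOn ℂ (qpow s) {τ : ℂ | 0 < τ.im} :=
    fun s => (differentiable_qpow s).differentiableOn
  have h0 : ∀ τ ∈ {τ : ℂ | 0 < τ.im}, qInf (qpow 1 τ) ≠ 0 := fun τ hτ => qInf_qpow_ne_zero hτ
  fin_cases j
  · exact (hs (-1 / 168)).mul ((hS 0 le_rfl (by norm_num)).div hE h0)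
  · exact (hs (47 / 168)).mul ((hS 1 (by norm_num) (by norm_num)).div hE h0)
  · exact (hs (-25 / 168)).mul ((hq.mul (hS 2 (by norm_num) (by norm_num))).div hE h0)

lemma im_neg_inv_pos {τ : ℂ} (hτ : 0 < τ.im) : 0 < (-1 / τ).im := by
  have h0 : τ ≠ 0 := by rintro rfl; simp at hτ
  have := Complex.normSq_pos.mpr h0
  rw [neg_div, one_div, neg_im, inv_im, neg_div, neg_neg]
  positivity

lemma neg_I_mul_mem_slitPlane {τ : ℂ} (hτ : 0 < τ.im) : -I * τ ∈ slitPlane := by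
  simpa using add_mem_slitPlane hτ le_rfl

lemma csqrt_ne_zero {w : ℂ} (hw : w ≠ 0) : csqrt w ≠ 0 := by
  rw [csqrt, Ne, cpow_eq_zero_iff]; exact fun h => hw h.1

lemma differentiableOn_F7_inv (j : Fin 3) : DifferentiableOn ℂ
    (fun τ => 1 / csqrt (-I * τ) * (M7.mulVec (F7 (-1 / τ))) j) {τ : ℂ | 0 < τ.im} := by
  refine DifferentiableOn.mul ?_ ?_
  · refine DifferentiableOn.div (differentiableOn_const _) ?_ fun τ hτ =>
      csqrt_ne_zero (slitPlane_ne_zero (neg_I_mul_mem_slitPlane hτ))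
    intro τ hτ
    unfold csqrt
    exact (DifferentiableAt.cpow (by fun_prop) (by fun_prop)
      (neg_I_mul_mem_slitPlane hτ)).differentiableWithinAt
  · unfold Matrix.mulVec dotProduct
    refine DifferentiableOn.fun_sum fun k _ => DifferentiableOn.const_mul ?_ _
    refine (differentiableOn_F7 k).comp (f := fun τ : ℂ => -1 / τ)
      (DifferentiableOn.div (differentiableOn_const _) differentiableOn_id ?_)
      fun τ hτ => im_neg_inv_pos hτ
    rintro τ hτ rfl
    simp at hτ

lemma hasDerivAt_inv_csqrt {τ : ℂ} (hτ : 0 < τ.im) {t : ℝ} (ht : 0 ≤ t) :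
    HasDerivAt (fun τ => (csqrt (t + -I * τ))⁻¹)
      ((I / 2) * ((csqrt (t + -I * τ))⁻¹ * (t + -I * τ)⁻¹)) τ := by
  have hs := add_mem_slitPlane hτ ht
  have h0 := slitPlane_ne_zero hs
  have hlin : HasDerivAt (fun τ : ℂ => (t : ℂ) + -I * τ) (-I) τ := by
    simpa using ((hasDerivAt_id τ).const_mul (-I)).const_add (t : ℂ)
  have h := (hlin.cpow_const (c := (1 / 2 : ℂ)) hs).inv (csqrt_ne_zero h0)
  refine h.congr_deriv ?_
  have hc := csqrt_ne_zero h0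
  rw [cpow_sub _ _ h0, cpow_one]
  change -(1 / 2 * (csqrt _ / _) * -I) / (csqrt _) ^ 2 = _
  field_simp

/-- Differentiation under the integral: on Im τ > δ the factor 1/√(−i(z + τ)) has a bounded
τ-derivative, and g₇ is integrable. -/
lemma differentiableOn_periodIntegral (j : Fin 3) :
    DifferentiableOn ℂ (fun τ => periodIntegral τ j) {τ : ℂ | 0 < τ.im} := by
  intro τ₀ hτ₀
  have hτ₀ : 0 < τ₀.im := hτ₀
  set δ := τ₀.im / 2 with hδ
  have hδ0 : 0 < δ := by positivity
  have hs : {τ : ℂ | δ < τ.im} ∈ nhds τ₀ :=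
    (isOpen_lt continuous_const continuous_im).mem_nhds (show δ < τ₀.im by linarith)
  have hG := integrableOn_ofReal_g7Real j
  have h := hasDerivAt_integral_of_dominated_loc_of_deriv_le (𝕜 := ℂ)
    (μ := volume.restrict (Set.Ioi 0)) (F := fun τ t => periodIntegrand τ j t)
    (F' := fun τ t => (I / 2) * ((csqrt (t + -I * τ))⁻¹ * (t + -I * τ)⁻¹) *
      ((g7Real j t : ℂ) * I))
    (bound := fun t => (1 / 2 * ((√δ)⁻¹ * δ⁻¹)) * ‖(g7Real j t : ℂ) * I‖) hs
    (by filter_upwards [hs] with τ hτ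
        exact (integrableOn_periodIntegrand (hδ0.trans hτ) j).aestronglyMeasurable)
    (integrableOn_periodIntegrand hτ₀ j) ?_ ?_ (hG.norm.const_mul _) ?_
  · exact h.2.differentiableAt.differentiableWithinAt
  · refine AEStronglyMeasurable.mul (AEStronglyMeasurable.const_mul
      ((aestronglyMeasurable_inv_csqrt hτ₀).mul ?_) _) hG.aestronglyMeasurable
    refine ContinuousOn.aestronglyMeasurable (fun t ht => ?_) measurableSet_Ioi
    exact ContinuousAt.continuousWithinAt (ContinuousAt.inv₀ (by fun_prop)
      (slitPlane_ne_zero (add_mem_slitPlane hτ₀ (le_of_lt ht))))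
  · filter_upwards [ae_restrict_mem measurableSet_Ioi] with t ht τ hτ
    have ht : 0 < t := ht
    have hτ : δ < τ.im := hτ
    rw [norm_mul, norm_mul, norm_mul, norm_inv ((t : ℂ) + _)]
    have h1 := (norm_inv_csqrt_le (hδ0.trans hτ) ht.le).trans
      (inv_anti₀ (Real.sqrt_pos.mpr hδ0) (Real.sqrt_le_sqrt hτ.le))
    have h2 : ‖(t : ℂ) + -I * τ‖⁻¹ ≤ δ⁻¹ := by
      refine inv_anti₀ hδ0 ?_
      have h := Complex.re_le_norm ((t : ℂ) + -I * τ)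
      rw [re_shifted_arg] at h
      linarith
    have h3 : ‖I / 2‖ = 1 / 2 := by simp
    rw [h3]
    gcongr
  · filter_upwards [ae_restrict_mem measurableSet_Ioi] with t ht τ hτ
    simp_rw [periodIntegrand_eq]
    exact (hasDerivAt_inv_csqrt (hδ0.trans hτ) (le_of_lt ht)).mul_const _

/-- Both sides are analytic on the connected half plane and agree on the imaginary axis, which
accumulates at i. -/
theorem F7_sub_inv {τ : ℂ} (hτ : 0 < τ.im) (j : Fin 3) :
    F7 τ j - 1 / csqrt (-I * τ) * (M7.mulVec (F7 (-1 / τ))) j =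
      I * (√21 : ℂ) * periodIntegral τ j := by
  have hf := ((differentiableOn_F7 j).sub (differentiableOn_F7_inv j)).analyticOnNhd isOpen_im_pos
  have hg := ((differentiableOn_periodIntegral j).const_mul (I * (√21 : ℂ))).analyticOnNhd
    isOpen_im_pos
  have hU : IsPreconnected {τ : ℂ | 0 < τ.im} := (convex_halfSpace_im_gt 0).isPreconnected
  refine hf.eqOn_of_preconnected_of_frequently_eq hg hU (z₀ := I) (by simp) ?_ hτ
  have hlim : Filter.Tendsto (fun y : ℝ => I * (y : ℂ)) (nhdsWithin 1 {1}ᶜ)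
      (nhdsWithin I {I}ᶜ) := by
    refine tendsto_nhdsWithin_iff.mpr ⟨?_, ?_⟩
    · have : Filter.Tendsto (fun y : ℝ => I * (y : ℂ)) (nhds 1) (nhds (I * ((1 : ℝ) : ℂ))) :=
        Continuous.tendsto (by fun_prop) _
      rw [ofReal_one, mul_one] at this
      exact this.mono_left nhdsWithin_le_nhds
    · filter_upwards [self_mem_nhdsWithin] with y hy h
      refine hy ?_
      have h' : I * (y : ℂ) = I * 1 := by rw [mul_one]; exact h
      exact_mod_cast mul_left_cancel₀ I_ne_zero h'
  refine hlim.frequently (Filter.Eventually.frequently ?_)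
  filter_upwards [nhdsWithin_le_nhds (lt_mem_nhds one_pos)] with y hy
  exact F7_sub_inv_imag j hy

end MockTheta7

end

theorem mainTheorem4 (τ : ℂ) (hτ : 0 < τ.im) :
    (∀ j, IntegrableOn (MockTheta7.periodIntegrand τ j) (Set.Ioi 0)) ∧
    MockTheta7.F7 τ -
        (1 / MockTheta7.csqrt (-I * τ)) • (MockTheta7.M7.mulVec (MockTheta7.F7 (-1 / τ))) =
      (I * (Real.sqrt 21 : ℂ)) • MockTheta7.periodIntegral τ ∧
    MockTheta7.F7 (τ + 1) = MockTheta7.T7.mulVec (MockTheta7.F7 τ) :=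
  ⟨MockTheta7.integrableOn_periodIntegrand hτ, funext fun j => MockTheta7.F7_sub_inv hτ j,
    MockTheta7.F7_add_one τ⟩
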